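/- Let $\Phi(X,Y)=\log(\exp(X)\exp(Y))=\sum_{n\ge 1}u_n(X,Y)\in\mathbb{Q}\langle\!\langle X,Y\rangle\!\rangle$ be the Hausdorff series in two non-commuting variables, where $u_n$ is its homogeneous part of total degree $n$, which is a Lie polynomial with rational coefficients. For an integer $c\ge 0$ put $\Phi_c=\sum_{n=1}^{c}u_n$, and let $m(c)$ be the least common denominator of the coefficients of $u_1,\dots,u_c$, i.e. the least positive integer $m$ such that $m\,u_1,\dots,m\,u_c$ are Lie polynomials with integer coefficients (elements of the free Lie ring over $\mathbb{Z}$ on $X,Y$). Let $\Lambda$ be a $\mathbb{Z}$-Lie lattice, i.e. a Lie ring whose additive group is free abelian of finite rank, and suppose that $\Lambda$ is nilpotent of class $c$. Put $m=m(c)$. Then $x*y=\Phi_c(x,y)$, evaluated in $\mathbb{Q}\otimes_{\mathbb{Z}}\Lambda\supseteq\Lambda$, defines a group structure on the set $m\Lambda$, and the group $\Gamma=\mathsf{exp}(m\Lambda)=(m\Lambda,*)$ is a torsion-free finitely generated nilpotent group of class $c$. Moreover, let $p$ be a prime with $p\nmid m$, and let $\widehat{\Gamma}_p=\varprojlim\Gamma/N$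 be the pro-$p$ completion of $\Gamma$, where $N$ runs over the normal subgroups of $\Gamma$ of $p$-power index. For a group $G$ and $n\ge 1$ let $a_n^{\mathrm{iso}}(G)$ be the number of subgroups $H\le G$ of index $n$ with $H\cong G$; for the $\mathbb{Z}_p$-Lie lattice $L=\mathbb{Z}_p\otimes_{\mathbb{Z}}\Lambda$ let $a_n^{\mathrm{iso}}(L)$ be the number of $\mathbb{Z}_p$-Lie sublattices $M\le L$ of index $n$ with $M\cong L$ as $\mathbb{Z}_p$-Lie lattices. Let $\zeta^{\mathrm{iso}}_{\bullet}(s)=\sum_{n\ge1}a_n^{\mathrm{iso}}(\bullet)\,n^{-s}$ be the corresponding isomorphic zeta functions. Then $$\zeta^{\mathrm{iso}}_{\widehat{\Gamma}_p}(s)=\zeta^{\mathrm{iso}}_{\mathbb{Z}_p\otimes_{\mathbb{Z}}\Lambda}(s)$$ as Dirichlet series, that is, for every $n\ge1$ the numbers $a_n^{\mathrm{iso}}(\widehat{\Gamma}_p)$ and $a_n^{\mathrm{iso}}(\mathbb{Z}_p\otimes_{\mathbb{Z}}\Lambda)$ are finite and equal (and hence so are the functions of $s$). This holds both when subgroups of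 $\widehat{\Gamma}_p$ and their isomorphisms are understood abstractly and when they are understood as open subgroups and isomorphisms of topological groups. -/

import Mathlib

open scoped TensorProduct

noncomputable section

/-! ### The Hausdorff series

The ring `ℚ⟨⟨X, Y⟩⟩` of formal power series in two non-commuting variables is the product of its
homogeneous parts by total degree.  A series is written here as a power series in a central variable `t` over the
polynomial ring `ℚ⟨X, Y⟩`, the coefficient of `t ^ n` being its homogeneous part of total
degree `n`; the variables themselves become `t X` and `t Y`. -/

/-- The ring `ℚ⟨X, Y⟩` of polynomials in two non-commuting variables. -/
abbrev NCPoly : Type := FreeAlgebra ℚ (Fin 2)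

/-- `exp (t a) = ∑ n, aⁿ / n! tⁿ`. -/
def gradedExp (a : NCPoly) : PowerSeries NCPoly :=
  PowerSeries.mk fun n => ((n.factorial : ℚ)⁻¹) • a ^ n

/-- `log Z = ∑ k ≥ 1, (-1) ^ (k + 1) (Z - 1) ^ k / k` for a series `Z` with constant coefficient
`1`. As `(Z - 1) ^ k` is divisible by `t ^ k`, only the terms with `k ≤ n` contribute to the
coefficient of `t ^ n`. -/
def gradedLog (Z : PowerSeries NCPoly) : PowerSeries NCPoly :=
  PowerSeries.mk fun n =>
    ∑ k ∈ Finset.Icc 1 n, ((-1 : ℚ) ^ (k + 1) / (k : ℚ)) • PowerSeries.coeff n ((Z - 1) ^ k)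

/-- The Hausdorff series `Φ(X, Y) = log (exp X exp Y)`. -/
def hausdorffSeries : PowerSeries NCPoly :=
  gradedLog (gradedExp (FreeAlgebra.ι ℚ 0) * gradedExp (FreeAlgebra.ι ℚ 1))

/-- Lie polynomials in `X, Y` with rational coefficients: the free Lie algebra over `ℚ`. -/
abbrev LiePoly : Type := FreeLieAlgebra ℚ (Fin 2)

section expand

attribute [local instance 100] LieRing.ofAssociativeRing

/-- The expansion of a Lie polynomial as a non-commutative polynomial, by `[a, b] = a b - b a`. -/
def LiePoly.expand : LiePoly →ₗ⁅ℚ⁆ NCPoly :=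
  FreeLieAlgebra.lift ℚ (FreeAlgebra.ι ℚ)

end expand

/-- `u_n(X, Y)`: the Lie polynomial that is the homogeneous part of total degree `n` of the
Hausdorff series. It exists by the Campbell-Baker-Hausdorff theorem, and it is unique because
`LiePoly.expand` is injective. -/
def hausdorffTerm (n : ℕ) : LiePoly :=
  Classical.epsilon fun u : LiePoly => LiePoly.expand u = PowerSeries.coeff n hausdorffSeries

/-- A Lie polynomial has integral coefficients if it is the image of an element of the free Lie
ring over `ℤ`, that is, if its coefficients with respect to one (equivalently, every) `ℤ`-basis of
that ring, such as a Hall basis, are integers. -/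
def LiePoly.IsIntegral (u : LiePoly) : Prop :=
  ∃ v : FreeLieAlgebra ℤ (Fin 2), FreeLieAlgebra.lift ℤ (FreeLieAlgebra.of ℚ) v = u

/-- `m(c)`: the least common denominator of the coefficients of `u_1, …, u_c`. -/
def hausdorffDenom (c : ℕ) : ℕ :=
  sInf {m : ℕ | 0 < m ∧ ∀ n ∈ Finset.Icc 1 c, ((m : ℚ) • hausdorffTerm n).IsIntegral}

/-- The value `Φ_c(x, y) = ∑ n ≤ c, u_n(x, y)` of the truncated Hausdorff series at two elements of
a Lie algebra over `ℚ`. -/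
def truncatedHausdorff {L : Type*} [LieRing L] [LieAlgebra ℚ L] (c : ℕ) (x y : L) : L :=
  ∑ n ∈ Finset.Icc 1 c, FreeLieAlgebra.lift ℚ ![x, y] (hausdorffTerm n)

/-! ### The underlying set of `exp (m Λ)` -/

/-- The set `m(c) Λ`, on which the group `exp (m(c) Λ)` lives. -/
def ExpLattice (Λ : Type*) [LieRing Λ] (c : ℕ) : Type _ :=
  {x : Λ // ∃ y : Λ, x = hausdorffDenom c • y}

/-- A group structure on `m(c) Λ` is that of `exp (m(c) Λ)` if its product is `x * y = Φ_c(x, y)`,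
the right-hand side being evaluated in the Lie algebra `ℚ ⊗ Λ`, into which a Lie lattice `Λ`
embeds. -/
def IsExpGroup (Λ : Type*) [LieRing Λ] (c : ℕ) (_ : Group (ExpLattice Λ c)) : Prop :=
  ∀ x y : ExpLattice Λ c,
    ((1 : ℚ) ⊗ₜ[ℤ] (x * y).val : ℚ ⊗[ℤ] Λ) =
      truncatedHausdorff c ((1 : ℚ) ⊗ₜ[ℤ] x.val) ((1 : ℚ) ⊗ₜ[ℤ] y.val)

/-! ### The pro-`p` completion -/

/-- The normal subgroups of `p`-power index. -/
abbrev PIndexSubgroup (p : ℕ) (Γ : Type*) [Group Γ] : Type _ :=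
  {N : Subgroup Γ // N.Normal ∧ ∃ k : ℕ, N.index = p ^ k}

instance (p : ℕ) (Γ : Type*) [Group Γ] (N : PIndexSubgroup p Γ) : N.val.Normal := N.2.1

/-- The pro-`p` completion of `Γ`: the inverse limit of the quotients `Γ ⧸ N` over all normal
subgroups `N` of `p`-power index, as the group of compatible families in their product. -/
def proPCompletion (p : ℕ) (Γ : Type*) [Group Γ] :
    Subgroup (∀ N : PIndexSubgroup p Γ, Γ ⧸ N.val) where
  carrier := {f | ∀ (N M : PIndexSubgroup p Γ) (h : N.val ≤ M.val),
    QuotientGroup.map N.val M.val (MonoidHom.id Γ) h (f N) = f M}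
  mul_mem' := by
    intro f g hf hg N M h
    rw [Pi.mul_apply, Pi.mul_apply, map_mul, hf N M h, hg N M h]
  one_mem' := by
    intro N M h
    rw [Pi.one_apply, Pi.one_apply, map_one]
  inv_mem' := by
    intro f hf N M h
    rw [Pi.inv_apply, Pi.inv_apply, map_inv, hf N M h]

/-- The profinite topology on the pro-`p` completion: the subspace topology of the product
topology, each finite quotient being discrete. -/
instance proPCompletion.instTopologicalSpace (p : ℕ) (Γ : Type*) [Group Γ] :
    TopologicalSpace (proPCompletion p Γ) :=
  TopologicalSpace.induced Subtype.val
    (@Pi.topologicalSpace (PIndexSubgroup p Γ) (fun N => Γ ⧸ N.val) fun _ => ⊥)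

/-! ### Isomorphic zeta functions -/

/-- The subgroups of index `n` of `G` that are isomorphic to `G`. -/
def isoSubgroups (G : Type*) [Group G] (n : ℕ) : Set (Subgroup G) :=
  {H | H.index = n ∧ Nonempty (H ≃* G)}

/-- The open subgroups of index `n` of `G` that are isomorphic to `G` as topological groups. -/
def topIsoSubgroups (G : Type*) [Group G] [TopologicalSpace G] (n : ℕ) : Set (Subgroup G) :=
  {H | IsOpen (H : Set G) ∧ H.index = n ∧ Nonempty (H ≃ₜ* G)}

/-- The Lie sublattices of index `n` of the `R`-Lie lattice `L` that are isomorphic to `L`. -/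
def isoSublattices (R L : Type*) [CommRing R] [LieRing L] [LieAlgebra R L] (n : ℕ) :
    Set (LieSubalgebra R L) :=
  {M | M.toSubmodule.toAddSubgroup.index = n ∧ Nonempty (M ≃ₗ⁅R⁆ L)}

/-- The isomorphic zeta function `∑ n ≥ 1, aₙ / n ^ s` of a group. -/
def groupIsoZeta (G : Type*) [Group G] (s : ℂ) : ℂ :=
  LSeries (fun n => ((isoSubgroups G n).ncard : ℂ)) s

/-- The isomorphic zeta function of a topological group, counting open subgroups that are
topologically isomorphic to the group. -/
def topGroupIsoZeta (G : Type*) [Group G] [TopologicalSpace G] (s : ℂ) : ℂ :=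
  LSeries (fun n => ((topIsoSubgroups G n).ncard : ℂ)) s

/-- The isomorphic zeta function `∑ n ≥ 1, aₙ / n ^ s` of an `R`-Lie lattice. -/
def lieIsoZeta (R L : Type*) [CommRing R] [LieRing L] [LieAlgebra R L] (s : ℂ) : ℂ :=
  LSeries (fun n => ((isoSublattices R L n).ncard : ℂ)) s

end

/-! Put `m = m(c)`. As `m u_n` is integral, so is `m ^ (n - 1) u_n` for `n ≥ 2`, and `m⁻¹ Φ_c(m a, m
b)` is an integral Lie polynomial, called `bch`. The bijection `a ↦ m a` moves the group from `m Λ`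
to `Λ`, and the same formula gives a product on `L = ℤ_[p] ⊗ Λ`.

That this is a group law needs two facts. The `u_n` are Lie polynomials
(`coeff_hausdorffSeries_mem_range`): applying `t d/dt` to `exp Z = exp (tX) exp (tY)` expresses `n
u_n` by commutators of lower terms. And `Φ_c` is associative in class at most `c`
(`truncatedHausdorff_assoc`): in the free Lie algebra on three letters the defect has no terms of
degree at most `c`, so by Dynkin's operator it lies deep in the lower central series.

Since `u_n` is homogeneous, `u_1 = x + y` and `u_2 = [x, y] / 2`, addition and bracket are recovered
from the product through arguments `t a`, `t b`. For the class, comparison of coefficients of `t ^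
2` identifies the upper central series of group and Lie ring (`map_mem_upperCentralSeries`). Over
`ℤ_[p]` one lets `t = p ^ k → 0`: `bch (t a) (t b) / t → a + b`, and the difference of the two
orders, divided by `t ^ 2`, tends to `m [a, b]`. Hence group endomorphisms of the completion are Lie
endomorphisms (`bchHom`).

The pro-`p` completion is `L` with the product `bch` (`padicExpEquiv`), because the subgroups on `p
^ k Λ` are cofinal. An isomorphism of the completion with a subgroup `H` is then an injective Lie
endomorphism of `L` with image `H`, so isomorphic subgroups and isomorphic sublattices are the same
sets (`isoSubgroups_eq_image`), with the same index. Subgroups of finite index contain some `p ^ s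
L`, whence openness and continuity are automatic. -/

noncomputable section

set_option linter.unusedSectionVars false

/-! ### Lie polynomials inside the free associative algebra -/

namespace FreeLieAlgebra

attribute [local instance 100] LieRing.ofAssociativeRing

variable {X : Type*}

/-- The canonical map from the free Lie algebra to the free associative algebra. -/
def toFreeAlgebra (X : Type*) : FreeLieAlgebra ℚ X →ₗ⁅ℚ⁆ FreeAlgebra ℚ X :=
  lift ℚ (FreeAlgebra.ι ℚ)

@[simp] theorem toFreeAlgebra_of (x : X) : toFreeAlgebra X (of ℚ x) = FreeAlgebra.ι ℚ x :=
  lift_of_apply _ _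

/-- The universal property gives a retraction onto `K`. This serves as the induction principle for
Lie polynomials: a property is packaged as a Lie subalgebra and checked on the variables. -/
theorem lieSubalgebra_eq_top {R : Type*} [CommRing R] (K : LieSubalgebra R (FreeLieAlgebra R X))
    (h : ∀ x, of R x ∈ K) : K = ⊤ := by
  have : K.incl.comp (lift R (fun x => (⟨of R x, h x⟩ : K))) = LieHom.id := by
    ext x; simp
  rw [eq_top_iff]
  intro u _
  have h2 := congrArg (fun f => f u) this
  simp only [LieHom.comp_apply, LieHom.id_apply] at h2
  rw [← h2]
  exact (lift R (fun x => (⟨of R x, h x⟩ : K)) u).2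

/-- The span of the variables in the free associative algebra. -/
def vars (X : Type*) : Submodule ℚ (FreeAlgebra ℚ X) := Submodule.span ℚ (Set.range (FreeAlgebra.ι ℚ))

/-- The substitution `x ↦ t x`. -/
def grading (X : Type*) : FreeAlgebra ℚ X →ₐ[ℚ] PowerSeries (FreeAlgebra ℚ X) :=
  FreeAlgebra.lift ℚ (fun x => PowerSeries.monomial 1 (FreeAlgebra.ι ℚ x))

theorem grading_of_mem_pow {n : ℕ} {a : FreeAlgebra ℚ X} (h : a ∈ vars X ^ n) :
    grading X a = PowerSeries.monomial n a := by
  induction n generalizing a with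
  | zero =>
    rw [pow_zero, Submodule.mem_one] at h
    obtain ⟨y, rfl⟩ := h
    rw [AlgHom.commutes, PowerSeries.algebraMap_apply, PowerSeries.monomial_zero_eq_C]
  | succ n ih =>
    rw [pow_succ'] at h
    induction h using Submodule.mul_induction_on' with
    | mem_mul_mem a ha b hb =>
      rw [map_mul, ih hb, add_comm, ← PowerSeries.monomial_mul_monomial]
      congr 1
      induction ha using Submodule.span_induction with
      | mem x hx => obtain ⟨x, rfl⟩ := hx; simp [grading]
      | zero => simp
      | add x y _ _ h1 h2 => simp [h1, h2]
      | smul c x _ h1 => simp [h1]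
    | add a _ b _ h1 h2 => simp [h1, h2]

/-- The generators act on `F × ℚ` by `x (u, s) = ([x, u] + s x, 0)`. -/
def dynkinRep (X : Type*) :
    FreeAlgebra ℚ X →ₐ[ℚ] Module.End ℚ (FreeLieAlgebra ℚ X × ℚ) :=
  FreeAlgebra.lift ℚ fun x =>
    LinearMap.prod
      ((LieAlgebra.ad ℚ (FreeLieAlgebra ℚ X) (of ℚ x) : FreeLieAlgebra ℚ X →ₗ[ℚ] FreeLieAlgebra ℚ X)
        ∘ₗ LinearMap.fst ℚ _ _ + (LinearMap.toSpanSingleton ℚ _ (of ℚ x)) ∘ₗ LinearMap.snd ℚ _ _) 0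

/-- Right-normed bracketing `x₁ ⋯ xₙ ↦ [x₁, [x₂, ⋯ xₙ]]`. -/
def dynkin (X : Type*) : FreeAlgebra ℚ X →ₗ[ℚ] FreeLieAlgebra ℚ X :=
  LinearMap.fst ℚ _ _ ∘ₗ (LinearMap.applyₗ ((0, 1) : FreeLieAlgebra ℚ X × ℚ)) ∘ₗ
    (dynkinRep X).toLinearMap

theorem dynkin_apply (a : FreeAlgebra ℚ X) : dynkin X a = (dynkinRep X a (0, 1)).1 := rfl

/-- On the first coordinate a Lie element must act by its adjoint action, as the variables do so and
the Jacobi identity passes this to brackets. The coordinate `ℚ` stands for the empty word. -/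
theorem dynkinRep_toFreeAlgebra (u : FreeLieAlgebra ℚ X) (v : FreeLieAlgebra ℚ X) (s : ℚ) :
    dynkinRep X (toFreeAlgebra X u) (v, s) = (⁅u, v⁆ + s • dynkin X (toFreeAlgebra X u), 0) := by
  let K : LieSubalgebra ℚ (FreeLieAlgebra ℚ X) :=
    { carrier := {u | ∀ v s, dynkinRep X (toFreeAlgebra X u) (v, s) =
        (⁅u, v⁆ + s • dynkin X (toFreeAlgebra X u), 0)}
      add_mem' := by
        intro a b ha hb v s
        rw [map_add, map_add, LinearMap.add_apply, ha, hb, map_add, add_lie]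
        ext <;> simp; abel
      zero_mem' := by intro v s; simp; rfl
      smul_mem' := by
        intro c a ha v s
        rw [map_smul, map_smul, LinearMap.smul_apply, ha, map_smul]
        ext
        · simp [smul_comm c s]
        · simp
      lie_mem' := by
        intro a b ha hb v s
        have e1 : dynkinRep X (toFreeAlgebra X ⁅a, b⁆) =
            dynkinRep X (toFreeAlgebra X a) * dynkinRep X (toFreeAlgebra X b)
            - dynkinRep X (toFreeAlgebra X b) * dynkinRep X (toFreeAlgebra X a) := by
          rw [LieHom.map_lie, LieRing.of_associative_ring_bracket, map_sub, map_mul, map_mul]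
        have e2 : ∀ v s, dynkinRep X (toFreeAlgebra X ⁅a, b⁆) (v, s) =
            (⁅⁅a, b⁆, v⁆ + s • (⁅a, dynkin X (toFreeAlgebra X b)⁆
              - ⁅b, dynkin X (toFreeAlgebra X a)⁆), 0) := by
          intro v s
          rw [Set.mem_ofPred_eq] at ha hb
          rw [e1]
          simp only [LinearMap.sub_apply, Module.End.mul_apply, ha, hb]
          ext
          · simp [lie_lie, smul_sub]; abel
          · simp
        -- Evaluating `e2` at `(0, 1)` identifies the coefficient of `s` with the Dynkin image of
        -- the bracket.
        rw [e2, dynkin_apply (toFreeAlgebra X ⁅a, b⁆), e2]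
        simp }
  have hK : K = ⊤ := by
    apply lieSubalgebra_eq_top
    intro x v s
    simp [dynkin_apply, dynkinRep]
  exact (hK ▸ LieSubalgebra.mem_top u : u ∈ K) v s

/-- Bracketing an expanded Lie polynomial is thus a derivation that fixes the variables; on degree
`n` it is multiplication by `n` (Dynkin–Specht–Wever). -/
theorem dynkin_lie (u v : FreeLieAlgebra ℚ X) : dynkin X (toFreeAlgebra X ⁅u, v⁆) =
    ⁅u, dynkin X (toFreeAlgebra X v)⁆ - ⁅v, dynkin X (toFreeAlgebra X u)⁆ := by
  conv_lhs => rw [dynkin_apply, LieHom.map_lie, LieRing.of_associative_ring_bracket, map_sub, map_mul, map_mul]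
  simp only [LinearMap.sub_apply, Module.End.mul_apply, dynkinRep_toFreeAlgebra]
  simp

@[simp] theorem dynkin_of (x : X) : dynkin X (FreeAlgebra.ι ℚ x) = of ℚ x := by
  simp [dynkin_apply, dynkinRep, LinearMap.toSpanSingleton_apply]

/-- Homogeneous Lie polynomials of degree `n + 1`. -/
def homog (X : Type*) (n : ℕ) : Submodule ℚ (FreeLieAlgebra ℚ X) where
  carrier := {u | u ∈ LieModule.lowerCentralSeries ℚ (FreeLieAlgebra ℚ X) (FreeLieAlgebra ℚ X) n ∧
    toFreeAlgebra X u ∈ vars X ^ (n + 1) ∧ dynkin X (toFreeAlgebra X u) = ((n + 1 : ℕ) : ℚ) • u}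
  add_mem' := by
    rintro a b ⟨h1, h2, h3⟩ ⟨k1, k2, k3⟩
    refine ⟨add_mem h1 k1, ?_, ?_⟩
    · rw [map_add]; exact add_mem h2 k2
    · rw [map_add, map_add, h3, k3, smul_add]
  zero_mem' := by simp
  smul_mem' := by
    rintro c a ⟨h1, h2, h3⟩
    refine ⟨Submodule.smul_mem _ c h1, ?_, ?_⟩
    · rw [map_smul]; exact Submodule.smul_mem _ c h2
    · rw [map_smul, map_smul, h3, smul_comm]

theorem ι_mem_vars (x : X) : FreeAlgebra.ι ℚ x ∈ vars X := Submodule.subset_span ⟨x, rfl⟩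

theorem of_mem_homog (x : X) : of ℚ x ∈ homog X 0 := by
  refine ⟨by simp, by simpa using ι_mem_vars x, by simp⟩

theorem lie_of_mem_homog {n : ℕ} (x : X) {u : FreeLieAlgebra ℚ X} (h : u ∈ homog X n) :
    ⁅of ℚ x, u⁆ ∈ homog X (n + 1) := by
  obtain ⟨h1, h2, h3⟩ := h
  refine ⟨?_, ?_, ?_⟩
  · rw [LieModule.lowerCentralSeries_succ]
    exact LieSubmodule.lie_mem_lie (LieSubmodule.mem_top _) h1
  · rw [LieHom.map_lie, LieRing.of_associative_ring_bracket, toFreeAlgebra_of]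
    apply sub_mem
    · rw [pow_succ']; exact Submodule.mul_mem_mul (ι_mem_vars x) h2
    · rw [pow_succ]; exact Submodule.mul_mem_mul h2 (ι_mem_vars x)
  · rw [dynkin_lie, h3, toFreeAlgebra_of, dynkin_of, ← lie_skew u, lie_smul, sub_neg_eq_add]
    push_cast
    simp only [add_smul, one_smul]

/-- Only brackets with a variable on the left are known to respect `homog`. By Jacobi, the elements
whose adjoint action preserves the sum form a Lie subalgebra, so all do, and the sum is itself a Lie
subalgebra. -/
theorem iSup_homog : ⨆ n, homog X n = ⊤ := by
  set M : Submodule ℚ (FreeLieAlgebra ℚ X) := ⨆ n, homog X n with hM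
  let N : LieSubalgebra ℚ (FreeLieAlgebra ℚ X) :=
    { carrier := {u | ∀ v ∈ M, ⁅u, v⁆ ∈ M}
      add_mem' := by intro a b ha hb v hv; rw [add_lie]; exact add_mem (ha v hv) (hb v hv)
      zero_mem' := by intro v _; simp
      smul_mem' := by intro c a ha v hv; rw [smul_lie]; exact Submodule.smul_mem _ c (ha v hv)
      lie_mem' := by
        intro a b ha hb v hv; rw [lie_lie]
        exact sub_mem (ha _ (hb v hv)) (hb _ (ha v hv)) }
  have hN : N = ⊤ := by
    apply lieSubalgebra_eq_top
    intro x v hv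
    have : M ≤ M.comap (LieAlgebra.ad ℚ (FreeLieAlgebra ℚ X) (of ℚ x) : _ →ₗ[ℚ] _) := by
      rw [hM, iSup_le_iff]
      intro n u hu
      exact Submodule.mem_iSup_of_mem (n + 1) (lie_of_mem_homog x hu)
    exact this hv
  let M' : LieSubalgebra ℚ (FreeLieAlgebra ℚ X) :=
    { M with lie_mem' := fun {a b} _ hb => (hN ▸ LieSubalgebra.mem_top a : a ∈ N) b hb }
  have : M' = ⊤ := by
    apply lieSubalgebra_eq_top
    intro x
    exact Submodule.mem_iSup_of_mem 0 (of_mem_homog x)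
  rw [eq_top_iff]
  intro u _
  exact (this ▸ LieSubalgebra.mem_top u : u ∈ M')

theorem exists_homog_decomposition (u : FreeLieAlgebra ℚ X) :
    ∃ f : ℕ →₀ FreeLieAlgebra ℚ X, (∀ n, f n ∈ homog X n) ∧ (f.sum fun _ x => x) = u := by
  have : u ∈ ⨆ n, homog X n := by rw [iSup_homog]; trivial
  exact (Submodule.mem_iSup_iff_exists_finsupp _ _).1 this

theorem eq_zero_of_mem_homog {n : ℕ} {u : FreeLieAlgebra ℚ X} (h : u ∈ homog X n)
    (h0 : toFreeAlgebra X u = 0) : u = 0 := by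
  have := h.2.2
  rw [h0, map_zero] at this
  exact (smul_eq_zero.1 this.symm).resolve_left (by positivity)

theorem coeff_grading_decomposition (f : ℕ →₀ FreeLieAlgebra ℚ X) (hf : ∀ n, f n ∈ homog X n)
    (n : ℕ) : PowerSeries.coeff (n + 1) (grading X (toFreeAlgebra X (f.sum fun _ x => x))) =
      toFreeAlgebra X (f n) := by
  rw [Finsupp.sum, map_sum, map_sum, map_sum]
  have : ∀ i ∈ f.support, PowerSeries.coeff (n + 1) (grading X (toFreeAlgebra X (f i))) =
      if n = i then toFreeAlgebra X (f i) else 0 := by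
    intro i _
    rw [grading_of_mem_pow (hf i).2.1, PowerSeries.coeff_monomial]
    simp
  rw [Finset.sum_congr rfl this, Finset.sum_ite_eq]
  split_ifs with h
  · rfl
  · rw [Finsupp.notMem_support_iff.1 h, map_zero]

/-- A Lie polynomial without terms of degree at most `c` lies in the corresponding term of the
lower central series. -/
theorem mem_lowerCentralSeries_of_grading {c : ℕ} {u : FreeLieAlgebra ℚ X}
    (h : ∀ n ≤ c, PowerSeries.coeff n (grading X (toFreeAlgebra X u)) = 0) :
    u ∈ LieModule.lowerCentralSeries ℚ (FreeLieAlgebra ℚ X) (FreeLieAlgebra ℚ X) c := by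
  obtain ⟨f, hf, rfl⟩ := exists_homog_decomposition u
  refine sum_mem fun n _ => ?_
  by_cases hn : n + 1 ≤ c
  · have := h _ hn
    rw [coeff_grading_decomposition f hf] at this
    rw [eq_zero_of_mem_homog (hf n) this]
    exact zero_mem _
  · exact LieModule.antitone_lowerCentralSeries ℚ _ _ (by omega) (hf n).1

/-- Each homogeneous component is recovered from its expansion by Dynkin's operator, up to the
nonzero factor `n + 1`. -/
theorem toFreeAlgebra_injective : Function.Injective (toFreeAlgebra X) := by
  rw [injective_iff_map_eq_zero]
  intro u hu
  obtain ⟨f, hf, rfl⟩ := exists_homog_decomposition u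
  refine Finset.sum_eq_zero fun n _ => eq_zero_of_mem_homog (hf n) ?_
  rw [← coeff_grading_decomposition f hf n, hu]
  simp

theorem mem_homog_of_toFreeAlgebra {n : ℕ} {u : FreeLieAlgebra ℚ X}
    (h : toFreeAlgebra X u ∈ vars X ^ (n + 1)) : u ∈ homog X n := by
  obtain ⟨f, hf, hu⟩ := exists_homog_decomposition u
  have : f n = u := by
    apply toFreeAlgebra_injective
    rw [← coeff_grading_decomposition f hf n, hu, grading_of_mem_pow h, PowerSeries.coeff_monomial_same]
  rw [← this]; exact hf n

end FreeLieAlgebra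

/-! ### Truncated exponential and logarithm -/

open Polynomial in
/-- The truncated exponential `∑ k ≤ N, T ^ k / k!`. -/
def expTrunc (N : ℕ) : ℚ[X] := ∑ k ∈ Finset.range (N + 1), C ((k.factorial : ℚ)⁻¹) * X ^ k

open Polynomial in
/-- The truncated logarithm `∑ 1 ≤ k ≤ N, (-1) ^ (k + 1) T ^ k / k` of `1 + T`. -/
def logTrunc (N : ℕ) : ℚ[X] := ∑ k ∈ Finset.Icc 1 N, C ((-1 : ℚ) ^ (k + 1) / (k : ℚ)) * X ^ k

namespace Polynomial

theorem coeff_expTrunc (N n : ℕ) :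
    (expTrunc N).coeff n = if n ≤ N then ((n.factorial : ℚ)⁻¹) else 0 := by
  simp [expTrunc, coeff_C_mul, coeff_X_pow]

theorem coeff_logTrunc (N n : ℕ) :
    (logTrunc N).coeff n = if 1 ≤ n ∧ n ≤ N then (-1 : ℚ) ^ (n + 1) / (n : ℚ) else 0 := by
  simp [logTrunc, coeff_C_mul, coeff_X_pow]

theorem derivative_expTrunc (N : ℕ) :
    derivative (expTrunc N) = expTrunc N - C ((N.factorial : ℚ)⁻¹) * X ^ N := by
  ext n
  rw [coeff_derivative, coeff_sub, coeff_C_mul, coeff_X_pow, coeff_expTrunc, coeff_expTrunc]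
  have h1 : (n.factorial : ℚ) ≠ 0 := by positivity
  rcases lt_trichotomy n N with h | rfl | h
  · rw [if_pos (by omega), if_pos (by omega), if_neg (by omega), Nat.factorial_succ]
    push_cast
    field_simp
    simp
  · simp
  · rw [if_neg (by omega), if_neg (by omega), if_neg (by omega)]
    simp

theorem one_add_X_mul_derivative_logTrunc (N : ℕ) :
    (1 + X) * derivative (logTrunc N) = 1 - (-X) ^ N := by
  have h : derivative (logTrunc N) = ∑ k ∈ Finset.range N, (-X) ^ k := by
    ext n
    rw [coeff_derivative, coeff_logTrunc]
    have : ∀ k, ((-X : ℚ[X]) ^ k) = C ((-1) ^ k) * X ^ k := by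
      intro k; rw [neg_pow]; simp
    simp only [this, finsetSum_coeff, coeff_C_mul, coeff_X_pow]
    simp only [mul_ite, mul_one, mul_zero, Finset.sum_ite_eq, Finset.mem_range]
    have h1 : (n : ℚ) + 1 ≠ 0 := by positivity
    by_cases h : n < N
    · rw [if_pos ⟨by omega, by omega⟩, if_pos h]
      push_cast
      field_simp
      ring
    · rw [if_neg (by omega), if_neg h, zero_mul]
  rw [h]
  have := mul_neg_geom_sum (-X : ℚ[X]) N
  rw [← this]; ring

theorem X_dvd_logTrunc (N : ℕ) : X ∣ logTrunc N := by
  rw [X_dvd_iff, coeff_logTrunc]; simp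

theorem X_dvd_expTrunc_sub_one (N : ℕ) : X ∣ expTrunc N - 1 := by
  rw [X_dvd_iff, coeff_sub, coeff_expTrunc]; simp

/-- Both `exp (log (1 + X))` and `1 + X` solve `(1 + X) y' = y` modulo `X ^ N`; the difference has
constant term `0`, and the equation then determines its coefficients recursively. -/
theorem X_pow_dvd_expTrunc_comp_logTrunc (N : ℕ) :
    X ^ (N + 1) ∣ (expTrunc N).comp (logTrunc N) - (1 + X) := by
  set P := (expTrunc N).comp (logTrunc N) with hP
  set Q := P - (1 + X) with hQ
  have h1 : X ^ N ∣ (1 + X) * derivative Q - Q := by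
    have e1 : (1 + X) * derivative Q - Q = (1 + X) * derivative P - P := by
      rw [hQ]; simp; ring
    have e2 : (1 + X) * derivative P =
        (1 - (-X) ^ N) * (P - C ((N.factorial : ℚ)⁻¹) * (logTrunc N) ^ N) := by
      rw [hP, derivative_comp, derivative_expTrunc, ← mul_assoc, one_add_X_mul_derivative_logTrunc]
      simp
    have e3 : X ^ N ∣ (logTrunc N) ^ N := pow_dvd_pow_of_dvd (X_dvd_logTrunc N) N
    obtain ⟨q, hq⟩ := e3
    rw [e1, e2, hq, neg_pow]
    exact ⟨-(-1) ^ N * P - C ((N.factorial : ℚ)⁻¹) * q * (1 - (-1) ^ N * X ^ N), by ring⟩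
  have h0 : Q.coeff 0 = 0 := by
    rw [hQ, hP, coeff_sub, coeff_zero_eq_eval_zero, coeff_zero_eq_eval_zero, eval_comp,
      ← coeff_zero_eq_eval_zero (logTrunc N), coeff_logTrunc]
    simp [← coeff_zero_eq_eval_zero, coeff_expTrunc]
  rw [X_pow_dvd_iff] at h1 ⊢
  intro n hn
  induction n with
  | zero => exact h0
  | succ n ih =>
    have h2 := h1 n (by omega)
    have h3 : ((1 + X) * derivative Q).coeff n = (n + 1) * Q.coeff (n + 1) + n * Q.coeff n := by
      rw [add_mul, one_mul, coeff_add, coeff_derivative]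
      cases n with
      | zero => simp
      | succ n => rw [coeff_X_mul, coeff_derivative]; push_cast; ring
    rw [coeff_sub, h3, ih (by omega)] at h2
    have h4 : (n : ℚ) + 1 ≠ 0 := by positivity
    simpa [h4] using h2

/-- The chain rule gives `E (G' - 1) ≡ 0` modulo `X ^ N`. As `E` has constant term `1` it can be
cancelled, and `G' ≡ 1` is integrated. -/
theorem X_pow_dvd_logTrunc_comp_expTrunc (N : ℕ) :
    X ^ (N + 1) ∣ (logTrunc N).comp (expTrunc N - 1) - X := by
  set E := expTrunc N with hE
  set G := (logTrunc N).comp (E - 1) with hG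
  have h1 : X ^ N ∣ E * (derivative G - 1) := by
    have e1 : E * (derivative (logTrunc N)).comp (E - 1) = 1 - (1 - E) ^ N := by
      have := congrArg (fun q => q.comp (E - 1)) (one_add_X_mul_derivative_logTrunc N)
      simpa using this
    obtain ⟨q, hq⟩ := X_dvd_expTrunc_sub_one N
    rw [← hE] at hq
    have e2 : (1 - E) ^ N = X ^ N * (-q) ^ N := by
      rw [← mul_pow]; congr 1; linear_combination -hq
    have e3 : E * (derivative G - 1) =
        derivative E * (E * (derivative (logTrunc N)).comp (E - 1)) - E := by
      rw [hG, derivative_comp]; simp; ring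
    rw [e3, e1, e2, hE, derivative_expTrunc]
    exact ⟨-C ((N.factorial : ℚ)⁻¹) - (expTrunc N - C ((N.factorial : ℚ)⁻¹) * X ^ N) * (-q) ^ N,
      by ring⟩
  have h2 : IsCoprime (X ^ N) E := by
    apply IsCoprime.pow_left
    obtain ⟨q, hq⟩ := X_dvd_expTrunc_sub_one N
    exact ⟨-q, 1, by linear_combination hq⟩
  have h3 := h2.dvd_of_dvd_mul_left h1
  have h0 : G.coeff 0 = 0 := by
    have e : eval 0 E = 1 := by rw [← coeff_zero_eq_eval_zero, hE, coeff_expTrunc]; simp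
    rw [hG, coeff_zero_eq_eval_zero, eval_comp, eval_sub, e, eval_one, sub_self,
      ← coeff_zero_eq_eval_zero, coeff_logTrunc]
    simp
  rw [X_pow_dvd_iff] at h3 ⊢
  intro n hn
  cases n with
  | zero => simp [h0]
  | succ n =>
    have h4 := h3 n (by omega)
    have h5 : derivative G - 1 = derivative (G - X) := by simp
    rw [h5, coeff_derivative] at h4
    exact (mul_eq_zero.1 h4).resolve_right (by positivity)

section Nilpotent

variable {B : Type*} [Ring B] [Algebra ℚ B] {N : ℕ}

theorem aeval_eq_zero_of_X_pow_dvd {p : ℚ[X]} {a : B} (ha : a ^ (N + 1) = 0) (h : X ^ (N + 1) ∣ p) :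
    aeval a p = 0 := by
  obtain ⟨q, rfl⟩ := h
  simp [ha]

theorem exp_log_of_pow_eq_zero {w : B} (hw : w ^ (N + 1) = 0) :
    aeval (aeval w (logTrunc N)) (expTrunc N) = 1 + w := by
  have := aeval_eq_zero_of_X_pow_dvd hw (X_pow_dvd_expTrunc_comp_logTrunc N)
  rw [map_sub, aeval_comp, sub_eq_zero] at this
  simpa using this

theorem log_exp_of_pow_eq_zero {a : B} (ha : a ^ (N + 1) = 0) :
    aeval (aeval a (expTrunc N) - 1) (logTrunc N) = a := by
  have := aeval_eq_zero_of_X_pow_dvd ha (X_pow_dvd_logTrunc_comp_expTrunc N)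
  rw [map_sub, aeval_comp, sub_eq_zero] at this
  simpa using this

theorem exp_injective_of_pow_eq_zero {a b : B} (ha : a ^ (N + 1) = 0) (hb : b ^ (N + 1) = 0)
    (h : aeval a (expTrunc N) = aeval b (expTrunc N)) : a = b := by
  rw [← log_exp_of_pow_eq_zero ha, h, log_exp_of_pow_eq_zero hb]

end Nilpotent

end Polynomial

/-! ### Evaluation of graded series -/

namespace FreeLieAlgebra

variable {X : Type*}

/-- A power series over the free algebra is graded if its `n`-th coefficient is homogeneous of
degree `n`. -/
def IsGraded (Z : PowerSeries (FreeAlgebra ℚ X)) : Prop :=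
  ∀ n, PowerSeries.coeff n Z ∈ vars X ^ n

theorem IsGraded.sub {Z W : PowerSeries (FreeAlgebra ℚ X)} (hZ : IsGraded Z) (hW : IsGraded W) :
    IsGraded (Z - W) := fun n => by
  rw [map_sub]; exact sub_mem (hZ n) (hW n)

theorem IsGraded.one : IsGraded (1 : PowerSeries (FreeAlgebra ℚ X)) := fun n => by
  rw [PowerSeries.coeff_one]
  split_ifs with h
  · rw [h, pow_zero]; exact Submodule.one_le.1 le_rfl
  · exact zero_mem _

theorem IsGraded.mul {Z W : PowerSeries (FreeAlgebra ℚ X)} (hZ : IsGraded Z) (hW : IsGraded W) :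
    IsGraded (Z * W) := fun n => by
  rw [PowerSeries.coeff_mul]
  refine sum_mem fun p hp => ?_
  rw [← Finset.HasAntidiagonal.mem_antidiagonal.1 hp, pow_add]
  exact Submodule.mul_mem_mul (hZ _) (hW _)

theorem IsGraded.pow {Z : PowerSeries (FreeAlgebra ℚ X)} (hZ : IsGraded Z) (k : ℕ) :
    IsGraded (Z ^ k) := by
  induction k with
  | zero => rw [pow_zero]; exact IsGraded.one
  | succ k ih => rw [pow_succ]; exact ih.mul hZ

variable {B : Type*} [Ring B] [Algebra ℚ B] (f : FreeAlgebra ℚ X →ₐ[ℚ] B) (c : ℕ)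

/-- The value `∑ n ≤ c, f (Z_n)` of a graded series. -/
def evalSeries (Z : PowerSeries (FreeAlgebra ℚ X)) : B :=
  ∑ n ∈ Finset.range (c + 1), f (PowerSeries.coeff n Z)

theorem evalSeries_sub (Z W : PowerSeries (FreeAlgebra ℚ X)) :
    evalSeries f c (Z - W) = evalSeries f c Z - evalSeries f c W := by
  simp [evalSeries]

theorem evalSeries_one : evalSeries f c 1 = 1 := by
  simp only [evalSeries, PowerSeries.coeff_one]
  rw [Finset.sum_eq_single_of_mem 0 (by simp)]
  · simp
  · intro b _ hb; simp [hb]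

variable {f c}

/-- Truncation is multiplicative because `f` kills exactly the surplus terms, those of total degree
above `c`. -/
theorem evalSeries_mul (hf : ∀ n > c, ∀ a ∈ vars X ^ n, f a = 0)
    {Z W : PowerSeries (FreeAlgebra ℚ X)} (hZ : IsGraded Z) (hW : IsGraded W) :
    evalSeries f c (Z * W) = evalSeries f c Z * evalSeries f c W := by
  simp only [evalSeries, PowerSeries.coeff_mul, map_sum, map_mul]
  rw [Finset.sum_mul_sum, ← Finset.sum_product']
  have h : ∀ x ∈ Finset.range (c + 1) ×ˢ Finset.range (c + 1), ¬ (x.1 + x.2 ≤ c) →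
      f (PowerSeries.coeff x.1 Z) * f (PowerSeries.coeff x.2 W) = 0 := by
    intro x _ hx
    rw [← map_mul]
    apply hf (x.1 + x.2) (by omega)
    rw [pow_add]
    exact Submodule.mul_mem_mul (hZ _) (hW _)
  rw [← Finset.sum_filter_add_sum_filter_not _ (fun x : ℕ × ℕ => x.1 + x.2 ≤ c)
    (fun x : ℕ × ℕ => f (PowerSeries.coeff x.1 Z) * f (PowerSeries.coeff x.2 W)),
    Finset.sum_eq_zero (s := Finset.filter (fun x : ℕ × ℕ => ¬ x.1 + x.2 ≤ c) _)
      (fun x hx => h x (Finset.mem_filter.1 hx).1 (Finset.mem_filter.1 hx).2), add_zero]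
  rw [← Finset.sum_fiberwise_of_maps_to (t := Finset.range (c + 1)) (g := fun x : ℕ × ℕ => x.1 + x.2)]
  · refine Finset.sum_congr rfl fun n hn => Finset.sum_congr ?_ fun _ _ => rfl
    ext ⟨i, j⟩
    simp only [Finset.HasAntidiagonal.mem_antidiagonal, Finset.mem_filter, Finset.mem_product, Finset.mem_range] at hn ⊢
    omega
  · intro x hx
    simp only [Finset.mem_filter, Finset.mem_range] at hx ⊢
    omega

theorem evalSeries_pow (hf : ∀ n > c, ∀ a ∈ vars X ^ n, f a = 0)
    {Z : PowerSeries (FreeAlgebra ℚ X)} (hZ : IsGraded Z) (k : ℕ) :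
    evalSeries f c (Z ^ k) = evalSeries f c Z ^ k := by
  induction k with
  | zero => rw [pow_zero, pow_zero, evalSeries_one]
  | succ k ih => rw [pow_succ, pow_succ, evalSeries_mul hf (hZ.pow k) hZ, ih]

end FreeLieAlgebra

theorem PowerSeries.coeff_pow_eq_zero_of_lt {A : Type*} [Ring A] {W : PowerSeries A}
    (h : PowerSeries.coeff 0 W = 0) {n k : ℕ} (hn : n < k) : PowerSeries.coeff n (W ^ k) = 0 := by
  induction k generalizing n with
  | zero => omega
  | succ k ih =>
    rw [pow_succ, PowerSeries.coeff_mul]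
    refine Finset.sum_eq_zero fun p hp => ?_
    have := Finset.HasAntidiagonal.mem_antidiagonal.1 hp
    by_cases h2 : p.2 = 0
    · rw [h2, h, mul_zero]
    · rw [ih (by omega), zero_mul]

section Hausdorff

open FreeLieAlgebra Polynomial

variable {B : Type*} [Ring B] [Algebra ℚ B] {f : NCPoly →ₐ[ℚ] B} {c : ℕ}

theorem isGraded_gradedExp (i : Fin 2) : IsGraded (gradedExp (FreeAlgebra.ι ℚ i)) := fun n => by
  rw [gradedExp, PowerSeries.coeff_mk]
  exact Submodule.smul_mem _ _ (Submodule.pow_mem_pow _ (ι_mem_vars i) n)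

theorem coeff_zero_gradedExp (a : NCPoly) : PowerSeries.coeff 0 (gradedExp a) = 1 := by
  rw [gradedExp, PowerSeries.coeff_mk]; simp

theorem evalSeries_gradedExp (a : NCPoly) :
    evalSeries f c (gradedExp a) = aeval (f a) (expTrunc c) := by
  simp [evalSeries, gradedExp, expTrunc, Algebra.smul_def]

theorem isGraded_gradedLog {Z : PowerSeries NCPoly} (hZ : IsGraded Z) : IsGraded (gradedLog Z) :=
  fun n => by
    rw [gradedLog, PowerSeries.coeff_mk]
    exact sum_mem fun k _ => Submodule.smul_mem _ _ ((hZ.sub IsGraded.one).pow k n)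

theorem evalSeries_gradedLog (hf : ∀ n > c, ∀ a ∈ vars (Fin 2) ^ n, f a = 0)
    {Z : PowerSeries NCPoly} (hZ : IsGraded Z) (h0 : PowerSeries.coeff 0 Z = 1) :
    evalSeries f c (gradedLog Z) = aeval (evalSeries f c Z - 1) (logTrunc c) := by
  have hW : PowerSeries.coeff 0 (Z - 1) = 0 := by rw [map_sub, h0]; simp
  have e : ∀ n ∈ Finset.range (c + 1), f (PowerSeries.coeff n (gradedLog Z)) =
      ∑ k ∈ Finset.Icc 1 c, ((-1 : ℚ) ^ (k + 1) / (k : ℚ)) • f (PowerSeries.coeff n ((Z - 1) ^ k)) := by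
    intro n hn
    rw [gradedLog, PowerSeries.coeff_mk, map_sum]
    simp only [map_smul]
    -- The terms with `n < k ≤ c` may be added, since `(Z - 1) ^ k` has no terms of degree below
    -- `k`.
    apply Finset.sum_subset
    · exact Finset.Icc_subset_Icc_right (by simpa [Nat.lt_succ_iff] using hn)
    · intro k h1 h2
      rw [PowerSeries.coeff_pow_eq_zero_of_lt hW, map_zero, smul_zero]
      simp only [Finset.mem_Icc] at h1 h2
      omega
  rw [evalSeries, Finset.sum_congr rfl e, Finset.sum_comm, logTrunc, map_sum]
  refine Finset.sum_congr rfl fun k _ => ?_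
  rw [← Finset.smul_sum]
  change _ • evalSeries f c ((Z - 1) ^ k) = _
  rw [evalSeries_pow hf (hZ.sub IsGraded.one), evalSeries_sub, evalSeries_one]
  simp [Algebra.smul_def]

theorem isGraded_hausdorffSeries : IsGraded hausdorffSeries :=
  isGraded_gradedLog ((isGraded_gradedExp 0).mul (isGraded_gradedExp 1))

theorem coeff_zero_hausdorffSeries : PowerSeries.coeff 0 hausdorffSeries = 0 := by
  rw [hausdorffSeries, gradedLog, PowerSeries.coeff_mk]; simp

/-- This is `exp Φ = exp X exp Y` in any algebra where words longer than `c` vanish; there the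
logarithm is a polynomial in a nilpotent element. -/
theorem exp_evalSeries_hausdorffSeries (hf : ∀ n > c, ∀ a ∈ vars (Fin 2) ^ n, f a = 0) :
    aeval (evalSeries f c hausdorffSeries) (expTrunc c) =
      aeval (f (FreeAlgebra.ι ℚ 0)) (expTrunc c) * aeval (f (FreeAlgebra.ι ℚ 1)) (expTrunc c) := by
  set g := gradedExp (FreeAlgebra.ι ℚ 0) * gradedExp (FreeAlgebra.ι ℚ 1) with hg
  have h0 : PowerSeries.coeff 0 g = 1 := by
    rw [hg, PowerSeries.coeff_mul]
    simp [coeff_zero_gradedExp]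
  have hgr : IsGraded g := (isGraded_gradedExp 0).mul (isGraded_gradedExp 1)
  have hnil : (evalSeries f c g - 1) ^ (c + 1) = 0 := by
    rw [← evalSeries_one f c, ← evalSeries_sub, ← evalSeries_pow hf (hgr.sub IsGraded.one)]
    refine Finset.sum_eq_zero fun n hn => ?_
    rw [PowerSeries.coeff_pow_eq_zero_of_lt _ (Finset.mem_range.1 hn), map_zero]
    rw [map_sub, h0]; simp
  rw [hausdorffSeries, evalSeries_gradedLog hf hgr h0, exp_log_of_pow_eq_zero hnil, hg,
    evalSeries_mul hf (isGraded_gradedExp 0) (isGraded_gradedExp 1), evalSeries_gradedExp,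
    evalSeries_gradedExp]
  abel

end Hausdorff

/-! ### Power series modulo a power of the variable -/

theorem Finset.sum_product_range_of_eq_zero {M : Type*} [AddCommMonoid M] {F : ℕ × ℕ → M}
    {a b N : ℕ} (ha : N ≤ a) (hb : N ≤ b) (hF : ∀ x, N ≤ x.1 + x.2 → F x = 0) :
    ∑ x ∈ Finset.range a ×ˢ Finset.range b, F x =
      ∑ n ∈ Finset.range N, ∑ x ∈ Finset.HasAntidiagonal.antidiagonal n, F x := by
  rw [← Finset.sum_filter_add_sum_filter_not _ (fun x : ℕ × ℕ => x.1 + x.2 < N) F,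
    Finset.sum_eq_zero (s := Finset.filter (fun x : ℕ × ℕ => ¬ x.1 + x.2 < N) _)
      (fun x hx => hF x (not_lt.1 (Finset.mem_filter.1 hx).2)), add_zero,
    ← Finset.sum_fiberwise_of_maps_to (t := Finset.range N) (g := fun x : ℕ × ℕ => x.1 + x.2)]
  · refine Finset.sum_congr rfl fun n hn => Finset.sum_congr ?_ fun _ _ => rfl
    ext ⟨i, j⟩
    simp only [Finset.HasAntidiagonal.mem_antidiagonal, Finset.mem_filter, Finset.mem_product,
      Finset.mem_range] at hn ⊢
    omega
  · intro x hx
    simp only [Finset.mem_filter, Finset.mem_range] at hx ⊢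
    exact hx.2

namespace PowerSeries

variable {A : Type*} [Ring A]

variable (A) in
/-- The power series divisible by `t ^ n`. -/
def lowOrder (n : ℕ) : Ideal (PowerSeries A) where
  carrier := {Z | ∀ j < n, coeff j Z = 0}
  add_mem' := by
    intro a b ha hb j hj
    rw [map_add, ha j hj, hb j hj, add_zero]
  zero_mem' := by intro j _; simp
  smul_mem' := by
    intro a b hb j hj
    rw [smul_eq_mul, coeff_mul]
    refine Finset.sum_eq_zero fun p hp => ?_
    have := Finset.HasAntidiagonal.mem_antidiagonal.1 hp
    rw [hb _ (by omega), mul_zero]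

theorem mem_lowOrder {n : ℕ} {Z : PowerSeries A} : Z ∈ lowOrder A n ↔ ∀ j < n, coeff j Z = 0 :=
  Iff.rfl

theorem mem_lowOrder_one {Z : PowerSeries A} : Z ∈ lowOrder A 1 ↔ coeff 0 Z = 0 := by
  simp [mem_lowOrder]

theorem lowOrder_anti {m n : ℕ} (h : m ≤ n) : lowOrder A n ≤ lowOrder A m :=
  fun _ hZ j hj => hZ j (hj.trans_le h)

theorem mul_mem_lowOrder {m n : ℕ} {Z W : PowerSeries A} (hZ : Z ∈ lowOrder A m)
    (hW : W ∈ lowOrder A n) : Z * W ∈ lowOrder A (m + n) := by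
  intro j hj
  rw [coeff_mul]
  refine Finset.sum_eq_zero fun p hp => ?_
  have := Finset.HasAntidiagonal.mem_antidiagonal.1 hp
  by_cases h : p.1 < m
  · rw [hZ _ h, zero_mul]
  · rw [hW _ (by omega), mul_zero]

theorem pow_mem_lowOrder {Z : PowerSeries A} (hZ : Z ∈ lowOrder A 1) (n : ℕ) :
    Z ^ n ∈ lowOrder A n := by
  induction n with
  | zero => intro j hj; omega
  | succ n ih => rw [pow_succ]; exact mul_mem_lowOrder ih hZ

instance (n : ℕ) : (lowOrder A n).IsTwoSided where
  mul_mem_of_left b ha := by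
    have := mul_mem_lowOrder ha (W := b) (n := 0) (fun j hj => by omega)
    simpa using this

/-- The coefficients of `U` solve a unitriangular system. This cancels a factor `exp Z` without
inverting it. -/
theorem mem_lowOrder_of_mul_mem {n : ℕ} {U V : PowerSeries A} (hV : coeff 0 V = 1)
    (h : U * V ∈ lowOrder A n) : U ∈ lowOrder A n := by
  intro j
  induction j using Nat.strong_induction_on with
  | _ j ih =>
    intro hj
    have := h j hj
    rw [coeff_mul, Finset.sum_eq_single_of_mem (j, 0) (by simp)] at this
    · simpa [hV] using this
    · intro p hp hne
      have h2 := Finset.HasAntidiagonal.mem_antidiagonal.1 hp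
      have : p.1 < j := by
        rcases Nat.lt_or_ge p.1 j with h3 | h3
        · exact h3
        · exact absurd (Prod.ext (by simp; omega) (by simp; omega)) hne
      rw [ih _ this (by omega), zero_mul]

theorem monomial_mem_lowOrder {m n : ℕ} (h : n ≤ m) (a : A) : monomial m a ∈ lowOrder A n := by
  intro j hj
  rw [coeff_monomial, if_neg (by omega)]

/-- The derivation `t d/dt`. -/
def eulerDeriv : PowerSeries A →+ PowerSeries A where
  toFun Z := mk fun n => n • coeff n Z
  map_zero' := by ext; simp
  map_add' := by intro Z W; ext n; simp

theorem coeff_eulerDeriv (n : ℕ) (Z : PowerSeries A) : coeff n (eulerDeriv Z) = n • coeff n Z :=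
  coeff_mk n fun n => n • coeff n Z

theorem eulerDeriv_mul (Z W : PowerSeries A) :
    eulerDeriv (Z * W) = eulerDeriv Z * W + Z * eulerDeriv W := by
  ext n
  rw [coeff_eulerDeriv, map_add, coeff_mul, coeff_mul, coeff_mul, Finset.smul_sum,
    ← Finset.sum_add_distrib]
  refine Finset.sum_congr rfl fun p hp => ?_
  rw [coeff_eulerDeriv, coeff_eulerDeriv, ← Finset.HasAntidiagonal.mem_antidiagonal.1 hp, add_smul,
    smul_mul_assoc, mul_smul_comm]

theorem eulerDeriv_mem_lowOrder {n : ℕ} {Z : PowerSeries A} (h : Z ∈ lowOrder A n) :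
    eulerDeriv Z ∈ lowOrder A n := by
  intro j hj
  rw [coeff_eulerDeriv, h j hj, smul_zero]

theorem coeff_rat_smul [Algebra ℚ A] (n : ℕ) (q : ℚ) (Z : PowerSeries A) :
    coeff n (q • Z) = q • coeff n Z := rfl

theorem eulerDeriv_smul [Algebra ℚ A] (q : ℚ) (Z : PowerSeries A) :
    eulerDeriv (q • Z) = q • eulerDeriv Z := by
  ext n
  simp only [coeff_eulerDeriv, coeff_rat_smul]
  rw [smul_comm]

end PowerSeries

/-! ### Iterated commutators -/

section Commutator

variable {R : Type*} [Ring R]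

/-- The iterated commutator `[a, [a, … [a, w]]]`. -/
def iterComm (a w : R) (k : ℕ) : R := (fun w => a * w - w * a)^[k] w

theorem iterComm_zero (a w : R) : iterComm a w 0 = w := rfl

theorem iterComm_succ (a w : R) (k : ℕ) :
    iterComm a w (k + 1) = a * iterComm a w k - iterComm a w k * a :=
  Function.iterate_succ_apply' _ _ _

/-- Left multiplication by `a` is the sum of two commuting operators, `ad a` and right
multiplication by `a`; this is the binomial theorem for them. -/
theorem pow_mul_eq_sum_iterComm (a w : R) (n : ℕ) :
    a ^ n * w = ∑ k ∈ Finset.range (n + 1), n.choose k • (iterComm a w k * a ^ (n - k)) := by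
  induction n with
  | zero => simp [iterComm_zero]
  | succ n ih =>
    have step : ∀ k ∈ Finset.range (n + 1), a * (n.choose k • (iterComm a w k * a ^ (n - k))) =
        n.choose k • (iterComm a w (k + 1) * a ^ (n - k))
          + n.choose k • (iterComm a w k * a ^ (n + 1 - k)) := by
      intro k hk
      have : n + 1 - k = (n - k) + 1 := by have := Finset.mem_range.1 hk; omega
      rw [this, iterComm_succ, pow_succ' a (n - k), mul_smul_comm, ← smul_add]
      congr 1; noncomm_ring
    rw [pow_succ', mul_assoc, ih, Finset.mul_sum, Finset.sum_congr rfl step,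
      Finset.sum_add_distrib, Finset.sum_range_succ' _ (n + 1)]
    simp only [Nat.choose_succ_succ, add_smul, Finset.sum_add_distrib, Nat.add_sub_add_right]
    rw [add_assoc]
    congr 1
    rw [Finset.sum_range_succ' _ n, Finset.sum_range_succ _ n]
    simp

/-- In the Leibniz expansion of `D (a ^ (n + 1))` all factors `a` are moved to the right; Pascal's
rule collects the resulting commutators. -/
theorem map_pow_eq_sum_iterComm (D : R →+ R) (hD : ∀ x y, D (x * y) = D x * y + x * D y) (a : R)
    (n : ℕ) : D (a ^ (n + 1)) = ∑ k ∈ Finset.range (n + 1),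
      (n + 1).choose (k + 1) • (iterComm a (D a) k * a ^ (n - k)) := by
  induction n with
  | zero => simp [iterComm_zero]
  | succ n ih =>
    have step : ∀ k ∈ Finset.range (n + 1),
        a * ((n + 1).choose (k + 1) • (iterComm a (D a) k * a ^ (n - k))) =
        (n + 1).choose (k + 1) • (iterComm a (D a) (k + 1) * a ^ (n - k))
          + (n + 1).choose (k + 1) • (iterComm a (D a) k * a ^ (n + 1 - k)) := by
      intro k hk
      have : n + 1 - k = (n - k) + 1 := by have := Finset.mem_range.1 hk; omega
      rw [this, iterComm_succ, pow_succ' a (n - k), mul_smul_comm, ← smul_add]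
      congr 1; noncomm_ring
    rw [pow_succ', hD, ih, Finset.mul_sum, Finset.sum_congr rfl step, Finset.sum_add_distrib]
    have e : ∀ k, (n + 1 + 1).choose (k + 1) • (iterComm a (D a) k * a ^ (n + 1 - k)) =
        (n + 1).choose k • (iterComm a (D a) k * a ^ (n + 1 - k)) +
        (n + 1).choose (k + 1) • (iterComm a (D a) k * a ^ (n + 1 - k)) := by
      intro k; rw [Nat.choose_succ_succ, add_smul]
    simp only [e, Finset.sum_add_distrib]
    rw [← add_assoc]
    congr 1
    · rw [Finset.sum_range_succ' _ (n + 1), add_comm]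
      simp [iterComm_zero]
    · rw [Finset.sum_range_succ _ (n + 1)]
      simp

end Commutator

namespace PowerSeries

theorem iterComm_mem_lowOrder {A : Type*} [Ring A] {Z W : PowerSeries A} (hZ : Z ∈ lowOrder A 1) (hW : W ∈ lowOrder A 1)
    (k : ℕ) : iterComm Z W k ∈ lowOrder A (k + 1) := by
  induction k with
  | zero => exact hW
  | succ k ih =>
    rw [iterComm_succ]
    refine sub_mem ?_ (mul_mem_lowOrder ih hZ)
    rw [add_comm]; exact mul_mem_lowOrder hZ ih

variable {A : Type*} [Ring A] [Algebra ℚ A]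

theorem aeval_expTrunc {B : Type*} [Ring B] [Algebra ℚ B] (a : B) (N : ℕ) :
    Polynomial.aeval a (expTrunc N) = ∑ k ∈ Finset.range (N + 1), (k.factorial : ℚ)⁻¹ • a ^ k := by
  simp [expTrunc, Algebra.smul_def]

theorem inv_factorial_mul_choose {n k : ℕ} (h : k ≤ n) :
    (n.factorial : ℚ)⁻¹ * (n.choose k : ℚ) = (k.factorial : ℚ)⁻¹ * ((n - k).factorial : ℚ)⁻¹ := by
  rw [Nat.cast_choose ℚ h]
  have h1 : (n.factorial : ℚ) ≠ 0 := by positivity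
  field_simp

/-- The right-hand side is `(exp (ad Z) - 1) / ad Z` applied to the derivative of `Z`, times
`exp Z`. -/
theorem eulerDeriv_exp_sub_mem {Z : PowerSeries A} (hZ : Z ∈ lowOrder A 1) (N : ℕ) :
    eulerDeriv (Polynomial.aeval Z (expTrunc N)) -
      (∑ k ∈ Finset.range N, ((k + 1).factorial : ℚ)⁻¹ • iterComm Z (eulerDeriv Z) k) *
        Polynomial.aeval Z (expTrunc N) ∈ lowOrder A (N + 1) := by
  set F : ℕ × ℕ → PowerSeries A := fun x =>
    (((x.1 + 1).factorial : ℚ)⁻¹ * (x.2.factorial : ℚ)⁻¹) • (iterComm Z (eulerDeriv Z) x.1 * Z ^ x.2)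
    with hF
  have e1 : eulerDeriv (Polynomial.aeval Z (expTrunc N)) =
      ∑ n ∈ Finset.range N, ∑ x ∈ Finset.HasAntidiagonal.antidiagonal n, F x := by
    rw [aeval_expTrunc, map_sum, Finset.sum_range_succ']
    have h0 : eulerDeriv ((Nat.factorial 0 : ℚ)⁻¹ • Z ^ 0) = 0 := by
      ext n
      rw [coeff_eulerDeriv, coeff_rat_smul, pow_zero, coeff_one]
      split_ifs with h <;> simp [h]
    rw [h0, add_zero]
    refine Finset.sum_congr rfl fun n _ => ?_
    rw [eulerDeriv_smul, map_pow_eq_sum_iterComm _ eulerDeriv_mul, Finset.smul_sum,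
      Finset.Nat.sum_antidiagonal_eq_sum_range_succ_mk]
    refine Finset.sum_congr rfl fun k hk => ?_
    have hk' : k + 1 ≤ n + 1 := by have := Finset.mem_range.1 hk; omega
    rw [← Nat.cast_smul_eq_nsmul ℚ, smul_smul, inv_factorial_mul_choose hk', hF,
      Nat.add_sub_add_right]
  have e2 : (∑ k ∈ Finset.range N, ((k + 1).factorial : ℚ)⁻¹ • iterComm Z (eulerDeriv Z) k) *
        Polynomial.aeval Z (expTrunc N) = ∑ x ∈ Finset.range N ×ˢ Finset.range (N + 1), F x := by
    rw [aeval_expTrunc, Finset.sum_mul_sum, ← Finset.sum_product']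
    refine Finset.sum_congr rfl fun x _ => ?_
    rw [hF, smul_mul_smul_comm]
  rw [e1, e2]
  intro j hj
  rw [map_sub, sub_eq_zero, map_sum, map_sum]
  simp only [map_sum]
  symm
  apply Finset.sum_product_range_of_eq_zero le_rfl (Nat.le_succ N)
  intro x hx
  have hD : eulerDeriv Z ∈ lowOrder A 1 := eulerDeriv_mem_lowOrder hZ
  rw [hF, coeff_rat_smul, mul_mem_lowOrder (iterComm_mem_lowOrder hZ hD x.1) (pow_mem_lowOrder hZ x.2) j
    (by omega), smul_zero]

/-- The identity `exp Z · W · exp (-Z) = exp (ad Z) W`, written without inverses. -/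
theorem exp_mul_sub_mem {Z W : PowerSeries A} (hZ : Z ∈ lowOrder A 1) (hW : W ∈ lowOrder A 1)
    (N : ℕ) : Polynomial.aeval Z (expTrunc N) * W -
      (∑ k ∈ Finset.range (N + 1), (k.factorial : ℚ)⁻¹ • iterComm Z W k) *
        Polynomial.aeval Z (expTrunc N) ∈ lowOrder A (N + 1) := by
  set F : ℕ × ℕ → PowerSeries A := fun x =>
    ((x.1.factorial : ℚ)⁻¹ * (x.2.factorial : ℚ)⁻¹) • (iterComm Z W x.1 * Z ^ x.2) with hF
  have e1 : Polynomial.aeval Z (expTrunc N) * W =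
      ∑ n ∈ Finset.range (N + 1), ∑ x ∈ Finset.HasAntidiagonal.antidiagonal n, F x := by
    rw [aeval_expTrunc, Finset.sum_mul]
    refine Finset.sum_congr rfl fun n _ => ?_
    rw [smul_mul_assoc, pow_mul_eq_sum_iterComm, Finset.smul_sum,
      Finset.Nat.sum_antidiagonal_eq_sum_range_succ_mk]
    refine Finset.sum_congr rfl fun k hk => ?_
    have hk' : k ≤ n := by have := Finset.mem_range.1 hk; omega
    rw [← Nat.cast_smul_eq_nsmul ℚ, smul_smul, inv_factorial_mul_choose hk', hF]
  have e2 : (∑ k ∈ Finset.range (N + 1), (k.factorial : ℚ)⁻¹ • iterComm Z W k) *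
        Polynomial.aeval Z (expTrunc N) = ∑ x ∈ Finset.range (N + 1) ×ˢ Finset.range (N + 1), F x := by
    rw [aeval_expTrunc, Finset.sum_mul_sum, ← Finset.sum_product']
    refine Finset.sum_congr rfl fun x _ => ?_
    rw [hF, smul_mul_smul_comm]
  rw [e1, e2]
  intro j hj
  rw [map_sub, sub_eq_zero, map_sum, map_sum]
  simp only [map_sum]
  symm
  apply Finset.sum_product_range_of_eq_zero le_rfl le_rfl
  intro x hx
  rw [hF, coeff_rat_smul, mul_mem_lowOrder (iterComm_mem_lowOrder hZ hW x.1) (pow_mem_lowOrder hZ x.2) j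
    (by omega), smul_zero]

/-- A series of pure degree one is its own Euler derivative, so it commutes with it and only the
term `k = 0` survives. -/
theorem eulerDeriv_exp_monomial_sub_mem (a : A) {N : ℕ} (hN : 1 ≤ N) :
    eulerDeriv (Polynomial.aeval (monomial 1 a) (expTrunc N)) - monomial 1 a * Polynomial.aeval (monomial 1 a) (expTrunc N)
      ∈ lowOrder A (N + 1) := by
  have h := eulerDeriv_exp_sub_mem (monomial_mem_lowOrder (le_refl 1) a) N
  have hD : eulerDeriv (monomial 1 a) = monomial 1 a := by
    ext n
    rw [coeff_eulerDeriv, coeff_monomial]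
    split_ifs with h <;> simp [h]
  have hk : ∀ k, iterComm (monomial 1 a) (monomial 1 a) (k + 1) = 0 := by
    intro k
    induction k with
    | zero => rw [iterComm_succ, iterComm_zero, sub_self]
    | succ k ih => rw [iterComm_succ, ih]; simp
  obtain ⟨N, rfl⟩ : ∃ M, N = M + 1 := ⟨N - 1, by omega⟩
  rw [hD, Finset.sum_range_succ', Finset.sum_eq_zero (fun k _ => by rw [hk, smul_zero])] at h
  simpa [iterComm_zero] using h

end PowerSeries

/-! ### The Campbell-Baker-Hausdorff theorem -/

namespace FreeLieAlgebra

open PowerSeries (lowOrder mem_lowOrder mem_lowOrder_one)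

variable {X : Type*} {A : Type*} [Ring A] [Algebra ℚ A]

theorem lift_mem_lowOrder {g : X → PowerSeries A} (hg : ∀ x, g x ∈ lowOrder A 1) {n : ℕ}
    {a : FreeAlgebra ℚ X} (ha : a ∈ vars X ^ n) : FreeAlgebra.lift ℚ g a ∈ lowOrder A n := by
  induction n generalizing a with
  | zero => intro j hj; omega
  | succ n ih =>
    rw [pow_succ] at ha
    induction ha using Submodule.mul_induction_on' with
    | mem_mul_mem a ha b hb =>
      rw [map_mul]
      refine PowerSeries.mul_mem_lowOrder (ih ha) ?_
      induction hb using Submodule.span_induction with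
      | mem x hx => obtain ⟨x, rfl⟩ := hx; simpa using hg x
      | zero => simp
      | add x y _ _ h1 h2 => rw [map_add]; exact add_mem h1 h2
      | smul c x _ h1 =>
        rw [map_smul]
        exact Submodule.smul_of_tower_mem _ c h1
    | add a _ b _ h1 h2 => rw [map_add]; exact add_mem h1 h2

variable (A) in
/-- Power series truncated above degree `c`. -/
abbrev Trunc (c : ℕ) : Type _ := PowerSeries A ⧸ lowOrder A (c + 1)

variable (A) in
/-- The truncation map. -/
abbrev toTrunc (c : ℕ) : PowerSeries A →ₐ[ℚ] Trunc A c := Ideal.Quotient.mkₐ ℚ (lowOrder A (c + 1))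

theorem toTrunc_eq_zero {c : ℕ} {Z : PowerSeries A} : toTrunc A c Z = 0 ↔ Z ∈ lowOrder A (c + 1) :=
  Ideal.Quotient.eq_zero_iff_mem

theorem toTrunc_eq {c : ℕ} {Z W : PowerSeries A} :
    toTrunc A c Z = toTrunc A c W ↔ Z - W ∈ lowOrder A (c + 1) :=
  Ideal.Quotient.mk_eq_mk_iff_sub_mem Z W

theorem toTrunc_comp_lift_eq_zero {g : X → PowerSeries A} (hg : ∀ x, g x ∈ lowOrder A 1) (c : ℕ) :
    ∀ n > c, ∀ a ∈ vars X ^ n, ((toTrunc A c).comp (FreeAlgebra.lift ℚ g)) a = 0 := by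
  intro n hn a ha
  rw [AlgHom.comp_apply, toTrunc_eq_zero]
  exact PowerSeries.lowOrder_anti hn (lift_mem_lowOrder hg ha)

end FreeLieAlgebra

section Existence

open FreeLieAlgebra PowerSeries

/-- The evaluated identity is applied to the substitution `x ↦ t x` into truncated power series,
which sends the Hausdorff series to itself. -/
theorem exp_hausdorffSeries_sub_mem (N : ℕ) :
    Polynomial.aeval hausdorffSeries (expTrunc N) -
      Polynomial.aeval (monomial 1 (FreeAlgebra.ι ℚ (0 : Fin 2))) (expTrunc N) *
        Polynomial.aeval (monomial 1 (FreeAlgebra.ι ℚ (1 : Fin 2))) (expTrunc N) ∈ lowOrder NCPoly (N + 1) := by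
  rw [← toTrunc_eq, map_mul, ← Polynomial.aeval_algHom_apply, ← Polynomial.aeval_algHom_apply, ← Polynomial.aeval_algHom_apply]
  have hg : ∀ x : Fin 2, monomial 1 (FreeAlgebra.ι ℚ x) ∈ lowOrder NCPoly 1 := fun x =>
    monomial_mem_lowOrder le_rfl _
  have h := exp_evalSeries_hausdorffSeries (toTrunc_comp_lift_eq_zero hg N)
  rw [AlgHom.comp_apply, AlgHom.comp_apply, FreeAlgebra.lift_ι_apply, FreeAlgebra.lift_ι_apply] at h
  rw [← h]
  congr 2
  rw [evalSeries]
  have : ∀ n ∈ Finset.range (N + 1), ((toTrunc NCPoly N).comp (FreeAlgebra.lift ℚ fun x : Fin 2 =>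
      monomial 1 (FreeAlgebra.ι ℚ x))) (PowerSeries.coeff n hausdorffSeries) =
      toTrunc NCPoly N (monomial n (PowerSeries.coeff n hausdorffSeries)) := by
    intro n _
    rw [AlgHom.comp_apply, ← grading_of_mem_pow (isGraded_hausdorffSeries n)]
    rfl
  rw [Finset.sum_congr rfl this, ← map_sum, toTrunc_eq]
  intro j hj
  rw [map_sub, map_sum, sub_eq_zero, Finset.sum_eq_single_of_mem j (Finset.mem_range.2 hj)]
  · rw [coeff_monomial_same]
  · intro i _ hi
    rw [coeff_monomial, if_neg (Ne.symm hi)]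

theorem coeff_zero_exp {Z : PowerSeries NCPoly} (hZ : Z ∈ lowOrder NCPoly 1) (N : ℕ) :
    PowerSeries.coeff 0 (Polynomial.aeval Z (expTrunc N)) = 1 := by
  rw [aeval_expTrunc, map_sum, Finset.sum_range_succ', Finset.sum_eq_zero]
  · simp
  · intro k _
    rw [coeff_rat_smul, pow_mem_lowOrder hZ (k + 1) 0 (by omega), smul_zero]

theorem hausdorffSeries_mem_lowOrder : hausdorffSeries ∈ lowOrder NCPoly 1 :=
  mem_lowOrder_one.2 coeff_zero_hausdorffSeries

/-- With `D = t d/dt`, differentiating `exp Z = exp a exp b` gives `((exp (ad Z) - 1) / ad Z)(D Z) ·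
exp Z = (a + exp (ad a) b) · exp Z`; then `exp Z` is cancelled. -/
theorem eulerDeriv_hausdorffSeries {N : ℕ} (hN : 1 ≤ N) :
    (∑ k ∈ Finset.range N, ((k + 1).factorial : ℚ)⁻¹ •
        iterComm hausdorffSeries (eulerDeriv hausdorffSeries) k) -
      (monomial 1 (FreeAlgebra.ι ℚ (0 : Fin 2)) +
        ∑ k ∈ Finset.range (N + 1), (k.factorial : ℚ)⁻¹ •
          iterComm (monomial 1 (FreeAlgebra.ι ℚ (0 : Fin 2)))
            (monomial 1 (FreeAlgebra.ι ℚ (1 : Fin 2))) k) ∈ lowOrder NCPoly (N + 1) := by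
  set a : PowerSeries NCPoly := monomial 1 (FreeAlgebra.ι ℚ (0 : Fin 2)) with ha
  set b : PowerSeries NCPoly := monomial 1 (FreeAlgebra.ι ℚ (1 : Fin 2)) with hb
  have hZ := hausdorffSeries_mem_lowOrder
  set Z := hausdorffSeries with hZdef
  have ha1 : a ∈ lowOrder NCPoly 1 := monomial_mem_lowOrder le_rfl _
  have hb1 : b ∈ lowOrder NCPoly 1 := monomial_mem_lowOrder le_rfl _
  have e1 := eulerDeriv_exp_sub_mem hZ N
  have e2 := exp_hausdorffSeries_sub_mem N
  have e2' := eulerDeriv_mem_lowOrder e2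
  have e3 := eulerDeriv_exp_monomial_sub_mem (FreeAlgebra.ι ℚ (0 : Fin 2)) hN
  have e4 := eulerDeriv_exp_monomial_sub_mem (FreeAlgebra.ι ℚ (1 : Fin 2)) hN
  have e5 := exp_mul_sub_mem ha1 hb1 N
  rw [← ha] at e2 e2' e3
  rw [← hb] at e2 e2' e4
  rw [map_sub] at e2'
  refine mem_lowOrder_of_mul_mem (coeff_zero_exp hZ N) ?_
  rw [← toTrunc_eq] at e1 e2 e2' e3 e4 e5
  rw [← toTrunc_eq_zero, sub_mul, map_sub, sub_eq_zero]
  rw [eulerDeriv_mul, map_add, map_mul, map_mul] at e2'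
  rw [map_mul] at e2 e3 e4 e5
  rw [map_mul] at e5
  rw [← e1, e2', map_mul, e2, e3, e4, map_add, add_mul, ← mul_assoc, ← mul_assoc, ← mul_assoc, e5]

end Existence

section Existence

attribute [local instance 100] LieRing.ofAssociativeRing

open FreeLieAlgebra PowerSeries

variable {K : LieSubalgebra ℚ NCPoly}

/-- Neither series has a constant term, so degree `j` of the commutator involves only coefficients
of degree below `j`. The gain of one degree drives the recursion for the Hausdorff series. -/
theorem coeff_commutator_mem {n : ℕ} {Z W : PowerSeries NCPoly} (hZ0 : Z ∈ lowOrder NCPoly 1)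
    (hW0 : W ∈ lowOrder NCPoly 1) (hZ : ∀ j < n, coeff j Z ∈ K) (hW : ∀ j < n, coeff j W ∈ K) :
    ∀ j < n + 1, coeff j (Z * W - W * Z) ∈ K := by
  intro j hj
  have : coeff j (Z * W - W * Z) = ∑ p ∈ Finset.HasAntidiagonal.antidiagonal j,
      ⁅coeff p.1 Z, coeff p.2 W⁆ := by
    simp only [LieRing.of_associative_ring_bracket, Finset.sum_sub_distrib]
    rw [map_sub, coeff_mul, coeff_mul]
    congr 1
    exact Finset.Nat.sum_antidiagonal_swap (f := fun p : ℕ × ℕ => coeff p.2 W * coeff p.1 Z)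
  rw [this]
  refine sum_mem fun p hp => ?_
  have hp' := Finset.HasAntidiagonal.mem_antidiagonal.1 hp
  by_cases h1 : p.1 = 0
  · rw [h1, mem_lowOrder_one.1 hZ0, zero_lie]; exact zero_mem _
  by_cases h2 : p.2 = 0
  · rw [h2, mem_lowOrder_one.1 hW0, lie_zero]; exact zero_mem _
  · exact K.lie_mem (hZ _ (by omega)) (hW _ (by omega))

theorem coeff_iterComm_succ_mem {n : ℕ} {Z W : PowerSeries NCPoly} (hZ0 : Z ∈ lowOrder NCPoly 1)
    (hW0 : W ∈ lowOrder NCPoly 1) (hZ : ∀ j < n, coeff j Z ∈ K) (hW : ∀ j < n, coeff j W ∈ K)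
    (k : ℕ) : ∀ j < n + 1, coeff j (iterComm Z W (k + 1)) ∈ K := by
  induction k with
  | zero =>
    rw [iterComm_succ, iterComm_zero]
    exact coeff_commutator_mem hZ0 hW0 hZ hW
  | succ k ih =>
    rw [iterComm_succ]
    refine coeff_commutator_mem hZ0 ?_ hZ fun j hj => ih j (by omega)
    exact lowOrder_anti (by omega) (iterComm_mem_lowOrder hZ0 hW0 (k + 1))

/-- The homogeneous parts of the Hausdorff series are Lie polynomials. -/
theorem coeff_hausdorffSeries_mem_range (n : ℕ) :
    coeff n hausdorffSeries ∈ LiePoly.expand.range := by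
  induction n using Nat.strong_induction_on with
  | _ n ih =>
    rcases Nat.eq_zero_or_pos n with rfl | hn
    · rw [coeff_zero_hausdorffSeries]; exact zero_mem _
    have hι : ∀ (i : Fin 2) j, coeff j (monomial 1 (FreeAlgebra.ι ℚ i)) ∈ LiePoly.expand.range := by
      intro i j
      rw [coeff_monomial]
      split_ifs
      · exact ⟨FreeLieAlgebra.of ℚ i, toFreeAlgebra_of i⟩
      · exact zero_mem _
    have hι1 : ∀ i : Fin 2, monomial 1 (FreeAlgebra.ι ℚ i) ∈ lowOrder NCPoly 1 := fun i =>
      monomial_mem_lowOrder le_rfl _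
    have h := eulerDeriv_hausdorffSeries hn n (Nat.lt_succ_self n)
    obtain ⟨m, rfl⟩ : ∃ m, n = m + 1 := ⟨n - 1, by omega⟩
    rw [map_sub, sub_eq_zero, map_add, map_sum, map_sum, Finset.sum_range_succ'] at h
    simp only [coeff_rat_smul] at h
    -- The isolated term `k = 0` is `n u_n`; the other terms on that side are iterated commutators,
    -- so in degree `n` they involve only lower `u_j`.
    rw [iterComm_zero, coeff_eulerDeriv, ← eq_sub_iff_add_eq'] at h
    have h2 : ((Nat.factorial (0 + 1) : ℚ))⁻¹ • (m + 1) • coeff (m + 1) hausdorffSeries ∈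
        LiePoly.expand.range := by
      rw [h]
      refine sub_mem (add_mem (hι 0 _) (sum_mem fun k _ => ?_)) (sum_mem fun k _ => ?_)
      · refine LieSubalgebra.smul_mem _ _ ?_
        cases k with
        | zero => exact hι 1 _
        | succ k =>
          exact coeff_iterComm_succ_mem (n := m + 1) (hι1 0) (hι1 1) (fun j _ => hι 0 j)
            (fun j _ => hι 1 j) k _ (by omega)
      · refine LieSubalgebra.smul_mem _ _ ?_
        refine coeff_iterComm_succ_mem (n := m + 1) hausdorffSeries_mem_lowOrder
          (eulerDeriv_mem_lowOrder hausdorffSeries_mem_lowOrder) ih (fun j hj => ?_) k _ (by omega)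
        rw [coeff_eulerDeriv]
        exact nsmul_mem (ih j hj) j
    have h3 : coeff (m + 1) hausdorffSeries = (((m + 1 : ℕ) : ℚ)⁻¹) •
        ((Nat.factorial (0 + 1) : ℚ))⁻¹ • (m + 1) • coeff (m + 1) hausdorffSeries := by
      rw [← Nat.cast_smul_eq_nsmul ℚ, smul_smul, smul_smul]
      have : ((m + 1 : ℕ) : ℚ) ≠ 0 := by positivity
      simp only [zero_add, Nat.factorial_one, Nat.cast_one, inv_one, mul_one]
      rw [inv_mul_cancel₀ this, one_smul]
    rw [h3]
    exact LieSubalgebra.smul_mem _ _ h2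

theorem expand_hausdorffTerm (n : ℕ) :
    LiePoly.expand (hausdorffTerm n) = coeff n hausdorffSeries :=
  Classical.epsilon_spec (coeff_hausdorffSeries_mem_range n)

theorem hausdorffTerm_mem_homog (n : ℕ) : hausdorffTerm (n + 1) ∈ homog (Fin 2) n := by
  apply mem_homog_of_toFreeAlgebra
  have := isGraded_hausdorffSeries (n + 1)
  rwa [← expand_hausdorffTerm] at this

theorem coeff_one_hausdorffSeries : coeff 1 hausdorffSeries =
    FreeAlgebra.ι ℚ (0 : Fin 2) + FreeAlgebra.ι ℚ 1 := by
  simp [hausdorffSeries, gradedLog, gradedExp, PowerSeries.coeff_mul, coeff_one,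
    Finset.Nat.antidiagonal_succ]
  abel

theorem coeff_two_hausdorffSeries : coeff 2 hausdorffSeries =
    (2 : ℚ)⁻¹ • ⁅FreeAlgebra.ι ℚ (0 : Fin 2), FreeAlgebra.ι ℚ 1⁆ := by
  have e : Finset.Icc 1 2 = {1, 2} := rfl
  simp [hausdorffSeries, gradedLog, gradedExp, PowerSeries.coeff_mul, coeff_one,
    Finset.Nat.antidiagonal_succ, e, pow_two, LieRing.of_associative_ring_bracket]
  simp only [add_mul, mul_add]
  module

theorem hausdorffTerm_one : hausdorffTerm 1 = FreeLieAlgebra.of ℚ 0 + FreeLieAlgebra.of ℚ 1 := by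
  apply toFreeAlgebra_injective
  rw [map_add, toFreeAlgebra_of, toFreeAlgebra_of, ← coeff_one_hausdorffSeries]
  exact expand_hausdorffTerm 1

theorem hausdorffTerm_two : hausdorffTerm 2 =
    (2 : ℚ)⁻¹ • ⁅FreeLieAlgebra.of ℚ (0 : Fin 2), FreeLieAlgebra.of ℚ (1 : Fin 2)⁆ := by
  apply toFreeAlgebra_injective
  rw [map_smul, LieHom.map_lie, toFreeAlgebra_of, toFreeAlgebra_of, ← coeff_two_hausdorffSeries]
  exact expand_hausdorffTerm 2

end Existence

/-! ### The group law on nilpotent Lie algebras -/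

namespace FreeLieAlgebra

theorem map_lift {R X L L' : Type*} [CommRing R] [LieRing L] [LieAlgebra R L] [LieRing L']
    [LieAlgebra R L'] (φ : L →ₗ⁅R⁆ L') (g : X → L) (u : FreeLieAlgebra R X) :
    φ (lift R g u) = lift R (φ ∘ g) u := by
  have : φ.comp (lift R g) = lift R (φ ∘ g) := by ext x; simp
  rw [← this]; rfl

section

attribute [local instance 100] LieRing.ofAssociativeRing

theorem lift_eq_lift_toFreeAlgebra {X B : Type*} [Ring B] [Algebra ℚ B] (g : X → B)
    (u : FreeLieAlgebra ℚ X) :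
    lift ℚ g u = FreeAlgebra.lift ℚ g (toFreeAlgebra X u) := by
  have : lift ℚ g = (FreeAlgebra.lift ℚ g).toLieHom.comp (toFreeAlgebra X) := by
    ext x; simp
  rw [this]; rfl

end

theorem lift_mem_lowerCentralSeries {R X L : Type*} [CommRing R] [LieRing L] [LieAlgebra R L]
    (g : X → L) {c : ℕ} {u : FreeLieAlgebra R X}
    (hu : u ∈ LieModule.lowerCentralSeries R (FreeLieAlgebra R X) (FreeLieAlgebra R X) c) :
    lift R g u ∈ LieModule.lowerCentralSeries R L L c :=
  LieIdeal.map_lowerCentralSeries_le c (LieIdeal.mem_map hu)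

end FreeLieAlgebra

section

variable {L L' : Type*} [LieRing L] [LieAlgebra ℚ L] [LieRing L'] [LieAlgebra ℚ L']

theorem map_truncatedHausdorff (φ : L →ₗ⁅ℚ⁆ L') (c : ℕ) (x y : L) :
    φ (truncatedHausdorff c x y) = truncatedHausdorff c (φ x) (φ y) := by
  rw [truncatedHausdorff, truncatedHausdorff, map_sum]
  refine Finset.sum_congr rfl fun n _ => ?_
  rw [FreeLieAlgebra.map_lift]
  congr 2
  ext i
  fin_cases i <;> rfl

end

section

attribute [local instance 100] LieRing.ofAssociativeRing

open FreeLieAlgebra PowerSeries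

variable {A : Type*} [Ring A] [Algebra ℚ A]

theorem truncatedHausdorff_eq_evalSeries {B : Type*} [Ring B] [Algebra ℚ B] (c : ℕ) (x y : B) :
    truncatedHausdorff c x y = evalSeries (FreeAlgebra.lift ℚ ![x, y]) c hausdorffSeries := by
  rw [truncatedHausdorff, evalSeries, Finset.sum_range_succ', coeff_zero_hausdorffSeries, map_zero,
    add_zero]
  symm
  refine Finset.sum_nbij (· + 1) (fun n hn => ?_) (fun _ _ _ _ h => Nat.succ_injective h)
    (fun n hn => ?_) fun n _ => ?_
  · simp only [Finset.mem_range, Finset.mem_Icc] at hn ⊢; omega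
  · have := Finset.mem_Icc.1 hn
    exact ⟨n - 1, by simp; omega, by simp; omega⟩
  · rw [lift_eq_lift_toFreeAlgebra, ← expand_hausdorffTerm]
    rfl

theorem truncatedHausdorff_mem_lowOrder (c : ℕ) {x y : PowerSeries A} (hx : x ∈ lowOrder A 1)
    (hy : y ∈ lowOrder A 1) : truncatedHausdorff c x y ∈ lowOrder A 1 := by
  have hg : ∀ i, ![x, y] i ∈ lowOrder A 1 := by intro i; fin_cases i <;> assumption
  rw [truncatedHausdorff]
  refine sum_mem fun n hn => ?_
  rw [lift_eq_lift_toFreeAlgebra]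
  have : toFreeAlgebra (Fin 2) (hausdorffTerm n) ∈ vars (Fin 2) ^ n :=
    (expand_hausdorffTerm n) ▸ isGraded_hausdorffSeries n
  exact lowOrder_anti (Finset.mem_Icc.1 hn).1 (lift_mem_lowOrder hg this)

theorem exp_truncatedHausdorff_sub_mem (c : ℕ) {x y : PowerSeries A} (hx : x ∈ lowOrder A 1)
    (hy : y ∈ lowOrder A 1) :
    toTrunc A c (Polynomial.aeval (truncatedHausdorff c x y) (expTrunc c)) =
      toTrunc A c (Polynomial.aeval x (expTrunc c)) * toTrunc A c (Polynomial.aeval y (expTrunc c)) := by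
  have hg : ∀ i, ![x, y] i ∈ lowOrder A 1 := by intro i; fin_cases i <;> assumption
  have h := exp_evalSeries_hausdorffSeries (toTrunc_comp_lift_eq_zero hg c)
  rw [AlgHom.comp_apply, AlgHom.comp_apply, FreeAlgebra.lift_ι_apply, FreeAlgebra.lift_ι_apply] at h
  simp only [← Polynomial.aeval_algHom_apply]
  refine Eq.trans ?_ h
  congr 2
  rw [truncatedHausdorff_eq_evalSeries, evalSeries, evalSeries, map_sum]
  rfl

/-- Both bracketings have the exponential `exp x exp y exp z` modulo degree above `c`, and the
exponential is injective on nilpotent elements. -/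
theorem truncatedHausdorff_assoc_sub_mem (c : ℕ) {x y z : PowerSeries A} (hx : x ∈ lowOrder A 1)
    (hy : y ∈ lowOrder A 1) (hz : z ∈ lowOrder A 1) :
    truncatedHausdorff c (truncatedHausdorff c x y) z -
      truncatedHausdorff c x (truncatedHausdorff c y z) ∈ lowOrder A (c + 1) := by
  have hxy := truncatedHausdorff_mem_lowOrder c hx hy
  have hyz := truncatedHausdorff_mem_lowOrder c hy hz
  have nil : ∀ {w : PowerSeries A}, w ∈ lowOrder A 1 → (toTrunc A c w) ^ (c + 1) = 0 := by
    intro w hw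
    rw [← map_pow, toTrunc_eq_zero]
    exact pow_mem_lowOrder hw _
  rw [← toTrunc_eq]
  apply Polynomial.exp_injective_of_pow_eq_zero
    (nil (truncatedHausdorff_mem_lowOrder c hxy hz)) (nil (truncatedHausdorff_mem_lowOrder c hx hyz))
  rw [Polynomial.aeval_algHom_apply, Polynomial.aeval_algHom_apply,
    exp_truncatedHausdorff_sub_mem c hxy hz, exp_truncatedHausdorff_sub_mem c hx hyz,
    exp_truncatedHausdorff_sub_mem c hx hy, exp_truncatedHausdorff_sub_mem c hy hz, mul_assoc]

/-- The defect for three free variables expands without terms of degree at most `c`, hence lies in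
term `c` of the lower central series, which is sent to `0` in `L`. -/
theorem truncatedHausdorff_assoc {L : Type*} [LieRing L] [LieAlgebra ℚ L] {c : ℕ}
    (hL : LieModule.lowerCentralSeries ℚ L L c = ⊥) (x y z : L) :
    truncatedHausdorff c (truncatedHausdorff c x y) z =
      truncatedHausdorff c x (truncatedHausdorff c y z) := by
  let v : Fin 3 → FreeLieAlgebra ℚ (Fin 3) := FreeLieAlgebra.of ℚ
  set P := truncatedHausdorff c (truncatedHausdorff c (v 0) (v 1)) (v 2) -
      truncatedHausdorff c (v 0) (truncatedHausdorff c (v 1) (v 2)) with hP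
  have h1 : P ∈ LieModule.lowerCentralSeries ℚ (FreeLieAlgebra ℚ (Fin 3)) _ c := by
    apply mem_lowerCentralSeries_of_grading
    let θ : FreeLieAlgebra ℚ (Fin 3) →ₗ⁅ℚ⁆ PowerSeries (FreeAlgebra ℚ (Fin 3)) :=
      (grading (Fin 3)).toLieHom.comp (toFreeAlgebra (Fin 3))
    have hθ : ∀ i, θ (v i) ∈ lowOrder (FreeAlgebra ℚ (Fin 3)) 1 := by
      intro i
      have : θ (v i) = monomial 1 (FreeAlgebra.ι ℚ i) := by simp [θ, v, grading]
      rw [this]; exact monomial_mem_lowOrder le_rfl _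
    have h := truncatedHausdorff_assoc_sub_mem c (hθ 0) (hθ 1) (hθ 2)
    simp only [← map_truncatedHausdorff, ← map_sub] at h
    intro n hn
    exact h n (Nat.lt_succ_of_le hn)
  have h2 := lift_mem_lowerCentralSeries ![x, y, z] h1
  rw [hL, LieSubmodule.mem_bot, hP, map_sub, sub_eq_zero] at h2
  simpa [map_truncatedHausdorff, v] using h2

end

/-! ### Homogeneity of the Hausdorff terms, and their values at commuting arguments -/

section

attribute [local instance 100] LieRing.ofAssociativeRing

open FreeLieAlgebra

variable {L : Type*} [LieRing L] [LieAlgebra ℚ L]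

theorem lift_hausdorffTerm_smul (n : ℕ) (hn : n ≠ 0) (s : ℚ) (x y : L) :
    lift ℚ ![s • x, s • y] (hausdorffTerm n) = s ^ n • lift ℚ ![x, y] (hausdorffTerm n) := by
  obtain ⟨n, rfl⟩ := Nat.exists_eq_succ_of_ne_zero hn
  have hu := hausdorffTerm_mem_homog n
  set u := hausdorffTerm (n + 1) with hudef
  have key : lift ℚ (fun i => s • of ℚ i) u = s ^ (n + 1) • u := by
    apply toFreeAlgebra_injective
    rw [map_lift, map_smul, lift_eq_lift_toFreeAlgebra]
    have : ∀ k, ∀ a ∈ vars (Fin 2) ^ k,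
        FreeAlgebra.lift ℚ (toFreeAlgebra (Fin 2) ∘ fun i => s • of ℚ i) a = s ^ k • a := by
      intro k
      induction k with
      | zero =>
        intro a ha
        rw [pow_zero, Submodule.mem_one] at ha
        obtain ⟨q, rfl⟩ := ha
        simp
      | succ k ih =>
        intro a ha
        rw [pow_succ] at ha
        induction ha using Submodule.mul_induction_on' with
        | mem_mul_mem a ha b hb =>
          rw [map_mul, ih a ha, pow_succ, ← smul_mul_smul_comm]
          congr 1
          induction hb using Submodule.span_induction with
          | mem x hx => obtain ⟨x, rfl⟩ := hx; simp
          | zero => simp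
          | add x y _ _ h1 h2 => rw [map_add, h1, h2, smul_add]
          | smul c x _ h1 => rw [map_smul, h1, smul_comm]
        | add a _ b _ h1 h2 => rw [map_add, h1, h2, smul_add]
    exact this _ _ hu.2.1
  have h2 := congrArg (lift ℚ ![x, y]) key
  rw [map_lift, map_smul] at h2
  rw [← h2]
  congr 2
  ext i
  fin_cases i <;> simp

/-- Centralisers are subalgebras: the variables centralise each other, so everything centralises the
variables, so everything commutes. -/
theorem lift_lie_eq_zero_of_commute {x y : L} (h : ⁅x, y⁆ = 0) (u v : FreeLieAlgebra ℚ (Fin 2)) :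
    ⁅lift ℚ ![x, y] u, lift ℚ ![x, y] v⁆ = 0 := by
  let K (z : L) : LieSubalgebra ℚ (FreeLieAlgebra ℚ (Fin 2)) :=
    { carrier := {u | ⁅lift ℚ ![x, y] u, z⁆ = 0}
      add_mem' := by
        intro a b (ha : _ = _) (hb : _ = _)
        change _ = _
        rw [map_add, add_lie, ha, hb, add_zero]
      zero_mem' := by change _ = _; rw [map_zero, zero_lie]
      smul_mem' := by
        intro c a (ha : _ = _)
        change _ = _
        rw [map_smul, smul_lie, ha, smul_zero]
      lie_mem' := by
        intro a b (ha : _ = _) (hb : _ = _)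
        change _ = _
        rw [LieHom.map_lie, lie_lie, ha, hb, lie_zero, lie_zero, sub_zero] }
  have h' : ⁅y, x⁆ = 0 := by rw [← lie_skew, h, neg_zero]
  have h1 : ∀ i, K (![x, y] i) = ⊤ := by
    intro i
    apply lieSubalgebra_eq_top
    intro k
    change ⁅lift ℚ ![x, y] (of ℚ k), _⁆ = 0
    rw [lift_of_apply]
    fin_cases i <;> fin_cases k <;> simp [h, h']
  have h2 : K (lift ℚ ![x, y] v) = ⊤ := by
    apply lieSubalgebra_eq_top
    intro k
    change ⁅lift ℚ ![x, y] (of ℚ k), _⁆ = 0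
    rw [lift_of_apply, ← lie_skew, neg_eq_zero]
    exact (h1 k ▸ LieSubalgebra.mem_top v : v ∈ K (![x, y] k))
  exact (h2 ▸ LieSubalgebra.mem_top u : u ∈ K (lift ℚ ![x, y] v))

/-- For `n ≥ 2` the term lies in the derived algebra of the free Lie algebra, which maps to `0` when
the image is abelian. -/
theorem lift_hausdorffTerm_of_commute {x y : L} (h : ⁅x, y⁆ = 0) (n : ℕ) (hn : 2 ≤ n) :
    lift ℚ ![x, y] (hausdorffTerm n) = 0 := by
  obtain ⟨n, rfl⟩ : ∃ k, n = k + 1 + 1 := ⟨n - 2, by omega⟩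
  have h1 := LieModule.antitone_lowerCentralSeries ℚ _ _ (Nat.le_add_left 1 n)
    (hausdorffTerm_mem_homog (n + 1)).1
  rw [LieModule.lowerCentralSeries_succ, LieModule.lowerCentralSeries_zero] at h1
  have h2 : ⁅(⊤ : LieIdeal ℚ (FreeLieAlgebra ℚ (Fin 2))),
      (⊤ : LieIdeal ℚ (FreeLieAlgebra ℚ (Fin 2)))⁆ ≤ (lift ℚ ![x, y]).ker := by
    rw [LieSubmodule.lie_le_iff]
    intro a _ b _
    rw [LieHom.mem_ker, LieHom.map_lie]
    exact lift_lie_eq_zero_of_commute h a b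
  exact LieHom.mem_ker.1 (h2 h1)

end

/-! ### The group law over the integers -/

namespace FreeLieAlgebra

/-- Integral Lie polynomials as rational Lie polynomials. -/
def ratMap (X : Type*) : FreeLieAlgebra ℤ X →ₗ⁅ℤ⁆ FreeLieAlgebra ℚ X := lift ℤ (of ℚ)

@[simp] theorem ratMap_of {X : Type*} (x : X) : ratMap X (of ℤ x) = of ℚ x := lift_of_apply _ _

/-- Every Lie polynomial has a denominator, so that the set whose infimum is `hausdorffDenom` is
nonempty. -/
theorem exists_pos_smul_mem_range_ratMap {X : Type*} (u : FreeLieAlgebra ℚ X) :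
    ∃ N : ℕ, 0 < N ∧ ∃ v, ratMap X v = (N : ℚ) • u := by
  let K : LieSubalgebra ℚ (FreeLieAlgebra ℚ X) :=
    { carrier := {u | ∃ N : ℕ, 0 < N ∧ ∃ v, ratMap X v = (N : ℚ) • u}
      add_mem' := by
        rintro a b ⟨N, hN, v, hv⟩ ⟨M, hM, w, hw⟩
        refine ⟨N * M, by positivity, M • v + N • w, ?_⟩
        rw [map_add, map_nsmul, map_nsmul, hv, hw]
        push_cast
        simp only [← Nat.cast_smul_eq_nsmul ℚ]
        module
      zero_mem' := ⟨1, one_pos, 0, by simp⟩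
      smul_mem' := by
        rintro q a ⟨N, hN, v, hv⟩
        refine ⟨N * q.den, Nat.mul_pos hN q.den_pos, q.num • v, ?_⟩
        rw [map_zsmul, hv, ← Int.cast_smul_eq_zsmul ℚ, smul_smul, smul_smul]
        congr 1
        push_cast
        rw [mul_assoc, mul_comm (q.den : ℚ), Rat.mul_den_eq_num, mul_comm]
      lie_mem' := by
        rintro a b ⟨N, hN, v, hv⟩ ⟨M, hM, w, hw⟩
        refine ⟨N * M, by positivity, ⁅v, w⁆, ?_⟩
        rw [LieHom.map_lie, hv, hw, smul_lie, lie_smul, smul_smul]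
        push_cast; rfl }
  have : K = ⊤ := lieSubalgebra_eq_top K fun x => ⟨1, one_pos, of ℤ x, by simp⟩
  exact (this ▸ LieSubalgebra.mem_top u : u ∈ K)

section AddSubgroup

variable {M : Type*} [LieRing M]

theorem lift_mem_addSubgroup {X : Type*} {S : AddSubgroup M} (hS : ∀ a ∈ S, ∀ b ∈ S, ⁅a, b⁆ ∈ S)
    {g : X → M} (hg : ∀ x, g x ∈ S) (v : FreeLieAlgebra ℤ X) : lift ℤ g v ∈ S := by
  let K : LieSubalgebra ℤ (FreeLieAlgebra ℤ X) :=
    { carrier := {v | lift ℤ g v ∈ S}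
      add_mem' := by
        intro a b (ha : _ ∈ S) (hb : _ ∈ S)
        change _ ∈ S; rw [map_add]; exact add_mem ha hb
      zero_mem' := by change _ ∈ S; rw [map_zero]; exact zero_mem _
      smul_mem' := by
        intro c a (ha : _ ∈ S)
        change _ ∈ S; rw [map_zsmul]; exact zsmul_mem ha c
      lie_mem' := by
        intro a b (ha : _ ∈ S) (hb : _ ∈ S)
        change _ ∈ S; rw [LieHom.map_lie]; exact hS _ ha _ hb }
  have : K = ⊤ := lieSubalgebra_eq_top K fun x => by
    change _ ∈ S; rw [lift_of_apply]; exact hg x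
  exact (this ▸ LieSubalgebra.mem_top v : v ∈ K)

/-- Working with an additive subgroup stable under all brackets gives congruences modulo an ideal
without passing to a quotient Lie ring. -/
theorem lift_sub_lift_mem {X : Type*} {I : AddSubgroup M} (hI : ∀ x : M, ∀ a ∈ I, ⁅x, a⁆ ∈ I)
    {g g' : X → M} (hg : ∀ x, g x - g' x ∈ I) (v : FreeLieAlgebra ℤ X) :
    lift ℤ g v - lift ℤ g' v ∈ I := by
  let K : LieSubalgebra ℤ (FreeLieAlgebra ℤ X) :=
    { carrier := {v | lift ℤ g v - lift ℤ g' v ∈ I}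
      add_mem' := by
        intro a b (ha : _ ∈ I) (hb : _ ∈ I)
        change _ ∈ I; rw [map_add, map_add, add_sub_add_comm]; exact add_mem ha hb
      zero_mem' := by change _ ∈ I; rw [map_zero, map_zero, sub_zero]; exact zero_mem _
      smul_mem' := by
        intro c a (ha : _ ∈ I)
        change _ ∈ I; rw [map_zsmul, map_zsmul, ← smul_sub]; exact zsmul_mem ha c
      lie_mem' := by
        intro a b (ha : _ ∈ I) (hb : _ ∈ I)
        change _ ∈ I
        have e : lift ℤ g ⁅a, b⁆ - lift ℤ g' ⁅a, b⁆ = ⁅lift ℤ g a, lift ℤ g b - lift ℤ g' b⁆ -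
            ⁅lift ℤ g' b, lift ℤ g a - lift ℤ g' a⁆ := by
          rw [LieHom.map_lie, LieHom.map_lie, lie_sub, lie_sub, ← lie_skew (lift ℤ g' b) (lift ℤ g a),
            ← lie_skew (lift ℤ g' b) (lift ℤ g' a)]
          abel
        rw [e]
        exact sub_mem (hI _ _ hb) (hI _ _ ha) }
  have : K = ⊤ := lieSubalgebra_eq_top K fun x => by
    change _ ∈ I; rw [lift_of_apply, lift_of_apply]; exact hg x
  exact (this ▸ LieSubalgebra.mem_top v : v ∈ K)

theorem map_lift_int {L X : Type*} [LieRing L] [LieAlgebra ℚ L] (j : M →+ L)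
    (hj : ∀ a b, j ⁅a, b⁆ = ⁅j a, j b⁆) (g : X → M) (v : FreeLieAlgebra ℤ X) :
    j (lift ℤ g v) = lift ℚ (j ∘ g) (ratMap X v) := by
  let K : LieSubalgebra ℤ (FreeLieAlgebra ℤ X) :=
    { carrier := {v | j (lift ℤ g v) = lift ℚ (j ∘ g) (ratMap X v)}
      add_mem' := by
        intro a b (ha : _ = _) (hb : _ = _)
        change _ = _; simp only [map_add, ha, hb]
      zero_mem' := by change _ = _; simp only [map_zero]
      smul_mem' := by
        intro c a (ha : _ = _)
        change _ = _; simp only [map_zsmul, ha]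
      lie_mem' := by
        intro a b (ha : _ = _) (hb : _ = _)
        change _ = _; simp only [LieHom.map_lie, hj, ha, hb] }
  have : K = ⊤ := lieSubalgebra_eq_top K fun x => by
    change _ = _; rw [lift_of_apply, ratMap_of, lift_of_apply]; rfl
  exact (this ▸ LieSubalgebra.mem_top v : v ∈ K)

end AddSubgroup

end FreeLieAlgebra

open FreeLieAlgebra

theorem hausdorffDenom_spec (c : ℕ) : 0 < hausdorffDenom c ∧
    ∀ n ∈ Finset.Icc 1 c, ((hausdorffDenom c : ℚ) • hausdorffTerm n).IsIntegral := by
  have : {m : ℕ | 0 < m ∧ ∀ n ∈ Finset.Icc 1 c, ((m : ℚ) • hausdorffTerm n).IsIntegral}.Nonempty := by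
    choose N hN v hv using fun u : LiePoly => exists_pos_smul_mem_range_ratMap u
    refine ⟨∏ n ∈ Finset.Icc 1 c, N (hausdorffTerm n), Finset.prod_pos fun n _ => hN _, ?_⟩
    intro n hn
    refine ⟨(∏ k ∈ (Finset.Icc 1 c).erase n, N (hausdorffTerm k)) • v (hausdorffTerm n), ?_⟩
    change ratMap _ _ = _
    rw [map_nsmul, hv, ← Finset.prod_erase_mul _ _ hn, ← Nat.cast_smul_eq_nsmul ℚ, smul_smul]
    push_cast; rfl
  exact Nat.sInf_mem this

theorem hausdorffDenom_pos (c : ℕ) : 0 < hausdorffDenom c := (hausdorffDenom_spec c).1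

/-- The integral Lie polynomial `m ^ (n - 1) u_n`, for `2 ≤ n ≤ c` and `m = m(c)`. -/
def scaledTerm (c n : ℕ) : FreeLieAlgebra ℤ (Fin 2) :=
  Classical.epsilon fun v => ratMap (Fin 2) v = (hausdorffDenom c : ℚ) ^ (n - 1) • hausdorffTerm n

theorem ratMap_scaledTerm {c n : ℕ} (hn : n ∈ Finset.Icc 2 c) :
    ratMap (Fin 2) (scaledTerm c n) = (hausdorffDenom c : ℚ) ^ (n - 1) • hausdorffTerm n := by
  refine Classical.epsilon_spec (p := fun v => ratMap (Fin 2) v = _) ?_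
  obtain ⟨h1, h2⟩ := Finset.mem_Icc.1 hn
  obtain ⟨v, hv⟩ := (hausdorffDenom_spec c).2 n (Finset.mem_Icc.2 ⟨by omega, h2⟩)
  refine ⟨hausdorffDenom c ^ (n - 2) • v, ?_⟩
  change ratMap _ v = _ at hv
  rw [map_nsmul, hv, ← Nat.cast_smul_eq_nsmul ℚ, smul_smul, show n - 1 = n - 2 + 1 by omega, pow_succ]
  push_cast; rfl

/-! ### The integral product `m⁻¹ Φ_c(m a, m b)` -/

section BCH

variable {M : Type*} [LieRing M] (c : ℕ)

/-- The value of `m ^ (n - 1) u_n`. -/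
def scaledEval (n : ℕ) (a b : M) : M := lift ℤ ![a, b] (scaledTerm c n)

/-- The product `m⁻¹ Φ_c(m a, m b)`, a Lie polynomial with integral coefficients. -/
def bch (a b : M) : M := a + b + ∑ n ∈ Finset.Icc 2 c, scaledEval c n a b

theorem bch_mem {S : AddSubgroup M} (hS : ∀ a ∈ S, ∀ b ∈ S, ⁅a, b⁆ ∈ S) {a b : M} (ha : a ∈ S)
    (hb : b ∈ S) : bch c a b ∈ S := by
  refine add_mem (add_mem ha hb) (sum_mem fun n _ => lift_mem_addSubgroup hS ?_ _)
  intro i; fin_cases i <;> assumption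

theorem bch_sub_bch_mem {I : AddSubgroup M} (hI : ∀ x : M, ∀ a ∈ I, ⁅x, a⁆ ∈ I) {a b a' b' : M}
    (ha : a - a' ∈ I) (hb : b - b' ∈ I) : bch c a b - bch c a' b' ∈ I := by
  rw [bch, bch, add_sub_add_comm, add_sub_add_comm, ← Finset.sum_sub_distrib]
  refine add_mem (add_mem ha hb) (sum_mem fun n _ => lift_sub_lift_mem hI ?_ _)
  intro i; fin_cases i <;> assumption

theorem map_bch {M' : Type*} [LieRing M'] (φ : M →+ M') (hφ : ∀ a b, φ ⁅a, b⁆ = ⁅φ a, φ b⁆)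
    (a b : M) : φ (bch c a b) = bch c (φ a) (φ b) := by
  rw [bch, bch, map_add, map_add, map_sum]
  congr 1
  refine Finset.sum_congr rfl fun n _ => ?_
  let ψ : M →ₗ⁅ℤ⁆ M' := { φ.toIntLinearMap with map_lie' := hφ _ _ }
  change ψ _ = _
  rw [scaledEval, scaledEval, map_lift]
  congr 2
  ext i
  fin_cases i <;> rfl

theorem map_scaledEval {L : Type*} [LieRing L] [LieAlgebra ℚ L] (j : M →+ L)
    (hj : ∀ a b, j ⁅a, b⁆ = ⁅j a, j b⁆) {n : ℕ} (hn : n ∈ Finset.Icc 2 c) (a b : M) :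
    j (scaledEval c n a b) =
      (hausdorffDenom c : ℚ) ^ (n - 1) • lift ℚ ![j a, j b] (hausdorffTerm n) := by
  rw [scaledEval, map_lift_int j hj, ratMap_scaledTerm hn, map_smul]
  congr 3
  ext i
  fin_cases i <;> rfl

/-- By homogeneity `m · m ^ (n - 1) u_n(a, b) = u_n(m a, m b)`. For `c = 0` the two sides differ:
`Φ_0 = 0`, while `bch 0` is addition. -/
theorem map_bch_rat {L : Type*} [LieRing L] [LieAlgebra ℚ L] (j : M →+ L)
    (hj : ∀ a b, j ⁅a, b⁆ = ⁅j a, j b⁆) (hc : c ≠ 0) (a b : M) :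
    j (hausdorffDenom c • bch c a b) =
      truncatedHausdorff c (j (hausdorffDenom c • a)) (j (hausdorffDenom c • b)) := by
  have hm : hausdorffDenom c • (∑ n ∈ Finset.Icc 2 c, scaledEval c n a b) =
    ∑ n ∈ Finset.Icc 2 c, hausdorffDenom c • scaledEval c n a b := Finset.smul_sum
  rw [bch, smul_add, hm, truncatedHausdorff, ← Finset.insert_Icc_add_one_left_eq_Icc (by omega : 1 ≤ c),
    Finset.sum_insert (by simp), map_add, map_sum]
  congr 1
  · rw [hausdorffTerm_one]; simp
  · refine Finset.sum_congr rfl fun n hn => ?_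
    have h2 := (Finset.mem_Icc.1 hn).1
    rw [map_nsmul, map_scaledEval c j hj hn, map_nsmul, map_nsmul, ← Nat.cast_smul_eq_nsmul ℚ,
      ← Nat.cast_smul_eq_nsmul ℚ, ← Nat.cast_smul_eq_nsmul ℚ, lift_hausdorffTerm_smul n (by omega),
      smul_smul, ← pow_succ', show n - 1 + 1 = n by omega]

section TorsionFree

variable (M) in
/-- The map from a Lie ring to its rationalisation. -/
def toRat : M →+ ℚ ⊗[ℤ] M := (TensorProduct.mk ℤ ℚ M 1).toAddMonoidHom

theorem toRat_lie (a b : M) : toRat M ⁅a, b⁆ = ⁅toRat M a, toRat M b⁆ := by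
  simp [toRat, LieAlgebra.ExtendScalars.bracket_tmul]

variable [IsAddTorsionFree M]

theorem toRat_injective : Function.Injective (toRat M) := by
  rw [injective_iff_map_eq_zero]
  intro a ha
  have : IsLocalizedModule (nonZeroDivisors ℤ) (TensorProduct.mk ℤ ℚ M 1) := inferInstance
  obtain ⟨s, hs⟩ := (IsLocalizedModule.eq_zero_iff (nonZeroDivisors ℤ) (TensorProduct.mk ℤ ℚ M 1)).1 ha
  exact (smul_eq_zero_iff_right (nonZeroDivisors.coe_ne_zero s)).1 hs

variable {c}

theorem scaledEval_smul {n : ℕ} (hn : n ∈ Finset.Icc 2 c) (s : ℤ) (a b : M) :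
    scaledEval c n (s • a) (s • b) = s ^ n • scaledEval c n a b := by
  apply toRat_injective
  have h2 := (Finset.mem_Icc.1 hn).1
  rw [map_scaledEval c _ toRat_lie hn, map_zsmul, map_zsmul, map_zsmul,
    map_scaledEval c _ toRat_lie hn, ← Int.cast_smul_eq_zsmul ℚ, ← Int.cast_smul_eq_zsmul ℚ s,
    lift_hausdorffTerm_smul n (by omega), ← Int.cast_smul_eq_zsmul ℚ, smul_comm]
  push_cast; rfl

theorem scaledEval_of_commute {n : ℕ} (hn : n ∈ Finset.Icc 2 c) {a b : M} (h : ⁅a, b⁆ = 0) :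
    scaledEval c n a b = 0 := by
  apply toRat_injective
  rw [map_scaledEval c _ toRat_lie hn, lift_hausdorffTerm_of_commute, smul_zero, map_zero]
  · rw [← toRat_lie, h, map_zero]
  · exact (Finset.mem_Icc.1 hn).1

/-- As `u_2 = [x, y] / 2`, antisymmetrising the quadratic term returns the bracket; this is how the
product remembers it. -/
theorem scaledEval_two_sub (hc : 2 ≤ c) (a b : M) :
    scaledEval c 2 a b - scaledEval c 2 b a = hausdorffDenom c • ⁅a, b⁆ := by
  apply toRat_injective
  have hn : 2 ∈ Finset.Icc 2 c := by simp [hc]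
  rw [map_sub, map_scaledEval c _ toRat_lie hn, map_scaledEval c _ toRat_lie hn, hausdorffTerm_two,
    map_nsmul, toRat_lie]
  simp only [map_smul, LieHom.map_lie, lift_of_apply]
  rw [← Nat.cast_smul_eq_nsmul ℚ]
  simp only [Matrix.cons_val_zero, Matrix.cons_val_one]
  rw [← lie_skew (toRat M b)]
  module

theorem bch_of_commute (c : ℕ) {a b : M} (h : ⁅a, b⁆ = 0) : bch c a b = a + b := by
  rw [bch, Finset.sum_eq_zero fun n hn => scaledEval_of_commute hn h, add_zero]

theorem bch_assoc (h : LieModule.lowerCentralSeries ℤ M M c = ⊥) (x y z : M) :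
    bch c (bch c x y) z = bch c x (bch c y z) := by
  rcases Nat.eq_zero_or_pos c with rfl | hc
  · simp [bch, add_assoc]
  have hK : LieModule.lowerCentralSeries ℚ (ℚ ⊗[ℤ] M) (ℚ ⊗[ℤ] M) c = ⊥ := by
    rw [LieSubmodule.lowerCentralSeries_tensor_eq_baseChange, h, LieSubmodule.baseChange_bot]
  have hm : Function.Injective fun a : M => toRat M (hausdorffDenom c • a) :=
    toRat_injective.comp (nsmul_right_injective (hausdorffDenom_pos c).ne')
  apply hm
  simp only [map_bch_rat c (toRat M) toRat_lie hc.ne']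
  exact truncatedHausdorff_assoc hK _ _ _

/-- The group with product `m⁻¹ Φ_c(m a, m b)`. -/
@[reducible] def bchGroup (h : LieModule.lowerCentralSeries ℤ M M c = ⊥) : Group M where
  mul := bch c
  one := 0
  inv := Neg.neg
  mul_assoc := bch_assoc h
  one_mul a := by change bch c 0 a = a; rw [bch_of_commute c (zero_lie a), zero_add]
  mul_one a := by change bch c a 0 = a; rw [bch_of_commute c (lie_zero a), add_zero]
  inv_mul_cancel a := by
    change bch c (-a) a = 0
    rw [bch_of_commute c (by rw [neg_lie, lie_self, neg_zero]), neg_add_cancel]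

variable (M c) in
/-- The bijection `a ↦ m a` from `M` to `m M`. -/
def expEquiv : M ≃ ExpLattice M c :=
  Equiv.ofBijective (fun a => ⟨hausdorffDenom c • a, a, rfl⟩)
    ⟨fun _ _ h => nsmul_right_injective (hausdorffDenom_pos c).ne' (congrArg Subtype.val h),
      fun ⟨_, a, ha⟩ => ⟨a, Subtype.ext ha.symm⟩⟩

theorem exists_isExpGroup (h : LieModule.lowerCentralSeries ℤ M M c = ⊥) :
    ∃ hG : Group (ExpLattice M c), IsExpGroup M c hG ∧
      ∀ a b : M, expEquiv M c a * expEquiv M c b = expEquiv M c (bch c a b) := by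
  let _ := bchGroup h
  refine ⟨(expEquiv M c).symm.group, ?_, ?_⟩
  · have key : ∀ x y : ExpLattice M c, (Equiv.group (expEquiv M c).symm).mul x y =
        expEquiv M c (bch c ((expEquiv M c).symm x) ((expEquiv M c).symm y)) := fun _ _ => rfl
    intro x y
    obtain ⟨a, rfl⟩ := (expEquiv M c).surjective x
    obtain ⟨b, rfl⟩ := (expEquiv M c).surjective y
    change toRat M ((Equiv.group (expEquiv M c).symm).mul _ _).val = _
    rw [key, Equiv.symm_apply_apply, Equiv.symm_apply_apply]
    -- Class `0` forces `M = 0`, which reconciles `bch 0` with the empty sum `Φ_0`.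
    rcases Nat.eq_zero_or_pos c with rfl | hc
    · have : Subsingleton M := by
        rw [LieModule.lowerCentralSeries_zero] at h
        exact (LieSubmodule.subsingleton_iff ℤ M M).1 (subsingleton_of_bot_eq_top h.symm)
      rw [Subsingleton.elim (expEquiv M 0 (bch 0 a b)).val 0]
      simp [truncatedHausdorff]
    · exact map_bch_rat c (toRat M) toRat_lie hc.ne' a b
  · intro a b
    change expEquiv M c (bch c ((expEquiv M c).symm _) ((expEquiv M c).symm _)) = _
    rw [Equiv.symm_apply_apply, Equiv.symm_apply_apply]

end TorsionFree

end BCH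

/-! ### Groups with a Hausdorff product -/

section BCHGroup

variable {M : Type*} [LieRing M] [IsAddTorsionFree M] {c : ℕ}

section Polynomial

/-- After applying a linear functional this is a polynomial over `ℚ` vanishing at all natural
numbers. -/
theorem eq_zero_of_forall_sum_pow_smul_eq_zero {V : Type*} [AddCommGroup V] [Module ℚ V]
    {s : Finset ℕ} {w : ℕ → V} (h : ∀ t : ℕ, ∑ n ∈ s, ((t : ℚ) ^ n) • w n = 0) {n : ℕ}
    (hn : n ∈ s) : w n = 0 := by
  rw [← Module.forall_dual_apply_eq_zero_iff ℚ]
  intro φ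
  set P : Polynomial ℚ := ∑ n ∈ s, Polynomial.C (φ (w n)) * Polynomial.X ^ n with hP
  have h0 : P = 0 := by
    apply Polynomial.eq_zero_of_infinite_isRoot
    refine Set.Infinite.mono ?_ (Set.infinite_range_of_injective (Nat.cast_injective (R := ℚ)))
    rintro _ ⟨t, rfl⟩
    have := congrArg φ (h t)
    rw [map_sum, map_zero] at this
    change Polynomial.eval _ _ = 0
    rw [hP, Polynomial.eval_finsetSum, ← this]
    refine Finset.sum_congr rfl fun k _ => ?_
    rw [Polynomial.eval_mul, Polynomial.eval_C, Polynomial.eval_pow, Polynomial.eval_X, map_smul,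
      smul_eq_mul, mul_comm]
  have h1 : P.coeff n = φ (w n) := by
    rw [hP, Polynomial.finsetSum_coeff]
    simp only [Polynomial.coeff_C_mul, Polynomial.coeff_X_pow]
    simp [hn]
  rw [← h1, h0, Polynomial.coeff_zero]

/-- Commuting at all scales `t` makes each homogeneous part of the difference vanish; the quadratic
one is `m [a, b]`. -/
theorem lie_eq_zero_of_forall_bch_eq {a b : M} (hc : 2 ≤ c)
    (h : ∀ t : ℕ, bch c (t • a) (t • b) = bch c (t • b) (t • a)) : ⁅a, b⁆ = 0 := by
  have key : ∀ t : ℕ, ∑ n ∈ Finset.Icc 2 c,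
      ((t : ℚ) ^ n) • toRat M (scaledEval c n a b - scaledEval c n b a) = 0 := by
    intro t
    have h1 := h t
    rw [bch, bch, add_comm (t • b), add_right_inj, ← sub_eq_zero, ← Finset.sum_sub_distrib] at h1
    have h2 := congrArg (toRat M) h1
    rw [map_sum, map_zero] at h2
    rw [← h2]
    refine Finset.sum_congr rfl fun n hn => ?_
    rw [← natCast_zsmul, ← natCast_zsmul, scaledEval_smul hn, scaledEval_smul hn, ← smul_sub,
      map_zsmul, ← Int.cast_smul_eq_zsmul ℚ]
    push_cast; rfl
  have h2 := eq_zero_of_forall_sum_pow_smul_eq_zero key (Finset.mem_Icc.2 ⟨le_rfl, hc⟩)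
  rw [scaledEval_two_sub hc, map_nsmul, ← map_nsmul] at h2
  have h3 := toRat_injective (h2.trans (map_zero _).symm)
  exact (smul_eq_zero_iff_right (hausdorffDenom_pos c).ne').1 h3

end Polynomial

/-! ### Groups identified with a Lie ring by a bijection `e`, such as `Γ` with `Λ` and its
completion with `L` -/

variable {G : Type*} [Group G] {e : M ≃ G} (he : ∀ a b, e a * e b = e (bch c a b))
include he

theorem bch_map_zero : e 0 = 1 := by
  have := he 0 0
  rw [bch_of_commute c (lie_self 0), add_zero] at this
  exact mul_eq_left.1 this

theorem bch_map_neg (a : M) : e (-a) = (e a)⁻¹ := by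
  rw [eq_inv_iff_mul_eq_one, he, bch_of_commute c (by rw [neg_lie, lie_self, neg_zero]),
    neg_add_cancel, bch_map_zero he]

theorem bch_map_nsmul (k : ℕ) (a : M) : e (k • a) = e a ^ k := by
  induction k with
  | zero => rw [zero_smul, pow_zero, bch_map_zero he]
  | succ k ih =>
    rw [pow_succ, ← ih, he, bch_of_commute c (by rw [nsmul_lie, lie_self, smul_zero]), succ_nsmul]

/-- The subgroup on a set of Lie subring elements. -/
def bchSubgroup (S : AddSubgroup M) (hS : ∀ a ∈ S, ∀ b ∈ S, ⁅a, b⁆ ∈ S) : Subgroup G where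
  carrier := {g | e.symm g ∈ S}
  mul_mem' := by
    intro g h hg hh
    have : e.symm (g * h) = bch c (e.symm g) (e.symm h) := by
      rw [Equiv.symm_apply_eq, ← he, Equiv.apply_symm_apply, Equiv.apply_symm_apply]
    change _ ∈ S
    rw [this]
    exact bch_mem c hS hg hh
  one_mem' := by
    change _ ∈ S
    rw [← bch_map_zero he, Equiv.symm_apply_apply]; exact zero_mem _
  inv_mem' := by
    intro g hg
    have : e.symm g⁻¹ = - e.symm g := by
      rw [Equiv.symm_apply_eq, bch_map_neg he, Equiv.apply_symm_apply]
    change _ ∈ S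
    rw [this]
    exact neg_mem hg

theorem map_mem_bchSubgroup {S : AddSubgroup M} {hS : ∀ a ∈ S, ∀ b ∈ S, ⁅a, b⁆ ∈ S} {a : M} :
    e a ∈ bchSubgroup he S hS ↔ a ∈ S := by
  change e.symm (e a) ∈ S ↔ _
  rw [Equiv.symm_apply_apply]

/-- `bch` respects congruences modulo `I`, so the cosets of the subgroup on an ideal are the
additive cosets. Every later index and quotient computation rests on this. -/
theorem inv_mul_mem_bchSubgroup {I : AddSubgroup M} (hI : ∀ x : M, ∀ a ∈ I, ⁅x, a⁆ ∈ I) {a b : M} :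
    (e a)⁻¹ * e b ∈ bchSubgroup he I (fun x _ => hI x) ↔ b - a ∈ I := by
  constructor
  · intro h
    obtain ⟨w, hw⟩ := e.surjective ((e a)⁻¹ * e b)
    rw [← hw, map_mem_bchSubgroup] at h
    have hb : b = bch c a w := by
      apply e.injective
      rw [← he, hw]; group
    have := bch_sub_bch_mem c hI (a := a) (a' := a) (b := w) (b' := 0) (by simp) (by simpa using h)
    rwa [bch_of_commute c (lie_zero a), add_zero, ← hb] at this
  · intro h
    rw [← bch_map_neg he, he, map_mem_bchSubgroup]
    have := bch_sub_bch_mem c hI (a := -a) (a' := -b) (b := b) (b' := b)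
      (by rwa [neg_sub_neg]) (by simp)
    rwa [bch_of_commute c (a := -b) (b := b) (by rw [neg_lie, lie_self, neg_zero]), neg_add_cancel,
      sub_zero] at this

theorem bchSubgroup_normal {I : AddSubgroup M} (hI : ∀ x : M, ∀ a ∈ I, ⁅x, a⁆ ∈ I) :
    (bchSubgroup he I (fun x _ => hI x)).Normal := by
  refine ⟨fun g hg h => ?_⟩
  obtain ⟨w, rfl⟩ := e.surjective g
  obtain ⟨a, rfl⟩ := e.surjective h
  rw [map_mem_bchSubgroup] at hg
  rw [← bch_map_neg he, he, he, map_mem_bchSubgroup]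
  have h1 := bch_sub_bch_mem c hI (a := a) (a' := a) (b := w) (b' := 0) (by simp) (by simpa using hg)
  have h2 := bch_sub_bch_mem c hI (b := -a) (b' := -a) h1 (by simp)
  rwa [bch_of_commute c (lie_zero a), add_zero,
    bch_of_commute c (a := a) (b := -a) (by rw [lie_neg, lie_self, neg_zero]), add_neg_cancel,
    sub_zero] at h2

theorem mul_inv_mem_bchSubgroup {I : AddSubgroup M} (hI : ∀ x : M, ∀ a ∈ I, ⁅x, a⁆ ∈ I) {a b : M} :
    e b * (e a)⁻¹ ∈ bchSubgroup he I (fun x _ => hI x) ↔ b - a ∈ I := by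
  rw [(bchSubgroup_normal he hI).mem_comm_iff, inv_mul_mem_bchSubgroup he hI]

theorem bch_eq_one_of_isOfFinOrder {g : G} (h : IsOfFinOrder g) : g = 1 := by
  obtain ⟨a, rfl⟩ := e.surjective g
  obtain ⟨k, hk, h1⟩ := isOfFinOrder_iff_pow_eq_one.1 h
  rw [← bch_map_nsmul he, ← bch_map_zero he, e.apply_eq_iff_eq] at h1
  rw [(smul_eq_zero_iff_right hk.ne').1 h1, bch_map_zero he]

end BCHGroup

/-! ### The upper central series -/

section Central

variable {M : Type*} [LieRing M]

/-- The terms of the upper central series of a Lie ring. -/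
abbrev lieUcs (M : Type*) [LieRing M] (i : ℕ) : LieIdeal ℤ M := (⊥ : LieIdeal ℤ M).ucs i

theorem mem_lieUcs_succ {i : ℕ} {a : M} : a ∈ lieUcs M (i + 1) ↔ ∀ x : M, ⁅x, a⁆ ∈ lieUcs M i := by
  rw [lieUcs, LieSubmodule.ucs_succ, LieSubmodule.mem_normalizer]

theorem lie_mem_lieUcs (i : ℕ) :
    ∀ x : M, ∀ a ∈ (lieUcs M i).toSubmodule.toAddSubgroup, ⁅x, a⁆ ∈ (lieUcs M i).toSubmodule.toAddSubgroup :=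
  fun x _ ha => (lieUcs M i).lie_mem (x := x) ha

/-- The quotient map by a term of the upper central series. -/
def lieUcsMk (M : Type*) [LieRing M] (i : ℕ) : M →+ M ⧸ lieUcs M i :=
  (lieUcs M i).toSubmodule.mkQ.toAddMonoidHom

theorem lieUcsMk_lie (i : ℕ) (a b : M) : lieUcsMk M i ⁅a, b⁆ = ⁅lieUcsMk M i a, lieUcsMk M i b⁆ :=
  rfl

theorem lieUcsMk_eq_zero {i : ℕ} {a : M} : lieUcsMk M i a = 0 ↔ a ∈ lieUcs M i :=
  Submodule.Quotient.mk_eq_zero _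

variable [IsAddTorsionFree M]

/-- The terms of the upper central series are isolated, so the quotients are torsion-free and the
facts about `bch` apply to them. -/
theorem mem_lieUcs_of_nsmul_mem {i k : ℕ} (hk : k ≠ 0) {a : M} (h : k • a ∈ lieUcs M i) :
    a ∈ lieUcs M i := by
  induction i generalizing a with
  | zero =>
    rw [lieUcs, LieSubmodule.ucs_zero, LieSubmodule.mem_bot] at h ⊢
    exact (smul_eq_zero_iff_right hk).1 h
  | succ i ih =>
    rw [mem_lieUcs_succ] at h ⊢
    intro x
    apply ih
    rw [← lie_nsmul]
    exact h x

instance (i : ℕ) : IsAddTorsionFree (M ⧸ lieUcs M i) where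
  nsmul_right_injective := by
    intro k hk x y h
    obtain ⟨a, rfl⟩ := Submodule.Quotient.mk_surjective _ x
    obtain ⟨b, rfl⟩ := Submodule.Quotient.mk_surjective _ y
    change k • _ = k • _ at h
    rw [← Submodule.Quotient.mk_smul, ← Submodule.Quotient.mk_smul, Submodule.Quotient.eq,
      ← smul_sub] at h
    rw [Submodule.Quotient.eq]
    exact mem_lieUcs_of_nsmul_mem hk h

theorem bch_sub_add_mem_lieUcs (c : ℕ) {i : ℕ} {a b : M} (h : ⁅a, b⁆ ∈ lieUcs M i) :
    bch c a b - (a + b) ∈ lieUcs M i := by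
  rw [← lieUcsMk_eq_zero, lieUcsMk_lie] at h
  rw [← lieUcsMk_eq_zero, map_sub, map_bch c _ (lieUcsMk_lie i), bch_of_commute c h, map_add, sub_self]

/-- One commutation relation in the group mixes all degrees; having it for all multiples `t a`
separates the quadratic part. For `c < 2` the bracket is zero. -/
theorem forall_bch_sub_mem_lieUcs_iff {c : ℕ} (h : LieModule.lowerCentralSeries ℤ M M c = ⊥) {i : ℕ}
    {a : M} : (∀ t : ℕ, ∀ b, bch c (t • a) b - bch c b (t • a) ∈ lieUcs M i) ↔
      ∀ b : M, ⁅b, a⁆ ∈ lieUcs M i := by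
  constructor
  · intro H b
    rcases Nat.lt_or_ge c 2 with hc | hc
    · have h1 := LieModule.antitone_lowerCentralSeries ℤ M M (Nat.lt_succ_iff.1 hc)
      rw [h, le_bot_iff, ← LieModule.trivial_iff_lower_central_eq_bot] at h1
      rw [h1.trivial]; exact zero_mem _
    · rw [← lie_skew, neg_mem_iff, ← lieUcsMk_eq_zero, lieUcsMk_lie]
      apply lie_eq_zero_of_forall_bch_eq hc
      intro t
      have := H t (t • b)
      rwa [← lieUcsMk_eq_zero, map_sub, sub_eq_zero, map_bch c _ (lieUcsMk_lie i),
        map_bch c _ (lieUcsMk_lie i), map_nsmul, map_nsmul] at this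
  · intro H t b
    have h1 : ⁅b, t • a⁆ ∈ lieUcs M i := by rw [lie_nsmul]; exact nsmul_mem (H b) t
    have h2 : ⁅t • a, b⁆ ∈ lieUcs M i := by rw [← lie_skew]; exact neg_mem h1
    have := sub_mem (bch_sub_add_mem_lieUcs c h2) (bch_sub_add_mem_lieUcs c h1)
    rwa [add_comm b, sub_sub_sub_cancel_right] at this

variable {c : ℕ} {G : Type*} [Group G] {e : M ≃ G} (he : ∀ a b, e a * e b = e (bch c a b))
include he

theorem map_mem_upperCentralSeries (h : LieModule.lowerCentralSeries ℤ M M c = ⊥) {i : ℕ} {a : M} :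
    e a ∈ Subgroup.upperCentralSeries G i ↔ a ∈ lieUcs M i := by
  induction i generalizing a with
  | zero =>
    rw [Subgroup.upperCentralSeries_zero, Subgroup.mem_bot, ← bch_map_zero he, e.apply_eq_iff_eq,
      lieUcs, LieSubmodule.ucs_zero, LieSubmodule.mem_bot]
  | succ i ih =>
    have hZ : Subgroup.upperCentralSeries G i =
        bchSubgroup he (lieUcs M i).toSubmodule.toAddSubgroup (fun x _ => lie_mem_lieUcs i x) := by
      ext g
      obtain ⟨a, rfl⟩ := e.surjective g
      rw [ih, map_mem_bchSubgroup]; rfl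
    have key : ∀ a, e a ∈ Subgroup.upperCentralSeries G (i + 1) ↔
        ∀ b, bch c a b - bch c b a ∈ lieUcs M i := by
      intro a
      rw [Subgroup.mem_upperCentralSeries_succ_iff, ← e.forall_congr_right]
      refine forall_congr' fun b => ?_
      have : e a * e b * (e a)⁻¹ * (e b)⁻¹ = e (bch c a b) * (e (bch c b a))⁻¹ := by
        rw [← he, ← he]; group
      rw [commutatorElement_def, this, hZ, mul_inv_mem_bchSubgroup he (lie_mem_lieUcs i)]
      rfl
    rw [mem_lieUcs_succ, ← forall_bch_sub_mem_lieUcs_iff h]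
    -- Membership in the group's central series passes to powers `e (t • a)`, which supplies the
    -- relation for every `t`.
    constructor
    · intro ha t
      rw [← key, bch_map_nsmul he]
      exact pow_mem ha t
    · intro ha
      rw [key]
      simpa using ha 1

theorem upperCentralSeries_eq_top_iff (h : LieModule.lowerCentralSeries ℤ M M c = ⊥) {i : ℕ} :
    Subgroup.upperCentralSeries G i = ⊤ ↔ LieModule.lowerCentralSeries ℤ M M i = ⊥ := by
  rw [← le_bot_iff (a := LieModule.lowerCentralSeries ℤ M M i), ← LieSubmodule.ucs_eq_top_iff,
    eq_top_iff, eq_top_iff]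
  constructor
  · intro H a _
    exact (map_mem_upperCentralSeries he h).1 (H (Subgroup.mem_top (e a)))
  · intro H g _
    obtain ⟨a, rfl⟩ := e.surjective g
    exact (map_mem_upperCentralSeries he h).2 (H (LieSubmodule.mem_top a))

theorem bch_isNilpotent (h : LieModule.lowerCentralSeries ℤ M M c = ⊥) : Group.IsNilpotent G :=
  ⟨c, (upperCentralSeries_eq_top_iff he h).2 h⟩

theorem bch_nilpotencyClass (h : LieModule.lowerCentralSeries ℤ M M c = ⊥)
    (hmin : ∀ i, LieModule.lowerCentralSeries ℤ M M i = ⊥ → c ≤ i) : Group.nilpotencyClass G = c := by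
  have := bch_isNilpotent he h
  refine le_antisymm ?_ (hmin _ ?_)
  · rw [← Subgroup.upperCentralSeries_eq_top_iff_nilpotencyClass_le, upperCentralSeries_eq_top_iff he h,
      h]
  · rw [← upperCentralSeries_eq_top_iff he h, Subgroup.upperCentralSeries_nilpotencyClass]

/-- On term `i + 1` the map `e` is a homomorphism modulo term `i`, so additive generators of the
former together with group generators for the latter suffice. -/
theorem exists_finite_lieUcs_le_closure [Module.Finite ℤ M] (i : ℕ) :
    ∃ S : Set G, S.Finite ∧ ∀ a ∈ lieUcs M i, e a ∈ Subgroup.closure S := by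
  induction i with
  | zero =>
    refine ⟨∅, Set.finite_empty, fun a ha => ?_⟩
    rw [lieUcs, LieSubmodule.ucs_zero, LieSubmodule.mem_bot] at ha
    rw [ha, bch_map_zero he]; exact one_mem _
  | succ i ih =>
    obtain ⟨S, hS, H⟩ := ih
    obtain ⟨T, hT⟩ := (inferInstance : IsNoetherian ℤ M).noetherian (lieUcs M (i + 1)).toSubmodule
    refine ⟨S ∪ e '' T, hS.union (T.finite_toSet.image e), fun a ha => ?_⟩
    set C := Subgroup.closure (S ∪ e '' (T : Set M)) with hC
    have hSC : ∀ a ∈ lieUcs M i, e a ∈ C := fun a ha =>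
      Subgroup.closure_mono Set.subset_union_left (H a ha)
    have hle : ∀ a ∈ lieUcs M i, a ∈ lieUcs M (i + 1) := fun a ha =>
      mem_lieUcs_succ.2 fun x => (lieUcs M i).lie_mem ha
    let A : AddSubgroup M :=
      { carrier := {a | a ∈ lieUcs M (i + 1) ∧ e a ∈ C}
        add_mem' := by
          rintro a b ⟨ha, ha'⟩ ⟨hb, hb'⟩
          refine ⟨add_mem ha hb, ?_⟩
          have h1 := bch_sub_add_mem_lieUcs c (mem_lieUcs_succ.1 hb a)
          have h2 := (inv_mul_mem_bchSubgroup he (lie_mem_lieUcs i) (a := bch c a b) (b := a + b)).2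
            (by rw [← neg_sub]; exact neg_mem h1)
          obtain ⟨w, hw⟩ := e.surjective ((e (bch c a b))⁻¹ * e (a + b))
          rw [← hw, map_mem_bchSubgroup] at h2
          have h3 : e (a + b) = e a * e b * e w := by rw [hw, he]; group
          rw [h3]
          exact mul_mem (mul_mem ha' hb') (hSC w h2)
        zero_mem' := ⟨zero_mem _, by rw [bch_map_zero he]; exact one_mem _⟩
        neg_mem' := by
          rintro a ⟨ha, ha'⟩
          exact ⟨neg_mem ha, by rw [bch_map_neg he]; exact inv_mem ha'⟩ }
    have hTA : (lieUcs M (i + 1)).toSubmodule ≤ AddSubgroup.toIntSubmodule A := by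
      rw [← hT, Submodule.span_le]
      intro t ht
      refine ⟨?_, Subgroup.subset_closure (Or.inr ⟨t, ht, rfl⟩)⟩
      have : t ∈ Submodule.span ℤ (T : Set M) := Submodule.subset_span ht
      rw [hT] at this
      exact this
    exact (hTA ha).2

theorem bch_fg [Module.Finite ℤ M] (h : LieModule.lowerCentralSeries ℤ M M c = ⊥) : Group.FG G := by
  obtain ⟨S, hS, H⟩ := exists_finite_lieUcs_le_closure he c
  rw [Group.fg_iff]
  refine ⟨S, ?_, hS⟩
  rw [eq_top_iff]
  intro g _
  obtain ⟨a, rfl⟩ := e.surjective g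
  apply H
  have := (LieSubmodule.ucs_eq_top_iff (⊥ : LieIdeal ℤ M) c).2 h.le
  rw [lieUcs, this]
  trivial

end Central

/-! ### The `p`-adic completion of a Lie lattice -/

section PadicInt

variable {p : ℕ} [Fact p.Prime]

theorem PadicInt.exists_forall_pow_dvd_sub (f : ℕ → ℤ) (hi : ∀ i, (p : ℤ) ^ i ∣ f (i + 1) - f i) :
    ∃ x : ℤ_[p], ∀ n, (p : ℤ_[p]) ^ n ∣ x - f n := by
  refine ⟨PadicInt.ofIntSeq _ (isCauSeq_padicNorm_of_pow_dvd_sub f p hi), fun n => ?_⟩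
  rw [← Ideal.mem_span_singleton, ← ker_toZModPow, RingHom.mem_ker, map_sub,
    toZModPow_ofIntSeq_of_pow_dvd_sub f p hi n, map_intCast, sub_self]

theorem PadicInt.eq_zero_of_forall_pow_dvd {x : ℤ_[p]} (h : ∀ n : ℕ, (p : ℤ_[p]) ^ n ∣ x) : x = 0 := by
  rw [← PadicInt.ext_of_toZModPow]
  intro n
  rw [map_zero, ← RingHom.mem_ker, ker_toZModPow, Ideal.mem_span_singleton]
  exact h n

theorem PadicInt.exists_nat_pow_dvd_sub (x : ℤ_[p]) (n : ℕ) :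
    ∃ k : ℕ, (p : ℤ_[p]) ^ n ∣ x - k :=
  ⟨x.appr n, Ideal.mem_span_singleton.1 (PadicInt.appr_spec n x)⟩

end PadicInt

section Multiples

/-- The subgroup `n M`. -/
def multiples (M : Type*) [AddCommGroup M] (n : ℕ) : AddSubgroup M := (nsmulAddMonoidHom n).range

theorem mem_multiples {M : Type*} [AddCommGroup M] {n : ℕ} {a : M} :
    a ∈ multiples M n ↔ ∃ z, n • z = a := Iff.rfl

theorem nsmul_mem_multiples {M : Type*} [AddCommGroup M] (n : ℕ) (a : M) :
    n • a ∈ multiples M n := ⟨a, rfl⟩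

theorem multiples_le_of_dvd {M : Type*} [AddCommGroup M] {m n : ℕ} (h : m ∣ n) :
    multiples M n ≤ multiples M m := by
  rintro _ ⟨z, rfl⟩
  obtain ⟨k, rfl⟩ := h
  exact ⟨k • z, (mul_nsmul' z m k).symm⟩

theorem lie_mem_multiples {M : Type*} [LieRing M] (n : ℕ) :
    ∀ x : M, ∀ a ∈ multiples M n, ⁅x, a⁆ ∈ multiples M n := by
  rintro x _ ⟨z, rfl⟩
  exact ⟨⁅x, z⁆, (lie_nsmul x z n).symm⟩

theorem finite_quotient_multiples (M : Type*) [AddCommGroup M] [Module.Finite ℤ M] {n : ℕ}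
    (hn : n ≠ 0) : Finite (M ⧸ multiples M n) := by
  have : AddGroup.FG M := Module.Finite.iff_addGroup_fg.1 inferInstance
  apply AddCommGroup.finite_of_fg_isAddTorsion
  intro x
  obtain ⟨a, rfl⟩ := QuotientAddGroup.mk_surjective x
  rw [isOfFinAddOrder_iff_nsmul_eq_zero]
  refine ⟨n, Nat.pos_of_ne_zero hn, ?_⟩
  rw [← QuotientAddGroup.mk_nsmul, QuotientAddGroup.eq_zero_iff]
  exact nsmul_mem_multiples n a

end Multiples

section Lattice

variable {Λ : Type*} [LieRing Λ] {p : ℕ} [Fact p.Prime]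

variable (Λ p) in
/-- The map from `Λ` to its `p`-adic completion. -/
def toPadic : Λ →+ ℤ_[p] ⊗[ℤ] Λ := (TensorProduct.mk ℤ ℤ_[p] Λ 1).toAddMonoidHom

theorem toPadic_lie (a b : Λ) : toPadic Λ p ⁅a, b⁆ = ⁅toPadic Λ p a, toPadic Λ p b⁆ := by
  simp [toPadic, LieAlgebra.ExtendScalars.bracket_tmul]

variable [Module.Free ℤ Λ]

instance : IsAddTorsionFree (ℤ_[p] ⊗[ℤ] Λ) where
  nsmul_right_injective := by
    intro n hn x y h
    have h' : ((n : ℤ_[p])) • x = (n : ℤ_[p]) • y := by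
      simpa only [Nat.cast_smul_eq_nsmul] using h
    exact smul_right_injective _ (Nat.cast_ne_zero.2 hn) h'

variable [Module.Finite ℤ Λ]

variable (Λ p) in
/-- A basis of the `p`-adic completion consisting of elements of `Λ`. -/
def padicBasis : Module.Basis (Module.Free.ChooseBasisIndex ℤ Λ) ℤ_[p] (ℤ_[p] ⊗[ℤ] Λ) :=
  (Module.Free.chooseBasis ℤ Λ).baseChange ℤ_[p]

theorem padicBasis_repr_toPadic (a : Λ) (i) :
    (padicBasis Λ p).repr (toPadic Λ p a) i = ((Module.Free.chooseBasis ℤ Λ).repr a i : ℤ_[p]) := by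
  change (padicBasis Λ p).repr (1 ⊗ₜ[ℤ] a) i = _
  rw [padicBasis, Module.Basis.baseChange_repr_tmul]
  simp

theorem exists_smul_eq_iff_forall_dvd {R V ι : Type*} [CommRing R] [AddCommGroup V] [Module R V]
    [Finite ι] (b : Module.Basis ι R V) {r : R} {x : V} :
    (∃ z, r • z = x) ↔ ∀ i, r ∣ b.repr x i := by
  have := Fintype.ofFinite ι
  constructor
  · rintro ⟨z, rfl⟩ i
    exact ⟨b.repr z i, by simp⟩
  · intro h
    choose q hq using h
    refine ⟨b.equivFun.symm q, b.repr.injective ?_⟩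
    ext i
    rw [hq i, map_smul, Finsupp.smul_apply, smul_eq_mul, ← b.equivFun_apply,
      LinearEquiv.apply_symm_apply]

theorem mem_multiples_padic {k : ℕ} {x : ℤ_[p] ⊗[ℤ] Λ} : x ∈ multiples (ℤ_[p] ⊗[ℤ] Λ) (p ^ k) ↔
    ∀ i, (p : ℤ_[p]) ^ k ∣ (padicBasis Λ p).repr x i := by
  rw [← exists_smul_eq_iff_forall_dvd, mem_multiples]
  simp only [← Nat.cast_smul_eq_nsmul ℤ_[p], Nat.cast_pow]

theorem mem_multiples_int {k : ℕ} {a : Λ} : a ∈ multiples Λ (p ^ k) ↔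
    ∀ i, (p : ℤ) ^ k ∣ (Module.Free.chooseBasis ℤ Λ).repr a i := by
  rw [← exists_smul_eq_iff_forall_dvd, mem_multiples]
  simp only [← Nat.cast_smul_eq_nsmul ℤ, Nat.cast_pow]

theorem toPadic_mem_multiples {k : ℕ} {a : Λ} :
    toPadic Λ p a ∈ multiples (ℤ_[p] ⊗[ℤ] Λ) (p ^ k) ↔ a ∈ multiples Λ (p ^ k) := by
  rw [mem_multiples_padic, mem_multiples_int]
  simp only [padicBasis_repr_toPadic, PadicInt.pow_p_dvd_int_iff]

theorem exists_sub_toPadic_mem (x : ℤ_[p] ⊗[ℤ] Λ) (k : ℕ) :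
    ∃ a : Λ, x - toPadic Λ p a ∈ multiples (ℤ_[p] ⊗[ℤ] Λ) (p ^ k) := by
  choose q hq using fun i => PadicInt.exists_nat_pow_dvd_sub ((padicBasis Λ p).repr x i) k
  refine ⟨(Module.Free.chooseBasis ℤ Λ).equivFun.symm fun i => (q i : ℤ), ?_⟩
  rw [mem_multiples_padic]
  intro i
  rw [map_sub, Finsupp.sub_apply, padicBasis_repr_toPadic,
    ← Module.Basis.equivFun_apply (Module.Free.chooseBasis ℤ Λ), LinearEquiv.apply_symm_apply]
  simpa using hq i

theorem eq_zero_of_forall_mem_multiples {x : ℤ_[p] ⊗[ℤ] Λ}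
    (h : ∀ k, x ∈ multiples (ℤ_[p] ⊗[ℤ] Λ) (p ^ k)) : x = 0 := by
  apply (padicBasis Λ p).repr.injective
  ext i
  rw [map_zero, Finsupp.zero_apply]
  exact PadicInt.eq_zero_of_forall_pow_dvd fun k => mem_multiples_padic.1 (h k) i

theorem exists_limit {b : ℕ → Λ} (hb : ∀ k, b (k + 1) - b k ∈ multiples Λ (p ^ k)) :
    ∃ x, ∀ k, x - toPadic Λ p (b k) ∈ multiples (ℤ_[p] ⊗[ℤ] Λ) (p ^ k) := by
  choose q hq using fun i => PadicInt.exists_forall_pow_dvd_sub (p := p)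
    (fun k => (Module.Free.chooseBasis ℤ Λ).repr (b k) i) fun k => by
      have := mem_multiples_int.1 (hb k) i
      rwa [map_sub, Finsupp.sub_apply] at this
  refine ⟨(padicBasis Λ p).equivFun.symm q, fun k => ?_⟩
  rw [mem_multiples_padic]
  intro i
  rw [map_sub, Finsupp.sub_apply, padicBasis_repr_toPadic,
    ← Module.Basis.equivFun_apply (padicBasis Λ p), LinearEquiv.apply_symm_apply]
  exact hq i k

/-- The part of `n` prime to `p` is a unit of `ℤ_[p]`, so the exponent is the valuation of `n`. -/
theorem exists_multiples_pow_le {V : Type*} [AddCommGroup V] [Module ℤ_[p] V] {n : ℕ} (hn : n ≠ 0) :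
    ∃ k, multiples V (p ^ k) ≤ multiples V n := by
  have hn' : (n : ℤ_[p]) ≠ 0 := Nat.cast_ne_zero.2 hn
  refine ⟨(n : ℤ_[p]).valuation, ?_⟩
  rintro _ ⟨z, rfl⟩
  refine ⟨((PadicInt.unitCoeff hn')⁻¹ : ℤ_[p]ˣ).val • z, ?_⟩
  change n • _ = (p ^ _) • z
  rw [← Nat.cast_smul_eq_nsmul ℤ_[p], ← Nat.cast_smul_eq_nsmul ℤ_[p], smul_smul]
  congr 1
  rw [mul_comm, Units.inv_mul_eq_iff_eq_mul, Nat.cast_pow]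
  exact PadicInt.unitCoeff_spec hn'

theorem finite_quotient_multiples_padic {n : ℕ} (hn : n ≠ 0) :
    Finite ((ℤ_[p] ⊗[ℤ] Λ) ⧸ multiples (ℤ_[p] ⊗[ℤ] Λ) n) := by
  obtain ⟨k, hle⟩ := exists_multiples_pow_le (p := p) (V := ℤ_[p] ⊗[ℤ] Λ) hn
  have := finite_quotient_multiples Λ (pow_ne_zero k (Fact.out : p.Prime).ne_zero)
  have hmap : multiples Λ (p ^ k) ≤ (multiples (ℤ_[p] ⊗[ℤ] Λ) n).comap (toPadic Λ p) :=
    fun a ha => hle (toPadic_mem_multiples.2 ha)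
  refine Finite.of_surjective (QuotientAddGroup.map _ _ (toPadic Λ p) hmap) fun y => ?_
  obtain ⟨x, rfl⟩ := QuotientAddGroup.mk_surjective y
  obtain ⟨a, ha⟩ := exists_sub_toPadic_mem x k
  refine ⟨QuotientAddGroup.mk a, ?_⟩
  rw [QuotientAddGroup.map_mk, QuotientAddGroup.eq, neg_add_eq_sub]
  exact hle ha

end Lattice

/-! ### The pro-`p` completion -/

section Completion

variable {Λ : Type*} [LieRing Λ] [IsAddTorsionFree Λ] {c : ℕ} {Γ : Type*} [Group Γ]
  {e : Λ ≃ Γ} (he : ∀ a b, e a * e b = e (bch c a b)) {p : ℕ} [Fact p.Prime]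

include he in
theorem mk_eq_mk_of_sub_mem (N : Subgroup Γ) {k : ℕ} (hN : ∀ z : Λ, e (p ^ k • z) ∈ N) {a b : Λ}
    (h : b - a ∈ multiples Λ (p ^ k)) : (QuotientGroup.mk (e a) : Γ ⧸ N) = QuotientGroup.mk (e b) := by
  rw [QuotientGroup.eq]
  obtain ⟨w, hw⟩ := e.surjective ((e a)⁻¹ * e b)
  have := (inv_mul_mem_bchSubgroup he (lie_mem_multiples (M := Λ) (p ^ k)) (a := a) (b := b)).2 h
  rw [← hw, map_mem_bchSubgroup] at this
  obtain ⟨z, rfl⟩ := this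
  rw [← hw]
  exact hN z

variable (p) in
/-- The level of a subgroup of index `p ^ k`. -/
def PIndexSubgroup.level (N : PIndexSubgroup p Γ) : ℕ := N.2.2.choose

include he in
-- A normal subgroup of index `p ^ k` contains all `p ^ k`-th powers, that is, the image of `p ^ k
-- Λ`; so these images are cofinal.
theorem PIndexSubgroup.map_pow_level_smul_mem (N : PIndexSubgroup p Γ) (z : Λ) :
    e (p ^ N.level p • z) ∈ N.1 := by
  rw [bch_map_nsmul he, ← show N.1.index = p ^ N.level p from N.2.2.choose_spec]
  exact N.1.pow_index_mem (e z)

variable [Module.Finite ℤ Λ]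

/-- The subgroup of `p ^ k`-multiples as a subgroup of `p`-power index. -/
def powSubgroup (k : ℕ) : PIndexSubgroup p Γ :=
  ⟨bchSubgroup he (multiples Λ (p ^ k)) fun x _ => lie_mem_multiples (p ^ k) x,
    bchSubgroup_normal he (lie_mem_multiples (p ^ k)), by
    set H := bchSubgroup he (multiples Λ (p ^ k)) fun x _ => lie_mem_multiples (p ^ k) x with hH
    have : H.Normal := bchSubgroup_normal he (lie_mem_multiples (p ^ k))
    have hfin := finite_quotient_multiples Λ (pow_ne_zero k (Fact.out : p.Prime).ne_zero)
    have : Finite (Γ ⧸ H) := by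
      refine Finite.of_surjective (fun x : Λ ⧸ multiples Λ (p ^ k) =>
        (QuotientGroup.mk (e (Quotient.out x)) : Γ ⧸ H)) fun y => ?_
      obtain ⟨g, rfl⟩ := QuotientGroup.mk_surjective y
      obtain ⟨a, rfl⟩ := e.surjective g
      refine ⟨QuotientAddGroup.mk a, ?_⟩
      rw [QuotientGroup.eq, hH, inv_mul_mem_bchSubgroup he (lie_mem_multiples (p ^ k)),
        ← neg_add_eq_sub, ← QuotientAddGroup.eq]
      exact QuotientAddGroup.out_eq' _
    -- Every `p ^ k`-th power lies in `H`, so the finite quotient is a `p`-group and its order a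
    -- power of `p`.
    have hp : IsPGroup p (Γ ⧸ H) := by
      intro y
      obtain ⟨g, rfl⟩ := QuotientGroup.mk_surjective y
      obtain ⟨a, rfl⟩ := e.surjective g
      refine ⟨k, ?_⟩
      rw [← QuotientGroup.mk_pow, QuotientGroup.eq_one_iff, ← bch_map_nsmul he, hH,
        map_mem_bchSubgroup]
      exact nsmul_mem_multiples _ a
    exact hp.exists_card_eq⟩

theorem map_mem_powSubgroup {k : ℕ} {a : Λ} :
    e a ∈ (powSubgroup he k : PIndexSubgroup p Γ).1 ↔ a ∈ multiples Λ (p ^ k) :=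
  map_mem_bchSubgroup he (hS := fun x _ => lie_mem_multiples (p ^ k) x)

theorem mk_powSubgroup_eq_iff {k : ℕ} {a b : Λ} :
    (QuotientGroup.mk (e a) : Γ ⧸ (powSubgroup he k : PIndexSubgroup p Γ).1) =
      QuotientGroup.mk (e b) ↔ b - a ∈ multiples Λ (p ^ k) := by
  rw [QuotientGroup.eq]
  exact inv_mul_mem_bchSubgroup he (lie_mem_multiples (p ^ k))

variable [Module.Free ℤ Λ]

/-- An element of `Λ` congruent to `x` modulo `p ^ k`. -/
def approx (x : ℤ_[p] ⊗[ℤ] Λ) (k : ℕ) : Λ := (exists_sub_toPadic_mem x k).choose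

theorem sub_approx_mem (x : ℤ_[p] ⊗[ℤ] Λ) (k : ℕ) :
    x - toPadic Λ p (approx x k) ∈ multiples (ℤ_[p] ⊗[ℤ] Λ) (p ^ k) :=
  (exists_sub_toPadic_mem x k).choose_spec

omit [IsAddTorsionFree Λ] in
theorem sub_mem_of_sub_toPadic_mem {x : ℤ_[p] ⊗[ℤ] Λ} {k l m : ℕ} (hk : m ≤ k) (hl : m ≤ l) {a b : Λ}
    (ha : x - toPadic Λ p a ∈ multiples (ℤ_[p] ⊗[ℤ] Λ) (p ^ k))
    (hb : x - toPadic Λ p b ∈ multiples (ℤ_[p] ⊗[ℤ] Λ) (p ^ l)) : b - a ∈ multiples Λ (p ^ m) := by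
  rw [← toPadic_mem_multiples (p := p), map_sub]
  have := sub_mem (multiples_le_of_dvd (pow_dvd_pow p hk) ha) (multiples_le_of_dvd (pow_dvd_pow p hl) hb)
  rwa [sub_sub_sub_cancel_left] at this

include he in
-- Two approximations of `x` agree to the smaller of their precisions, and either precision suffices
-- modulo `N`. Hence coordinates may be computed from any convenient approximation.
theorem mk_approx_eq (N : PIndexSubgroup p Γ) {k : ℕ} (hN : ∀ z : Λ, e (p ^ k • z) ∈ N.1)
    {x : ℤ_[p] ⊗[ℤ] Λ} {a : Λ} (h : x - toPadic Λ p a ∈ multiples (ℤ_[p] ⊗[ℤ] Λ) (p ^ k)) :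
    (QuotientGroup.mk (e (approx x (N.level p))) : Γ ⧸ N.1) = QuotientGroup.mk (e a) := by
  rcases le_total k (N.level p) with hk | hk
  · exact mk_eq_mk_of_sub_mem he N.1 hN (sub_mem_of_sub_toPadic_mem hk le_rfl (sub_approx_mem x _) h)
  · exact mk_eq_mk_of_sub_mem he N.1 (N.map_pow_level_smul_mem he)
      (sub_mem_of_sub_toPadic_mem le_rfl hk (sub_approx_mem x _) h)

/-- The map from the `p`-adic completion of the lattice to the pro-`p` completion of the group. -/
def padicExp (x : ℤ_[p] ⊗[ℤ] Λ) : proPCompletion p Γ :=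
  ⟨fun N => QuotientGroup.mk (e (approx x (N.level p))), by
    intro N M h
    change (QuotientGroup.mk (e (approx x (N.level p))) : Γ ⧸ M.1) = _
    exact (mk_approx_eq he M (fun z => h (N.map_pow_level_smul_mem he z)) (sub_approx_mem x _)).symm⟩

theorem padicExp_apply (N : PIndexSubgroup p Γ) {k : ℕ} (hN : ∀ z : Λ, e (p ^ k • z) ∈ N.1)
    {x : ℤ_[p] ⊗[ℤ] Λ} {a : Λ} (h : x - toPadic Λ p a ∈ multiples (ℤ_[p] ⊗[ℤ] Λ) (p ^ k)) :
    (padicExp he x).1 N = QuotientGroup.mk (e a) :=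
  mk_approx_eq he N hN h

theorem padicExp_mul (x y : ℤ_[p] ⊗[ℤ] Λ) :
    padicExp he x * padicExp he y = padicExp he (bch c x y) := by
  apply Subtype.ext
  funext N
  have hN := N.map_pow_level_smul_mem he
  have h := bch_sub_bch_mem c (lie_mem_multiples (p ^ N.level p)) (sub_approx_mem x (N.level p))
    (sub_approx_mem y (N.level p))
  rw [← map_bch c _ toPadic_lie] at h
  rw [padicExp_apply he N hN h, ← he]
  rfl

theorem padicExp_powSubgroup_eq_one_iff {k : ℕ} {x : ℤ_[p] ⊗[ℤ] Λ} :
    (padicExp he x).1 (powSubgroup he k) = 1 ↔ x ∈ multiples (ℤ_[p] ⊗[ℤ] Λ) (p ^ k) := by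
  rw [padicExp_apply he (powSubgroup he k)
    (fun z => (map_mem_powSubgroup he).2 (nsmul_mem_multiples _ z)) (sub_approx_mem x k),
    QuotientGroup.eq_one_iff, map_mem_powSubgroup, ← toPadic_mem_multiples (p := p)]
  rw [← add_mem_cancel_left (sub_approx_mem x k), sub_add_cancel]

theorem padicExp_level_eq_one (N : PIndexSubgroup p Γ) (z : ℤ_[p] ⊗[ℤ] Λ) :
    (padicExp he (p ^ N.level p • z)).1 N = 1 := by
  rw [padicExp_apply he N (N.map_pow_level_smul_mem he) (a := 0)
    (by rw [map_zero, sub_zero]; exact nsmul_mem_multiples _ z), bch_map_zero he]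
  rfl

/-- The coordinate at `powSubgroup` determines `x` modulo `p ^ k`, and `L` is `p`-adically
separated. -/
theorem padicExp_injective : Function.Injective (padicExp he (p := p)) := by
  intro x y h
  rw [← sub_eq_zero]
  apply eq_zero_of_forall_mem_multiples
  intro k
  have hN : ∀ z : Λ, e (p ^ k • z) ∈ (powSubgroup he k : PIndexSubgroup p Γ).1 := fun z =>
    (map_mem_powSubgroup he).2 (nsmul_mem_multiples _ z)
  have h1 := congrArg (fun f => f.1 (powSubgroup he k)) h
  simp only [padicExp_apply he (powSubgroup he k) hN (sub_approx_mem x k),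
    padicExp_apply he (powSubgroup he k) hN (sub_approx_mem y k), mk_powSubgroup_eq_iff] at h1
  rw [← toPadic_mem_multiples (p := p), map_sub] at h1
  have := sub_mem (sub_mem (sub_approx_mem x k) (sub_approx_mem y k)) h1
  convert this using 1
  abel

/-- Compatibility makes representatives of the coordinates at `powSubgroup` a `p`-adic Cauchy
sequence. Its limit has the right coordinates there, and cofinality gives the others. -/
theorem padicExp_surjective : Function.Surjective (padicExp he (p := p)) := by
  intro F
  have hex : ∀ k, ∃ b : Λ, F.1 (powSubgroup he k) = QuotientGroup.mk (e b) := by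
    intro k
    obtain ⟨g, hg⟩ := QuotientGroup.mk_surjective (F.1 (powSubgroup he k))
    obtain ⟨b, rfl⟩ := e.surjective g
    exact ⟨b, hg.symm⟩
  choose b hb using hex
  have hcompat : ∀ k, b (k + 1) - b k ∈ multiples Λ (p ^ k) := by
    intro k
    have hle : (powSubgroup he (k + 1) : PIndexSubgroup p Γ).1 ≤
        (powSubgroup he k : PIndexSubgroup p Γ).1 := by
      intro g hg
      obtain ⟨a, rfl⟩ := e.surjective g
      rw [map_mem_powSubgroup] at hg ⊢
      exact multiples_le_of_dvd (pow_dvd_pow p (Nat.le_succ k)) hg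
    have := F.2 _ _ hle
    rw [hb, hb] at this
    exact (mk_powSubgroup_eq_iff he).1 this.symm
  obtain ⟨x, hx⟩ := exists_limit hcompat
  refine ⟨x, Subtype.ext (funext fun N => ?_)⟩
  rw [padicExp_apply he N (N.map_pow_level_smul_mem he) (hx _)]
  have hle : (powSubgroup he (N.level p) : PIndexSubgroup p Γ).1 ≤ N.1 := by
    intro g hg
    obtain ⟨a, rfl⟩ := e.surjective g
    rw [map_mem_powSubgroup] at hg
    obtain ⟨z, rfl⟩ := hg
    exact N.map_pow_level_smul_mem he z
  have := F.2 _ _ hle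
  rw [hb] at this
  exact this

/-- The pro-`p` completion of the group is the group on the `p`-adic completion of the lattice. -/
def padicExpEquiv : ℤ_[p] ⊗[ℤ] Λ ≃ proPCompletion p Γ :=
  Equiv.ofBijective (padicExp he) ⟨padicExp_injective he, padicExp_surjective he⟩

end Completion

/-! ### Homomorphisms of groups with a Hausdorff product over the `p`-adic integers -/

section Asymptotics

variable {M : Type*} [LieRing M] [IsAddTorsionFree M]

/-- Dividing by `t` and letting `t = p ^ k` tend to `0` recovers addition from the product. -/
theorem exists_bch_smul_eq (c t : ℕ) (a b : M) :
    ∃ w, bch c (t • a) (t • b) = t • (a + b) + t ^ 2 • w := by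
  refine ⟨∑ n ∈ Finset.Icc 2 c, t ^ (n - 2) • scaledEval c n a b, ?_⟩
  rw [bch, smul_add, Finset.smul_sum]
  congr 1
  refine Finset.sum_congr rfl fun n hn => ?_
  rw [smul_smul, ← pow_add, Nat.add_sub_cancel' (Finset.mem_Icc.1 hn).1, ← natCast_zsmul,
    ← natCast_zsmul, scaledEval_smul hn, ← natCast_zsmul, Nat.cast_pow]

theorem exists_bch_smul_sub_eq {c : ℕ} (hc : 2 ≤ c) (t : ℕ) (a b : M) :
    ∃ w, bch c (t • a) (t • b) - bch c (t • b) (t • a) =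
      t ^ 2 • (hausdorffDenom c • ⁅a, b⁆ + t • w) := by
  refine ⟨∑ n ∈ (Finset.Icc 2 c).erase 2,
    -- With the quadratic term removed `n ≥ 3`, so the subtraction is not truncated.
    t ^ (n - 3) • (scaledEval c n a b - scaledEval c n b a), ?_⟩
  have h2 : 2 ∈ Finset.Icc 2 c := Finset.mem_Icc.2 ⟨le_rfl, hc⟩
  have hs : ∀ n ∈ Finset.Icc 2 c, scaledEval c n (t • a) (t • b) - scaledEval c n (t • b) (t • a) =
      t ^ n • (scaledEval c n a b - scaledEval c n b a) := by
    intro n hn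
    rw [← natCast_zsmul, ← natCast_zsmul, scaledEval_smul hn, scaledEval_smul hn, ← smul_sub,
      ← natCast_zsmul, Nat.cast_pow]
  rw [bch, bch, add_comm (t • b), add_sub_add_left_eq_sub, ← Finset.sum_sub_distrib,
    ← Finset.add_sum_erase _ _ h2, hs 2 h2, scaledEval_two_sub hc, smul_add, Finset.smul_sum,
    Finset.smul_sum]
  congr 1
  refine Finset.sum_congr rfl fun n hn => ?_
  rw [hs n (Finset.mem_of_mem_erase hn), smul_smul, smul_smul, ← pow_succ, ← pow_add]
  have h3 := Finset.mem_erase.1 hn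
  have h4 := Finset.mem_Icc.1 h3.2
  congr 2
  omega

end Asymptotics

/-! ### Comparison of subgroup and sublattice indices -/

section Index

variable {M : Type*} [LieRing M] [IsAddTorsionFree M] {c : ℕ} {G : Type*} [Group G] {e : M ≃ G}
  (he : ∀ a b, e a * e b = e (bch c a b))

theorem relIndex_bchSubgroup {I : AddSubgroup M} (hI : ∀ x : M, ∀ a ∈ I, ⁅x, a⁆ ∈ I)
    {S : AddSubgroup M} (hS : ∀ a ∈ S, ∀ b ∈ S, ⁅a, b⁆ ∈ S) :
    (bchSubgroup he I fun x _ => hI x).relIndex (bchSubgroup he S hS) = I.relIndex S := by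
  let E : S ≃ bchSubgroup he S hS :=
    e.subtypeEquiv fun a => (map_mem_bchSubgroup he (hS := hS)).symm
  refine (Nat.card_congr (Quotient.congr E fun a b => ?_)).symm
  rw [QuotientAddGroup.leftRel_apply, QuotientGroup.leftRel_apply, AddSubgroup.mem_addSubgroupOf, Subgroup.mem_subgroupOf]
  change -a.1 + b.1 ∈ I ↔ (e a.1)⁻¹ * e b.1 ∈ _
  rw [inv_mul_mem_bchSubgroup he hI, neg_add_eq_sub]

/-- Cosets of `S` need not correspond when `S` is not an ideal. Both indices are therefore computed
through an ideal `I ≤ S` of finite index, whose cosets do. -/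
theorem index_bchSubgroup {I : AddSubgroup M} (hI : ∀ x : M, ∀ a ∈ I, ⁅x, a⁆ ∈ I)
    (hfin : I.index ≠ 0) {S : AddSubgroup M} (hS : ∀ a ∈ S, ∀ b ∈ S, ⁅a, b⁆ ∈ S) (hIS : I ≤ S) :
    (bchSubgroup he S hS).index = S.index := by
  have htop : bchSubgroup he ⊤ (fun _ _ _ _ => AddSubgroup.mem_top _) = ⊤ := by
    rw [eq_top_iff]
    intro g _
    exact AddSubgroup.mem_top (e.symm g)
  have h1 : (bchSubgroup he I fun x _ => hI x).index = I.index := by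
    rw [← Subgroup.relIndex_top_right, ← htop, relIndex_bchSubgroup he hI,
      AddSubgroup.relIndex_top_right]
  have hle : (bchSubgroup he I fun x _ => hI x) ≤ bchSubgroup he S hS := fun g hg => hIS hg
  have h2 := Subgroup.relIndex_mul_index hle
  rw [relIndex_bchSubgroup he hI, h1, ← AddSubgroup.relIndex_mul_index hIS] at h2
  refine mul_left_cancel₀ (left_ne_zero_of_mul (b := S.index) ?_) h2
  rwa [AddSubgroup.relIndex_mul_index hIS]

end Index

section Hom

variable {p : ℕ} [Fact p.Prime] {L : Type*} [LieRing L] [LieAlgebra ℤ_[p] L]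
  (hsep : ∀ x : L, (∀ k, x ∈ multiples L (p ^ k)) → x = 0)

include hsep in
/-- Additive maps between `p`-adically separated modules are `p`-adically linear. -/
theorem AddMonoidHom.map_padicInt_smul (f : L →+ L) (r : ℤ_[p]) (x : L) : f (r • x) = r • f x := by
  rw [← sub_eq_zero]
  apply hsep
  intro k
  obtain ⟨q, s, hs⟩ := PadicInt.exists_nat_pow_dvd_sub r k
  have hr : ∀ y : L, r • y = q • y + p ^ k • (s • y) := by
    intro y
    rw [← Nat.cast_smul_eq_nsmul ℤ_[p], ← Nat.cast_smul_eq_nsmul ℤ_[p] (p ^ k), smul_smul, ← add_smul,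
      Nat.cast_pow, ← hs, add_sub_cancel]
  refine ⟨f (s • x) - s • f x, ?_⟩
  change p ^ k • (f (s • x) - s • f x) = _
  rw [hr, hr, map_add, map_nsmul, map_nsmul, smul_sub]
  abel

variable [IsAddTorsionFree L] {c : ℕ} (hlie : c < 2 → ∀ a b : L, ⁅a, b⁆ = 0) {G : Type*} [Group G]
  {e : L ≃ G} (he : ∀ a b, e a * e b = e (bch c a b)) (F : G →* G)

/-- A group homomorphism transported to the Lie algebra. -/
def bchHomFun (e : L ≃ G) (F : G →* G) (a : L) : L := e.symm (F (e a))

omit [LieRing L] [LieAlgebra ℤ_[p] L] [IsAddTorsionFree L] in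
theorem map_bchHomFun (a : L) : e (bchHomFun e F a) = F (e a) := e.apply_symm_apply _

include he

theorem bchHomFun_nsmul (k : ℕ) (a : L) : bchHomFun e F (k • a) = k • bchHomFun e F a := by
  apply e.injective
  rw [map_bchHomFun, bch_map_nsmul he, bch_map_nsmul he, map_bchHomFun, map_pow]

theorem bchHomFun_bch (a b : L) :
    bchHomFun e F (bch c a b) = bch c (bchHomFun e F a) (bchHomFun e F b) := by
  apply e.injective
  rw [map_bchHomFun, ← he, ← he, map_bchHomFun, map_bchHomFun, map_mul]

/-- Elements congruent modulo `n L` differ in the group by an `n`-th power, and homomorphisms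
preserve `n`-th powers. -/
theorem bchHomFun_sub_mem {n : ℕ} {a b : L} (h : b - a ∈ multiples L n) :
    bchHomFun e F b - bchHomFun e F a ∈ multiples L n := by
  rw [← inv_mul_mem_bchSubgroup he (lie_mem_multiples n)] at h ⊢
  obtain ⟨w, hw⟩ := e.surjective ((e a)⁻¹ * e b)
  rw [← hw, map_mem_bchSubgroup] at h
  rw [map_bchHomFun, map_bchHomFun, ← map_inv, ← map_mul, ← hw, ← map_bchHomFun, map_mem_bchSubgroup]
  obtain ⟨z, rfl⟩ := h
  exact ⟨bchHomFun e F z, (bchHomFun_nsmul he F n z).symm⟩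

include hsep

theorem bchHomFun_add (a b : L) :
    bchHomFun e F (a + b) = bchHomFun e F a + bchHomFun e F b := by
  rw [← sub_eq_zero]
  apply hsep
  intro k
  have ht : p ^ k ≠ 0 := pow_ne_zero k (Fact.out : p.Prime).ne_zero
  set t := p ^ k
  obtain ⟨w, hw⟩ := exists_bch_smul_eq c t a b
  obtain ⟨w', hw'⟩ := exists_bch_smul_eq c t (bchHomFun e F a) (bchHomFun e F b)
  -- Here `t (a + b)` and `bch (t a) (t b)` agree modulo `t ^ 2`; after applying `F` and cancelling
  -- `t`, additivity holds modulo `t = p ^ k`.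
  obtain ⟨z, hz⟩ : bchHomFun e F (t • (a + b)) - bchHomFun e F (bch c (t • a) (t • b)) ∈
      multiples L (t ^ 2) := by
    apply bchHomFun_sub_mem he
    exact ⟨-w, by change t ^ 2 • -w = _; rw [hw, smul_neg]; abel⟩
  change t ^ 2 • z = _ at hz
  rw [bchHomFun_bch he, bchHomFun_nsmul he, bchHomFun_nsmul he, bchHomFun_nsmul he, hw'] at hz
  refine ⟨z + w', nsmul_right_injective ht ?_⟩
  change t • t • (z + w') = t • _
  rw [smul_smul, ← sq, smul_add, hz, smul_sub]
  abel

include hlie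

/-- The map is additive and respects `bch`, so comparing the differences at scale `t = p ^ k` and
cancelling `t ^ 2` gives `m f[a, b] ≡ m [f a, f b]` modulo `p ^ k`. Separatedness and
torsion-freeness remove `p ^ k` and `m`. For `c < 2` there is no quadratic term, and `hlie` is used
instead. -/
theorem bchHomFun_lie (a b : L) :
    bchHomFun e F ⁅a, b⁆ = ⁅bchHomFun e F a, bchHomFun e F b⁆ := by
  let f : L →+ L := AddMonoidHom.mk' (bchHomFun e F) (bchHomFun_add hsep he F)
  have hf : ∀ a, bchHomFun e F a = f a := fun _ => rfl
  rcases Nat.lt_or_ge c 2 with hc | hc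
  · rw [hlie hc, hlie hc, hf, map_zero]
  · have hm := (hausdorffDenom_pos c).ne'
    rw [← sub_eq_zero]
    refine (smul_eq_zero_iff_right hm).1 (hsep _ fun k => ?_)
    have ht : p ^ k ≠ 0 := pow_ne_zero k (Fact.out : p.Prime).ne_zero
    set t := p ^ k
    obtain ⟨w, hw⟩ := exists_bch_smul_sub_eq hc t a b
    obtain ⟨w', hw'⟩ := exists_bch_smul_sub_eq hc t (bchHomFun e F a) (bchHomFun e F b)
    have h1 := congrArg f hw
    rw [map_sub, ← hf, ← hf, bchHomFun_bch he, bchHomFun_bch he, bchHomFun_nsmul he,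
      bchHomFun_nsmul he, hw', map_nsmul] at h1
    have h2 := nsmul_right_injective (pow_ne_zero 2 ht) h1
    rw [map_add, map_nsmul, map_nsmul] at h2
    refine ⟨w' - f w, ?_⟩
    change t • (w' - f w) = _
    rw [smul_sub, smul_sub, hf ⁅a, b⁆, sub_eq_sub_iff_add_eq_add, add_comm, h2, add_comm]

/-- A homomorphism of groups with a Hausdorff product is a homomorphism of `p`-adic Lie algebras. -/
def bchHom : L →ₗ⁅ℤ_[p]⁆ L where
  toFun := bchHomFun e F
  map_add' := bchHomFun_add hsep he F
  map_smul' := AddMonoidHom.map_padicInt_smul hsep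
    (AddMonoidHom.mk' (bchHomFun e F) (bchHomFun_add hsep he F))
  map_lie' := bchHomFun_lie hsep hlie he F _ _

end Hom

/-! ### Isomorphic subgroups and isomorphic sublattices -/

section IsoSubgroups

variable {p : ℕ} [Fact p.Prime] {L : Type*} [LieRing L] [LieAlgebra ℤ_[p] L] [IsAddTorsionFree L]
  {c : ℕ} {G : Type*} [Group G] {e : L ≃ G} (he : ∀ a b, e a * e b = e (bch c a b))

/-- The subgroup on a Lie sublattice. -/
def bchLieSubgroup (S : LieSubalgebra ℤ_[p] L) : Subgroup G :=
  bchSubgroup he S.toSubmodule.toAddSubgroup fun _ ha _ hb => S.lie_mem ha hb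

theorem map_mem_bchLieSubgroup {S : LieSubalgebra ℤ_[p] L} {a : L} :
    e a ∈ bchLieSubgroup he S ↔ a ∈ S :=
  map_mem_bchSubgroup he (hS := fun _ ha _ hb => S.lie_mem ha hb)

theorem bchLieSubgroup_injective :
    Function.Injective (bchLieSubgroup he : LieSubalgebra ℤ_[p] L → Subgroup G) := by
  intro S T h
  ext a
  rw [← map_mem_bchLieSubgroup he, h, map_mem_bchLieSubgroup he]

variable (hfin : ∀ n ≠ 0, Finite (L ⧸ multiples L n))

include hfin in
theorem index_multiples_ne_zero {n : ℕ} (hn : n ≠ 0) : (multiples L n).index ≠ 0 := by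
  have := hfin n hn
  exact Nat.card_pos.ne'

theorem multiples_index_le {V : Type*} [AddCommGroup V] (S : AddSubgroup V) :
    multiples V S.index ≤ S := by
  rintro _ ⟨z, rfl⟩
  exact S.nsmul_index_mem z

include he in
-- `H` need not be normal, so only some power with exponent at most the index is known to lie in it;
-- the factorial is a multiple of every such exponent.
theorem map_nsmul_factorial_mem {H : Subgroup G} (hH : H.index ≠ 0) (a : L) :
    e (H.index.factorial • a) ∈ H := by
  obtain ⟨k, hk0, hk, hmem⟩ := Subgroup.exists_pow_mem_of_index_ne_zero hH (e a)
  obtain ⟨q, hq⟩ := Nat.dvd_factorial hk0 hk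
  rw [hq, bch_map_nsmul he, pow_mul]
  exact pow_mem hmem q

include hfin in
theorem index_bchLieSubgroup {n : ℕ} (hn : n ≠ 0) {S : LieSubalgebra ℤ_[p] L}
    (hS : multiples L n ≤ S.toSubmodule.toAddSubgroup) :
    (bchLieSubgroup he S).index = S.toSubmodule.toAddSubgroup.index :=
  index_bchSubgroup he (lie_mem_multiples n) (index_multiples_ne_zero hfin hn) _ hS

/-- An isomorphism of a Lie sublattice with the lattice as an isomorphism of groups. -/
def bchMulEquiv {S : LieSubalgebra ℤ_[p] L} (φ : S ≃ₗ⁅ℤ_[p]⁆ L) : bchLieSubgroup he S ≃* G :=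
  have hval : ∀ a b : S, (bch c a b).1 = bch c a.1 b.1 := fun a b =>
    map_bch c S.toSubmodule.toAddSubgroup.subtype (fun _ _ => rfl) a b
  have hφ : ∀ a b : S, φ (bch c a b) = bch c (φ a) (φ b) := fun a b =>
    map_bch c (φ : S →ₗ[ℤ_[p]] L).toAddMonoidHom (fun x y => LieEquiv.map_lie φ x y) a b
  let E : S ≃ bchLieSubgroup he S := e.subtypeEquiv fun a => (map_mem_bchLieSubgroup he).symm
  have hE : ∀ a b : S, E a * E b = E (bch c a b) := fun a b => by
    apply Subtype.ext
    change e a.1 * e b.1 = e (bch c a b).1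
    rw [he, hval]
  { toEquiv := E.symm.trans (φ.toLinearEquiv.toEquiv.trans e)
    map_mul' := by
      intro x y
      obtain ⟨a, rfl⟩ := E.surjective x
      obtain ⟨b, rfl⟩ := E.surjective y
      rw [hE]
      change e (φ (E.symm (E (bch c a b)))) = e (φ (E.symm (E a))) * e (φ (E.symm (E b)))
      rw [E.symm_apply_apply, E.symm_apply_apply, E.symm_apply_apply, hφ, he] }

variable (hsep : ∀ x : L, (∀ k, x ∈ multiples L (p ^ k)) → x = 0)
  (hlie : c < 2 → ∀ a b : L, ⁅a, b⁆ = 0)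

include hfin hsep hlie

/-- The inverse of `H ≃* G`, followed by the inclusion, is an injective endomorphism of `G`; by
`bchHom` it is Lie, and its range is the sublattice underlying `H`. Conversely, a Lie isomorphism
respects `bch`. -/
theorem isoSubgroups_eq_image {n : ℕ} (hn : n ≠ 0) :
    isoSubgroups G n = bchLieSubgroup he '' isoSublattices ℤ_[p] L n := by
  ext H
  constructor
  · rintro ⟨hH, ⟨ψ⟩⟩
    set F : G →* G := H.subtype.comp ψ.symm.toMonoidHom with hF
    have hFinj : Function.Injective F := H.subtype_injective.comp ψ.symm.injective
    set f := bchHom hsep hlie he F with hf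
    have hfe : ∀ a, e (f a) = F (e a) := map_bchHomFun F
    have hfinj : Function.Injective f := by
      intro a b h
      exact e.injective (hFinj (by rw [← hfe, ← hfe, h]))
    have hHS : bchLieSubgroup he f.range = H := by
      ext g
      obtain ⟨a, rfl⟩ := e.surjective g
      rw [map_mem_bchLieSubgroup, LieHom.mem_range]
      constructor
      · rintro ⟨b, rfl⟩
        rw [hfe]
        exact (ψ.symm (e b)).2
      · intro h
        refine ⟨e.symm (ψ ⟨e a, h⟩), e.injective ?_⟩
        rw [hfe, Equiv.apply_symm_apply, hF]
        change ((ψ.symm (ψ ⟨e a, h⟩)) : G) = e a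
        rw [MulEquiv.symm_apply_apply]
    have hle : multiples L H.index.factorial ≤ f.range.toSubmodule.toAddSubgroup := by
      rintro _ ⟨z, rfl⟩
      refine (map_mem_bchLieSubgroup he (S := f.range)).1 ?_
      rw [hHS]
      exact map_nsmul_factorial_mem he (hH ▸ hn) z
    refine ⟨f.range, ⟨?_, ⟨(LieEquiv.ofInjective f hfinj).symm⟩⟩, hHS⟩
    rw [← index_bchLieSubgroup he hfin (Nat.factorial_ne_zero _) hle, hHS, hH]
  · rintro ⟨S, ⟨hS, ⟨φ⟩⟩, rfl⟩
    refine ⟨?_, ⟨bchMulEquiv he φ⟩⟩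
    have hle := multiples_index_le S.toSubmodule.toAddSubgroup
    rw [hS] at hle
    rw [index_bchLieSubgroup he hfin hn hle, hS]

include he in
theorem ncard_isoSubgroups {n : ℕ} (hn : n ≠ 0) :
    (isoSubgroups G n).ncard = (isoSublattices ℤ_[p] L n).ncard := by
  rw [isoSubgroups_eq_image he hfin hsep hlie hn,
    Set.ncard_image_of_injective _ (bchLieSubgroup_injective he)]

omit hsep hlie [IsAddTorsionFree L] in
-- A sublattice of index `n` contains `n L`, so it is determined by its image in the finite
-- quotient.
theorem finite_isoSublattices {n : ℕ} (hn : n ≠ 0) : (isoSublattices ℤ_[p] L n).Finite := by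
  have := hfin n hn
  let g : LieSubalgebra ℤ_[p] L → Set (L ⧸ multiples L n) := fun S => QuotientAddGroup.mk '' (S : Set L)
  refine Set.Finite.of_finite_image (f := g) (Set.toFinite _) ?_
  have key : ∀ S ∈ isoSublattices ℤ_[p] L n, ∀ a : L,
      (QuotientAddGroup.mk a : L ⧸ multiples L n) ∈ g S ↔ a ∈ S := by
    rintro S ⟨hS, -⟩ a
    have hle := multiples_index_le S.toSubmodule.toAddSubgroup
    rw [hS] at hle
    constructor
    · rintro ⟨b, hb, h⟩
      have := S.add_mem hb (hle (QuotientAddGroup.eq.1 h))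
      rwa [add_neg_cancel_left] at this
    · intro h
      exact ⟨a, h, rfl⟩
  intro S hS T hT h
  ext a
  rw [← key S hS, ← key T hT]
  exact Set.ext_iff.1 h _

end IsoSubgroups

/-! ### Continuity -/

section Continuity

variable {p : ℕ} {Γ : Type*} [Group Γ]

theorem proPCompletion.isOpen_coord (N : PIndexSubgroup p Γ) (q : Γ ⧸ N.1) :
    IsOpen {h : proPCompletion p Γ | h.1 N = q} := by
  let _ : ∀ N : PIndexSubgroup p Γ, TopologicalSpace (Γ ⧸ N.1) := fun _ => ⊥
  have : ∀ N : PIndexSubgroup p Γ, DiscreteTopology (Γ ⧸ N.1) := fun _ => ⟨rfl⟩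
  have : Continuous fun h : proPCompletion p Γ => h.1 N :=
    (continuous_apply N).comp continuous_induced_dom
  exact (isOpen_discrete {q}).preimage this

/-- A homomorphism to the pro-`p` completion is continuous if each coordinate is trivial on the
kernel of some coordinate of a continuous homomorphism. -/
theorem proPCompletion.continuous_of_forall_exists {Y : Type*} [Group Y] [TopologicalSpace Y]
    (ρ : Y →* proPCompletion p Γ) (hρ : Continuous ρ) (F : Y →* proPCompletion p Γ)
    (h : ∀ N, ∃ K, ∀ y, (ρ y).1 K = 1 → (F y).1 N = 1) : Continuous F := by
  let _ : ∀ N : PIndexSubgroup p Γ, TopologicalSpace (Γ ⧸ N.1) := fun _ => ⊥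
  have : ∀ N : PIndexSubgroup p Γ, DiscreteTopology (Γ ⧸ N.1) := fun _ => ⟨rfl⟩
  refine continuous_induced_rng.2 (continuous_pi fun N => continuous_discrete_rng.2 fun q => ?_)
  obtain ⟨K, hK⟩ := h N
  rw [isOpen_iff_forall_mem_open]
  intro y hy
  refine ⟨{z | (ρ z).1 K = (ρ y).1 K}, fun z hz => ?_,
    (proPCompletion.isOpen_coord K ((ρ y).1 K)).preimage hρ, rfl⟩
  have h1 : (F (y⁻¹ * z)).1 N = 1 := by
    apply hK
    rw [map_mul, map_inv]
    change ((ρ y).1 K)⁻¹ * (ρ z).1 K = 1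
    rw [inv_mul_eq_one]; exact Eq.symm hz
  rw [map_mul, map_inv] at h1
  change ((F y).1 N)⁻¹ * (F z).1 N = 1 at h1
  rw [inv_mul_eq_one] at h1
  exact h1.symm.trans hy

end Continuity

/-! ### Openness and automatic continuity -/

section TopIso

variable {Λ : Type*} [LieRing Λ] [IsAddTorsionFree Λ] [Module.Finite ℤ Λ] [Module.Free ℤ Λ] {c : ℕ}
  {Γ : Type*} [Group Γ] {e : Λ ≃ Γ} (he : ∀ a b, e a * e b = e (bch c a b)) {p : ℕ} [Fact p.Prime]

include he

theorem padicExpEquiv_mul (x y : ℤ_[p] ⊗[ℤ] Λ) :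
    padicExpEquiv he x * padicExpEquiv he y = padicExpEquiv he (bch c x y) := padicExp_mul he x y

theorem exists_pow_eq_of_coord_powSubgroup {k : ℕ} {g : proPCompletion p Γ}
    (hg : g.1 (powSubgroup he k) = 1) : ∃ x, g = padicExpEquiv he x ^ p ^ k ∧
      g = padicExpEquiv he (p ^ k • x) := by
  obtain ⟨y, rfl⟩ := (padicExpEquiv he).surjective g
  obtain ⟨x, rfl⟩ := (padicExp_powSubgroup_eq_one_iff he).1 hg
  exact ⟨x, bch_map_nsmul (padicExpEquiv_mul he) _ _, rfl⟩

theorem pow_level_coord_eq_one (N : PIndexSubgroup p Γ) (g : proPCompletion p Γ) :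
    (g ^ p ^ N.level p).1 N = 1 := by
  obtain ⟨x, rfl⟩ := (padicExpEquiv he).surjective g
  rw [← bch_map_nsmul (padicExpEquiv_mul he)]
  exact padicExp_level_eq_one he N x

theorem exists_pow_smul_mem {H : Subgroup (proPCompletion p Γ)} (hH : H.index ≠ 0) :
    ∃ s, ∀ x : ℤ_[p] ⊗[ℤ] Λ, padicExpEquiv he (p ^ s • x) ∈ H := by
  obtain ⟨s, hs⟩ := exists_multiples_pow_le (p := p) (V := ℤ_[p] ⊗[ℤ] Λ)
    (Nat.factorial_ne_zero H.index)
  refine ⟨s, fun x => ?_⟩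
  obtain ⟨z, hz⟩ := hs (nsmul_mem_multiples _ x)
  rw [← hz]
  exact map_nsmul_factorial_mem (padicExpEquiv_mul he) hH z

/-- `H` contains the group on some `p ^ s L`, which is the kernel of one coordinate and hence open.
-/
theorem isOpen_of_index_ne_zero {H : Subgroup (proPCompletion p Γ)} (hH : H.index ≠ 0) :
    IsOpen (H : Set (proPCompletion p Γ)) := by
  obtain ⟨s, hs⟩ := exists_pow_smul_mem he hH
  rw [isOpen_iff_forall_mem_open]
  intro g hg
  refine ⟨{h | h.1 (powSubgroup he s) = g.1 (powSubgroup he s)}, fun h hh => ?_,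
    proPCompletion.isOpen_coord _ _, rfl⟩
  have h1 : (g⁻¹ * h).1 (powSubgroup he s) = 1 := by
    change (g.1 (powSubgroup he s))⁻¹ * h.1 (powSubgroup he s) = 1
    rw [inv_mul_eq_one]; exact Eq.symm hh
  obtain ⟨x, -, hx⟩ := exists_pow_eq_of_coord_powSubgroup he h1
  have h2 : g * (g⁻¹ * h) ∈ H := H.mul_mem hg (hx ▸ hs x)
  rwa [mul_inv_cancel_left] at h2

/-- Elements near the identity are `p ^ k`-th powers, and every coordinate kills high enough
`p`-powers of any element. -/
theorem continuous_mulEquiv_symm {H : Subgroup (proPCompletion p Γ)} (ψ : H ≃* proPCompletion p Γ) :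
    Continuous ψ.symm := by
  rw [continuous_induced_rng]
  refine proPCompletion.continuous_of_forall_exists (MonoidHom.id _) continuous_id
    (H.subtype.comp ψ.symm.toMonoidHom) fun N => ⟨powSubgroup he (N.level p), fun y hy => ?_⟩
  obtain ⟨x, hx, -⟩ := exists_pow_eq_of_coord_powSubgroup he hy
  rw [MonoidHom.id_apply] at hx
  rw [hx, map_pow]
  exact pow_level_coord_eq_one he N _

theorem continuous_mulEquiv {H : Subgroup (proPCompletion p Γ)} (hH : H.index ≠ 0)
    (ψ : H ≃* proPCompletion p Γ) : Continuous ψ := by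
  obtain ⟨s, hs⟩ := exists_pow_smul_mem he hH
  refine proPCompletion.continuous_of_forall_exists H.subtype continuous_subtype_val
    -- The extra `s` makes `y` a `p ^ level`-th power of an element of `H` itself, where `ψ` is
    -- defined.
    ψ.toMonoidHom fun N => ⟨powSubgroup he (s + N.level p), fun y hy => ?_⟩
  obtain ⟨x, -, hx⟩ := exists_pow_eq_of_coord_powSubgroup he hy
  have hy' : y = ⟨_, hs x⟩ ^ p ^ N.level p := by
    apply Subtype.ext
    rw [Subgroup.coe_pow, ← bch_map_nsmul (padicExpEquiv_mul he), smul_smul, ← pow_add, add_comm,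
      ← hx]
    rfl
  rw [hy', map_pow]
  exact pow_level_coord_eq_one he N _

theorem topIsoSubgroups_eq {n : ℕ} (hn : n ≠ 0) :
    topIsoSubgroups (proPCompletion p Γ) n = isoSubgroups (proPCompletion p Γ) n := by
  ext H
  constructor
  · rintro ⟨-, hH, ⟨ψ⟩⟩
    exact ⟨hH, ⟨ψ.toMulEquiv⟩⟩
  · rintro ⟨hH, ⟨ψ⟩⟩
    have hH0 : H.index ≠ 0 := hH ▸ hn
    exact ⟨isOpen_of_index_ne_zero he hH0, hH,
      ⟨{ ψ with
          continuous_toFun := continuous_mulEquiv he hH0 ψ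
          continuous_invFun := continuous_mulEquiv_symm he ψ }⟩⟩

end TopIso

/-! ### The exponential of a Lie lattice -/

theorem lowerCentralSeries_eq_bot_of_nilpotencyLength_eq {M : Type*} [LieRing M]
    [LieRing.IsNilpotent M] {c : ℕ} (hc : LieModule.nilpotencyLength M M = c) :
    LieModule.lowerCentralSeries ℤ M M c = ⊥ := by
  have := Nat.sInf_mem (s := {k | LieModule.lowerCentralSeries ℤ M M k = ⊥})
    (LieModule.IsNilpotent.nilpotent ℤ M M)
  rw [← hc]
  exact this

theorem lie_padic_eq_zero {Λ : Type*} [LieRing Λ] {p : ℕ} [Fact p.Prime]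
    (h : ∀ a b : Λ, ⁅a, b⁆ = 0) (x y : ℤ_[p] ⊗[ℤ] Λ) : ⁅x, y⁆ = 0 := by
  induction x using TensorProduct.induction_on with
  | zero => exact zero_lie y
  | add x x' hx hx' => rw [add_lie, hx, hx', add_zero]
  | tmul r a =>
    induction y using TensorProduct.induction_on with
    | zero => exact lie_zero (r ⊗ₜ[ℤ] a : ℤ_[p] ⊗[ℤ] Λ)
    | add y y' hy hy' =>
      exact (lie_add (r ⊗ₜ[ℤ] a : ℤ_[p] ⊗[ℤ] Λ) y y').trans (by rw [hy, hy', add_zero])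
    | tmul s b => rw [LieAlgebra.ExtendScalars.bracket_tmul, h, TensorProduct.tmul_zero]

end

theorem proposition2p1 {Λ : Type*} [LieRing Λ] [Module.Free ℤ Λ] [Module.Finite ℤ Λ]
    [LieRing.IsNilpotent Λ] (c : ℕ) (hc : LieModule.nilpotencyLength Λ Λ = c) :
    ∃ hG : Group (ExpLattice Λ c),
      IsExpGroup Λ c hG ∧
      (∀ x : ExpLattice Λ c, IsOfFinOrder x → x = 1) ∧
      Group.FG (ExpLattice Λ c) ∧
      Group.IsNilpotent (ExpLattice Λ c) ∧
      Group.nilpotencyClass (ExpLattice Λ c) = c ∧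
      ∀ (p : ℕ) [Fact p.Prime], ¬ p ∣ hausdorffDenom c →
        (∀ n : ℕ, n ≠ 0 →
          (isoSublattices ℤ_[p] (ℤ_[p] ⊗[ℤ] Λ) n).Finite ∧
          (isoSubgroups (proPCompletion p (ExpLattice Λ c)) n).Finite ∧
          (isoSubgroups (proPCompletion p (ExpLattice Λ c)) n).ncard =
            (isoSublattices ℤ_[p] (ℤ_[p] ⊗[ℤ] Λ) n).ncard ∧
          (topIsoSubgroups (proPCompletion p (ExpLattice Λ c)) n).Finite ∧
          (topIsoSubgroups (proPCompletion p (ExpLattice Λ c)) n).ncard =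
            (isoSublattices ℤ_[p] (ℤ_[p] ⊗[ℤ] Λ) n).ncard) ∧
        ∀ s : ℂ,
          groupIsoZeta (proPCompletion p (ExpLattice Λ c)) s =
            lieIsoZeta ℤ_[p] (ℤ_[p] ⊗[ℤ] Λ) s ∧
          topGroupIsoZeta (proPCompletion p (ExpLattice Λ c)) s =
            lieIsoZeta ℤ_[p] (ℤ_[p] ⊗[ℤ] Λ) s := by
  have : IsAddTorsionFree Λ :=
    ⟨fun n hn x y h => smul_right_injective Λ (Int.natCast_ne_zero.2 hn) (by simpa using h)⟩
  have hbot := lowerCentralSeries_eq_bot_of_nilpotencyLength_eq hc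
  have hmin : ∀ i, LieModule.lowerCentralSeries ℤ Λ Λ i = ⊥ → c ≤ i := fun i hi =>
    hc ▸ Nat.sInf_le hi
  obtain ⟨hG, hexp, he⟩ := exists_isExpGroup hbot
  refine ⟨hG, hexp, fun x hx => bch_eq_one_of_isOfFinOrder he hx, bch_fg he hbot,
    bch_isNilpotent he hbot, bch_nilpotencyClass he hbot hmin, fun p _ _ => ?_⟩
  have hlie : c < 2 → ∀ x y : ℤ_[p] ⊗[ℤ] Λ, ⁅x, y⁆ = 0 := by
    intro hc2
    have h1 := LieModule.antitone_lowerCentralSeries ℤ Λ Λ (Nat.lt_succ_iff.1 hc2)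
    rw [hbot, le_bot_iff, ← LieModule.trivial_iff_lower_central_eq_bot] at h1
    exact lie_padic_eq_zero h1.trivial
  have hfin : ∀ n ≠ 0, Finite ((ℤ_[p] ⊗[ℤ] Λ) ⧸ multiples (ℤ_[p] ⊗[ℤ] Λ) n) := fun n hn =>
    finite_quotient_multiples_padic hn
  have hsep : ∀ x : ℤ_[p] ⊗[ℤ] Λ, (∀ k, x ∈ multiples (ℤ_[p] ⊗[ℤ] Λ) (p ^ k)) → x = 0 := fun x =>
    eq_zero_of_forall_mem_multiples
  -- This presents the completion as a group with product `bch` on `L`, so the comparison of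
  -- subgroups with sublattices applies to it.
  have hE := padicExpEquiv_mul he (p := p)
  have hcard : ∀ n ≠ 0, (isoSubgroups (proPCompletion p (ExpLattice Λ c)) n).ncard =
      (isoSublattices ℤ_[p] (ℤ_[p] ⊗[ℤ] Λ) n).ncard := fun n hn =>
    ncard_isoSubgroups hE hfin hsep hlie hn
  refine ⟨fun n hn => ?_, fun s => ⟨LSeries_congr (fun {n} hn => ?_) s,
    LSeries_congr (fun {n} hn => ?_) s⟩⟩
  · have h1 := finite_isoSublattices (p := p) hfin hn
    have h2 : (isoSubgroups (proPCompletion p (ExpLattice Λ c)) n).Finite := by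
      rw [isoSubgroups_eq_image hE hfin hsep hlie hn]
      exact h1.image _
    rw [topIsoSubgroups_eq he hn]
    exact ⟨h1, h2, hcard n hn, h2, hcard n hn⟩
  · rw [hcard n hn]
  · rw [topIsoSubgroups_eq he hn, hcard n hn]
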